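/- **Conventions.** An irreducible plane curve $Y$ is the germ at the origin of the zero set of an irreducible $f\in\mathbb C\{x,y\}$. If its tangent cone is transversal to $\{x=0\}$ and $Y$ has multiplicity $k$, then $Y$ has injective parametrizations $x=t^k$, $y=\sum_{i\ge k}c_it^i$ (convergent), and we write $y=\sum_\alpha a_\alpha x^\alpha$ with $a_{i/k}=c_i$ and $a_\alpha=0$ for the other $\alpha\in\mathbb Q$; this is a Puiseux expansion of $Y$ relatively to the coordinates $(x,y)$. The *first Puiseux exponent* of $Y$ relatively to $(x,y)$ is the smallest $\alpha>1$ (integer or not) with $a_\alpha\neq0$; it is $+\infty$ if there is none. If the tangent cone is $\{y=0\}$, this is the order of the series $\sum_\alpha a_\alpha x^\alpha$. If $Z$ is another such germ, with Puiseux expansion $y=\sum_\alpha b_\alpha x^\alpha$, and the two expansions are chosen so that they agree as far as possible, the *contact exponent* $o(Y,Z)$ is the smallest $\gamma$ with $a_\gamma\ne b_\gamma$ ($+\infty$ if $Y=Z$). For germs that are tangent to $\{x=0\}$ the first Puiseux exponent is taken relatively to $(y,x)$. For a pair with a member tangent to $\{x=0\}$, the contact exponent is computed relatively to $(y,x)$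 if both germs are transversal to $\{y=0\}$; if one germ is tangent to $\{x=0\}$ and the other to $\{y=0\}$, it is $1$. Two germs are *tangent* if they have the same tangent cone, and *transversal* if their tangent cones meet only at the origin. **Theorem.** Let $Y,Z$ be irreducible plane curves with the same tangent cone $\{y=ax\}$, $a\in\mathbb C$. Blow up the origin, and use the chart $(x,w)\mapsto(x,x(a+w))$, which is centred at the point of the exceptional divisor $E=\{x=0\}$ that corresponds to the common tangent line. Let $\widetilde Y,\widetilde Z$ be the germs at this point of the strict transforms of $Y,Z$. Let $\mu,\nu,\widetilde\mu,\widetilde\nu$ be the first Puiseux exponents of $Y,Z,\widetilde Y,\widetilde Z$ (for $Y,Z$ in the coordinates $(x,y)$; for a strict transform that is tangent to $E$, in the coordinates $(w,x)$). Assume that $\nu\le\mu$. 1. If $\nu\ge2$, then $o(\widetilde Y,\widetilde Z)=o(Y,Z)-1$, and $\widetilde Y,\widetilde Z$ are transversal to $E$. 2. If $\nu<2$ and $\mu\ge2$, then $o(\widetilde Y,\widetilde Z)=1$, and $\widetilde Z$ is tangent to $E$. 3. If $\mu<2$, then $\widetilde Y,\widetilde Z$ are tangent to $E$ and $\widetilde\mu\le\widetilde\nu$.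 Moreover: - (a) If $o(Y,Z)>\mu$, then $\mu=\nu$, $\widetilde\mu=\widetilde\nu$ and $$o(\widetilde Y,E)=o(\widetilde Z,E)=\widetilde\mu<\frac{o(Y,Z)}{\mu-1}-1=o(\widetilde Y,\widetilde Z).$$ - (b) If $o(Y,Z)=\mu$, then $\mu=\nu$ and $o(\widetilde Y,E)=o(\widetilde Z,E)=\widetilde\mu=\widetilde\nu=o(\widetilde Y,\widetilde Z)$. - (c) If $o(Y,Z)<\mu$, then $o(Y,Z)=\nu$ and $o(\widetilde Y,E)=o(\widetilde Y,\widetilde Z)=\widetilde\mu<\widetilde\nu=o(\widetilde Z,E)$. -/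

import Mathlib

open Filter Topology Asymptotics

noncomputable section

namespace PlaneCurve

/-- `f` is (a representative of) an irreducible element of the ring `ℂ{x, y}` of germs at the
origin of analytic functions: it is not a unit, and in every factorization `f = g h` one of the
factors is a unit, that is, does not vanish at the origin. -/
def IsIrreducibleGerm (f : ℂ × ℂ → ℂ) : Prop :=
  AnalyticAt ℂ f 0 ∧ f 0 = 0 ∧
    ∀ g h : ℂ × ℂ → ℂ, AnalyticAt ℂ g 0 → AnalyticAt ℂ h 0 →
      f =ᶠ[𝓝 0] g * h → g 0 ≠ 0 ∨ h 0 ≠ 0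

/-- Near the origin `Y` is the zero set of an irreducible element of `ℂ{x, y}`. Only the germ of
`Y` at the origin matters, here and below. -/
def IsIrreduciblePlaneCurve (Y : Set (ℂ × ℂ)) : Prop :=
  ∃ f : ℂ × ℂ → ℂ, IsIrreducibleGerm f ∧ ∀ᶠ p in 𝓝 (0 : ℂ × ℂ), p ∈ Y ↔ f p = 0

/-- The tangent cone at the origin. -/
def tangentCone (Y : Set (ℂ × ℂ)) : Set (ℂ × ℂ) := tangentConeAt ℂ Y 0

/-- Two germs are tangent if they have the same tangent cone (irreducible germs only have one
tangent line). -/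
def IsTangent (Y Z : Set (ℂ × ℂ)) : Prop := tangentCone Y = tangentCone Z

def IsTransversal (Y Z : Set (ℂ × ℂ)) : Prop := tangentCone Y ∩ tangentCone Z = {0}

/-- `x = t ^ k`, `y = s t` is a Puiseux expansion of the germ `Y` relatively to the coordinates
`(x, y)`. The function `s` is analytic, and `s = O(t ^ k)` says that the tangent cone is transversal
to `{x = 0}` (so that `k` is the multiplicity). The parametrization is injective near `0`, and its
image is `Y` near the origin. -/
def IsPuiseuxExpansion (Y : Set (ℂ × ℂ)) (k : ℕ) (s : ℂ → ℂ) : Prop :=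
  0 < k ∧ AnalyticAt ℂ s 0 ∧ s =O[𝓝 0] (fun t : ℂ => t ^ k) ∧
    (∃ U ∈ 𝓝 (0 : ℂ), Set.InjOn (fun t : ℂ => (t ^ k, s t)) U) ∧
    ∀ᶠ p in 𝓝 (0 : ℂ × ℂ), p ∈ Y ↔ ∃ t : ℂ, t ^ k = p.1 ∧ s t = p.2

/-- The coefficient `a_α` of `x ^ α` in the expansion `y = ∑ a_α x ^ α` given by `x = t ^ k`,
`y = s t`: the Taylor coefficient of `s` of degree `i` if `α = i / k`, and `0` if there is no such
natural number `i`. -/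
def puiseuxCoeff (k : ℕ) (s : ℂ → ℂ) (α : ℚ) : ℂ :=
  if (⌊α * k⌋₊ : ℚ) = α * k then iteratedDeriv ⌊α * k⌋₊ s 0 / (⌊α * k⌋₊.factorial : ℂ) else 0

/-- The line `{x = 0}`. -/
def yAxis : Set (ℂ × ℂ) := {p | p.1 = 0}

/-- The germ `Y` read in the coordinates `(y, x)`. -/
def swapCoords (Y : Set (ℂ × ℂ)) : Set (ℂ × ℂ) := Prod.swap ⁻¹' Y

/-- The first Puiseux exponent relatively to the coordinates `(x, y)`: the smallest exponent
`α > 1` with `a_α ≠ 0` in a Puiseux expansion of `Y` (it does not depend on the expansion), and `⊤`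
if there is none, that is, if `Y` is a line. When the tangent cone of `Y` is `{y = 0}`, it is the
order of the fractional power series `y = ∑ a_α x ^ α`. -/
def firstPuiseuxExponentIn (Y : Set (ℂ × ℂ)) : EReal :=
  sInf {e : EReal | ∃ (k : ℕ) (s : ℂ → ℂ) (α : ℚ), IsPuiseuxExpansion Y k s ∧ 1 < α ∧
    puiseuxCoeff k s α ≠ 0 ∧ e = ((α : ℝ) : EReal)}

open Classical in
/-- The first Puiseux exponent, relatively to the coordinates `(x, y)` if the tangent cone is
transversal to `{x = 0}`, and relatively to `(y, x)` if `Y` is tangent to `{x = 0}`. -/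
def firstPuiseuxExponent (Y : Set (ℂ × ℂ)) : EReal :=
  if IsTransversal Y yAxis then firstPuiseuxExponentIn Y
  else firstPuiseuxExponentIn (swapCoords Y)

/-- The contact exponent relatively to the coordinates `(x, y)`: the smallest `γ` such that
`a_γ ≠ b_γ` (`⊤` if there is none), where the Puiseux expansions `y = ∑ a_α x ^ α` of `Y` and
`y = ∑ b_α x ^ α` of `Z` are chosen so that they agree as far as possible. -/
def contactExponentIn (Y Z : Set (ℂ × ℂ)) : EReal :=
  sSup {c : EReal | ∃ (k : ℕ) (s : ℂ → ℂ) (l : ℕ) (r : ℂ → ℂ),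
    IsPuiseuxExpansion Y k s ∧ IsPuiseuxExpansion Z l r ∧
    c = sInf {e : EReal | ∃ γ : ℚ, puiseuxCoeff k s γ ≠ puiseuxCoeff l r γ ∧
      e = ((γ : ℝ) : EReal)}}

open Classical in
/-- The contact exponent `o(Y, Z)` of two irreducible germs. It is read in the coordinates `(x, y)`
if both tangent cones are transversal to `{x = 0}`, otherwise in the coordinates `(y, x)` if both
are transversal to `{y = 0}`. In the remaining case one germ is tangent to `{x = 0}` and the other
to `{y = 0}`; germs with different tangent cones have contact exponent `1`. -/
def contactExponent (Y Z : Set (ℂ × ℂ)) : EReal :=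
  if IsTransversal Y yAxis ∧ IsTransversal Z yAxis then contactExponentIn Y Z
  else if IsTransversal (swapCoords Y) yAxis ∧ IsTransversal (swapCoords Z) yAxis then
    contactExponentIn (swapCoords Y) (swapCoords Z)
  else 1

/-- The blow up of the origin of `ℂ²`, in the affine chart centred at the point of the exceptional
divisor that corresponds to the line `y = a x`. -/
def blowUp (a : ℂ) (q : ℂ × ℂ) : ℂ × ℂ := (q.1, q.1 * (a + q.2))

def exceptionalDivisor (a : ℂ) : Set (ℂ × ℂ) := blowUp a ⁻¹' {0}

/-- The strict transform of `Y`, in the same chart. -/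
def strictTransform (a : ℂ) (Y : Set (ℂ × ℂ)) : Set (ℂ × ℂ) :=
  closure (blowUp a ⁻¹' (Y \ {0}))

end PlaneCurve

end

/-! ### Analytic germs in two variables: Osgood's lemma, division by `y`, descent to `t ^ k`. -/

noncomputable section

namespace PlaneCurve

/-! All exponents are quotients of orders of vanishing.
`IsIrreduciblePlaneCurve.exists_isParam_of_tangentCone` gives $x=t^k$, $y=t^k(a+\sigma(t))$ with
$\sigma(0)=0$ for $Y$, and by `IsParam.strictTransform` the curve $x=t^k$, $w=\sigma(t)$
parametrizes $\widetilde Y$. Hence $\mu=1+\mathrm{ord}\,\sigma/k$, and $\mu\ge2$ means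
$\mathrm{ord}\,\sigma\ge k$, that is, $\widetilde Y$ is transversal to $E$. If
$p=\mathrm{ord}\,\sigma<k$, then $\widetilde Y$ is tangent to $E$, and exchanging coordinates gives
$w=\tau^p$, $x=h(\tau)$ with $h$ of order $k$; so $k/p$ is both its first exponent and its contact
exponent with $E$. `IsParam` drops the condition $s=O(t^k)$ in order to cover both situations.

For contact, parametrizations $s,r$ with denominators $k,l$ are compared over a common denominator
$N=kd=le$. They are unique up to roots of unity, so $s(t^d)-r(t^e)$ has finitely many possible
orders, and the contact exponent is the greatest one, $D$, divided by $N$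
(`contactExponentIn_eq_ordRatio`). Blowing up divides the difference by $x=t^N$ and lowers $D$ by
$N$: this is case 1. If the two orders differ, nothing cancels and $D$ is their minimum: this gives
3(c), and case 2 where the value 1 is not a convention.

There remains $p/k=q/l<1$. The inversion formula $D'+pd=D+kd$
(`exists_isGreatest_contactOrders_swap`) relates the greatest orders before and after the exchange
of coordinates. With $M=pd$ one writes the two germs as $A^M$ and $B^M$ for uniformizers $A,B$; the
exchanged germs are $N$-th powers of the inverses of $A,B$, and $A-B$ has the same order as the
difference of the inverses. Cases 3(a) and 3(b) are $D>pd$ and $D=pd$.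

Parametrizations come from the Newton-Puiseux theorem (`exists_pow_root`): it finds a curve inside
the zero set, and irreducibility makes that curve the whole zero set. The division arguments in two
variables rest on Osgood's lemma. -/

/-- Integration over a circle, as a continuous linear functional on the continuous functions on
this circle. -/
def circleFunctional (c : ℂ) (r : ℝ) (hr : 0 ≤ r) : C(Metric.sphere c r, ℂ) →L[ℂ] ℂ :=
  have hint : ∀ φ : C(Metric.sphere c r, ℂ), IntervalIntegrable
      (fun θ : ℝ => deriv (circleMap c r) θ • φ ⟨circleMap c r θ, circleMap_mem_sphere c hr θ⟩)
      MeasureTheory.volume 0 (2 * Real.pi) := fun φ => by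
    refine Continuous.intervalIntegrable ?_ _ _
    simp only [deriv_circleMap]
    have h1 : Continuous fun θ : ℝ =>
        (⟨circleMap c r θ, circleMap_mem_sphere c hr θ⟩ : Metric.sphere c r) :=
      (continuous_circleMap c r).subtype_mk _
    have := φ.continuous.comp h1
    fun_prop
  LinearMap.mkContinuous
    { toFun := fun φ => ∫ θ in (0 : ℝ)..2 * Real.pi,
        deriv (circleMap c r) θ • φ ⟨circleMap c r θ, circleMap_mem_sphere c hr θ⟩
      map_add' := fun φ ψ => by
        simp only [ContinuousMap.add_apply, smul_add]
        exact intervalIntegral.integral_add (hint φ) (hint ψ)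
      map_smul' := fun a φ => by
        simp only [ContinuousMap.smul_apply, RingHom.id_apply]
        rw [← intervalIntegral.integral_smul]
        congr 1; ext θ; simp only [smul_eq_mul]; ring }
    (r * (2 * Real.pi)) (fun φ => by
      have := intervalIntegral.norm_integral_le_of_norm_le_const (a := 0) (b := 2 * Real.pi)
        (C := r * ‖φ‖) (f := fun θ : ℝ => deriv (circleMap c r) θ •
          φ ⟨circleMap c r θ, circleMap_mem_sphere c hr θ⟩) (fun θ _ => by
          rw [norm_smul]
          refine mul_le_mul ?_ (φ.norm_coe_le_norm _) (norm_nonneg _) hr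
          simp [abs_of_nonneg hr])
      rw [sub_zero, abs_of_nonneg (by positivity)] at this
      calc _ ≤ _ := this
        _ = _ := by ring)

theorem circleFunctional_apply {c : ℂ} {r : ℝ} (hr : 0 ≤ r) (φ : C(Metric.sphere c r, ℂ))
    (g : ℂ → ℂ) (h : ∀ w : Metric.sphere c r, φ w = g w) :
    circleFunctional c r hr φ = ∮ w in C(c, r), g w := by
  simp only [circleFunctional, LinearMap.mkContinuous_apply, LinearMap.coe_mk, AddHom.coe_mk,
    circleIntegral]
  simp [h]

/-- **Osgood's lemma**: a continuous function of two complex variables that is holomorphic in each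
variable is analytic. -/
theorem analyticAt_of_separately_differentiable {f : ℂ × ℂ → ℂ} {p₀ : ℂ × ℂ}
    (h : ∀ᶠ p in 𝓝 p₀, ContinuousAt f p ∧ DifferentiableAt ℂ (fun x => f (x, p.2)) p.1 ∧
      DifferentiableAt ℂ (fun y => f (p.1, y)) p.2) : AnalyticAt ℂ f p₀ := by
  obtain ⟨r, hr, hball⟩ := Metric.nhds_basis_closedBall.mem_iff.1 h
  obtain ⟨x₀, y₀⟩ := p₀
  have hmem : ∀ x ∈ Metric.closedBall x₀ r, ∀ y ∈ Metric.closedBall y₀ r,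
      ContinuousAt f (x, y) ∧ DifferentiableAt ℂ (fun x => f (x, y)) x ∧
      DifferentiableAt ℂ (fun y => f (x, y)) y := by
    intro x hx y hy
    have : (x, y) ∈ Metric.closedBall (x₀, y₀) r := by
      rw [← closedBall_prod_same]; exact ⟨hx, hy⟩
    exact hball this
  have hcont : ContinuousOn f (Metric.closedBall (x₀, y₀) r) := fun p hp =>
    (hball hp).1.continuousWithinAt
  -- A Tietze extension of `f` makes `Φ` below continuous on all of `ℂ`; only values on the bidisc
  -- matter.
  obtain ⟨g, hg⟩ := ContinuousMap.exists_restrict_eq (Metric.isClosed_closedBall)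
    (⟨_, hcont.domRestrict⟩ : C(Metric.closedBall (x₀, y₀) r, ℂ))
  have hgf : ∀ x ∈ Metric.closedBall x₀ r, ∀ y ∈ Metric.closedBall y₀ r, g (x, y) = f (x, y) := by
    intro x hx y hy
    have : (x, y) ∈ Metric.closedBall (x₀, y₀) r := by
      rw [← closedBall_prod_same]; exact ⟨hx, hy⟩
    have := congrArg (fun k => k ⟨(x, y), this⟩) hg
    simpa using this
  set S := Metric.sphere y₀ r with hS
  have hSsub : ∀ w : S, (w : ℂ) ∈ Metric.closedBall y₀ r := fun w =>
    Metric.sphere_subset_closedBall w.2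
  let Φ : C(ℂ, C(S, ℂ)) := (g.comp (⟨fun p : ℂ × S => (p.1, (p.2 : ℂ)), by fun_prop⟩)).curry
  have hΦ : ∀ z w, Φ z w = g (z, w) := fun z w => rfl
  have hΦint : CircleIntegrable Φ x₀ r := (Φ.continuous.continuousOn).circleIntegrable hr.le
  -- Cauchy integral in `x` with values in the Banach space `C(S, ℂ)`: the restriction of `f (x, ·)`
  -- to the circle depends analytically on `x`.
  let Ψ : ℂ → C(S, ℂ) := fun x =>
    (2 * (Real.pi : ℂ) * Complex.I)⁻¹ • ∮ z in C(x₀, r), (z - x)⁻¹ • Φ z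
  have hΨ : AnalyticAt ℂ Ψ x₀ := by
    lift r to NNReal using hr.le
    exact (hasFPowerSeriesOn_cauchy_integral hΦint hr).analyticAt
  have hΨf : ∀ x ∈ Metric.ball x₀ r, ∀ w : S, Ψ x w = f (x, w) := by
    intro x hx w
    have key := Complex.two_pi_I_inv_smul_circleIntegral_sub_inv_smul_of_differentiable_on_off_countable
      (s := ∅) Set.countable_empty hx (f := fun x => f (x, w)) ?_ ?_
    · rw [← key]
      simp only [Ψ, ContinuousMap.smul_apply]
      congr 1
      let ev : C(S, ℂ) →L[ℂ] ℂ := ContinuousMap.evalCLM ℂ w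
      change ev (∮ z in C(x₀, r), (z - x)⁻¹ • Φ z) = _
      unfold circleIntegral
      rw [← ContinuousLinearMap.intervalIntegral_comp_comm]
      · refine intervalIntegral.integral_congr fun θ _ => ?_
        have h1 : circleMap x₀ r θ ∈ Metric.closedBall x₀ r := circleMap_mem_closedBall x₀ hr.le θ
        simp only [map_smul]
        congr 2
        exact hgf _ h1 _ (hSsub w)
      · have h2 : CircleIntegrable (fun z => (z - x)⁻¹ • Φ z) x₀ r := by
          refine ContinuousOn.circleIntegrable hr.le fun z hz => ?_
          refine ContinuousAt.continuousWithinAt ?_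
          have hne : z - x ≠ 0 := by
            intro h0
            rw [sub_eq_zero.1 h0, Metric.mem_sphere] at hz
            rw [Metric.mem_ball, hz] at hx
            exact lt_irrefl _ hx
          exact ((continuousAt_id.sub continuousAt_const).inv₀ hne).smul Φ.continuous.continuousAt
        exact h2.out
    · intro z hz
      exact (hmem z hz w (hSsub w)).2.1.continuousAt.continuousWithinAt
    · intro z hz
      exact (hmem z (Metric.ball_subset_closedBall hz.1) w (hSsub w)).2.1
  let ι : C(S, ℂ) := ⟨fun w => (w : ℂ), by fun_prop⟩
  -- The Cauchy kernel `w ↦ (w - y)⁻¹` as an inverse in the Banach algebra `C(S, ℂ)`, hence analytic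
  -- in `y`.
  let K : ℂ → C(S, ℂ) := fun y => Ring.inverse (ι - algebraMap ℂ C(S, ℂ) y)
  have hne : ∀ y ∈ Metric.ball y₀ r, ∀ w : S, (w : ℂ) - y ≠ 0 := by
    intro y hy w h0
    have hw := w.2
    rw [sub_eq_zero.1 h0, Metric.mem_sphere] at hw
    rw [Metric.mem_ball, hw] at hy
    exact lt_irrefl _ hy
  have hunit : ∀ y ∈ Metric.ball y₀ r, IsUnit (ι - algebraMap ℂ C(S, ℂ) y) := by
    intro y hy
    rw [ContinuousMap.isUnit_iff_forall_ne_zero]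
    exact fun w => hne y hy w
  have hK : ∀ y ∈ Metric.ball y₀ r, ∀ w : S, K y w = ((w : ℂ) - y)⁻¹ := by
    intro y hy w
    have := congrArg (fun k : C(S, ℂ) => k w) (Ring.inverse_mul_cancel _ (hunit y hy))
    exact eq_inv_of_mul_eq_one_left this
  have hKan : AnalyticAt ℂ K y₀ := by
    obtain ⟨u, hu⟩ := hunit y₀ (Metric.mem_ball_self hr)
    have h1 : AnalyticAt ℂ (fun y => ι - algebraMap ℂ C(S, ℂ) y) y₀ :=
      analyticAt_const.sub ((Algebra.linearMap ℂ C(S, ℂ)).toContinuousLinearMap.analyticAt y₀)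
    have h2 : AnalyticAt ℂ Ring.inverse (ι - algebraMap ℂ C(S, ℂ) y₀) := by
      rw [← hu]; exact analyticAt_inverse u
    exact AnalyticAt.fun_comp h2 h1
  -- By Cauchy's formula in `y` this function is `f`; it is a continuous functional of a product of
  -- analytic maps, so jointly analytic.
  have hprod : AnalyticAt ℂ (fun p : ℂ × ℂ => (2 * (Real.pi : ℂ) * Complex.I)⁻¹ •
      circleFunctional y₀ r hr.le (K p.2 * Ψ p.1)) (x₀, y₀) := by
    have h1 : AnalyticAt ℂ (fun p : ℂ × ℂ => Ψ p.1) (x₀, y₀) :=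
      AnalyticAt.fun_comp (f := Prod.fst) hΨ analyticAt_fst
    have h2 : AnalyticAt ℂ (fun p : ℂ × ℂ => K p.2) (x₀, y₀) :=
      AnalyticAt.fun_comp (f := Prod.snd) hKan analyticAt_snd
    have h3 := AnalyticAt.fun_comp ((circleFunctional y₀ r hr.le).analyticAt _) (h2.mul h1)
    simp only [smul_eq_mul]
    exact analyticAt_const.mul h3
  refine hprod.congr ?_
  filter_upwards [Metric.ball_mem_nhds (x₀, y₀) hr] with p hp
  rw [← ball_prod_same] at hp
  have key := Complex.two_pi_I_inv_smul_circleIntegral_sub_inv_smul_of_differentiable_on_off_countable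
      (s := ∅) Set.countable_empty hp.2 (f := fun y => f (p.1, y)) ?_ ?_
  · rw [circleFunctional_apply hr.le _ (fun w => (w - p.2)⁻¹ • f (p.1, w))]
    · exact key
    · intro w
      rw [ContinuousMap.mul_apply, hK _ hp.2, hΨf _ hp.1, smul_eq_mul]
  · intro z hz
    exact (hmem p.1 (Metric.ball_subset_closedBall hp.1) z hz).2.2.continuousAt.continuousWithinAt
  · intro z hz
    exact (hmem p.1 (Metric.ball_subset_closedBall hp.1) z (Metric.ball_subset_closedBall hz.1)).2.2

/-- An analytic germ that vanishes on the line `y = 0` is divisible by `y`. -/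
theorem exists_eq_snd_mul {f : ℂ × ℂ → ℂ} (hf : AnalyticAt ℂ f 0)
    (h0 : ∀ᶠ x in 𝓝 (0 : ℂ), f (x, 0) = 0) :
    ∃ h : ℂ × ℂ → ℂ, AnalyticAt ℂ h 0 ∧ ∀ᶠ p in 𝓝 (0 : ℂ × ℂ), f p = p.2 * h p := by
  have hfst : Tendsto (fun p : ℂ × ℂ => p.1) (𝓝 0) (𝓝 0) := continuous_fst.tendsto 0
  have hfst' : Tendsto (fun p : ℂ × ℂ => (p.1, (0 : ℂ))) (𝓝 0) (𝓝 0) :=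
    (Continuous.tendsto (by fun_prop) _)
  have han := hf.eventually_analyticAt
  have h0' : ∀ᶠ p in 𝓝 (0 : ℂ × ℂ), f (p.1, 0) = 0 := hfst.eventually h0
  have hslice : ∀ p : ℂ × ℂ, AnalyticAt ℂ f p → DifferentiableAt ℂ (fun y => f (p.1, y)) p.2 :=
    fun p hp => DifferentiableAt.fun_comp' (g := f) p.2 hp.differentiableAt (by fun_prop)
  have hslice' : ∀ p : ℂ × ℂ, AnalyticAt ℂ f p → DifferentiableAt ℂ (fun x => f (x, p.2)) p.1 :=
    fun p hp => DifferentiableAt.fun_comp' (g := f) p.1 hp.differentiableAt (by fun_prop)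
  -- The quotient `f / y`, completed by `∂f/∂y` on `y = 0`. Osgood's lemma reduces its analyticity
  -- to continuity and to slices.
  let h : ℂ × ℂ → ℂ := fun p => dslope (fun y => f (p.1, y)) 0 p.2
  have hderiv : ∀ x, AnalyticAt ℂ f (x, 0) →
      deriv (fun y => f (x, y)) 0 = fderiv ℂ f (x, 0) (0, 1) := by
    intro x hx
    have h1 : HasDerivAt (fun y : ℂ => (x, y)) ((0 : ℂ), (1 : ℂ)) 0 :=
      (hasDerivAt_const _ _).prodMk (hasDerivAt_id _)
    exact (hx.differentiableAt.hasFDerivAt.comp_hasDerivAt (0 : ℂ) h1).deriv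
  have hfd : ∀ p : ℂ × ℂ, AnalyticAt ℂ f (p.1, 0) →
      AnalyticAt ℂ (fun x : ℂ => fderiv ℂ f (x, 0) (0, 1)) p.1 := by
    intro p hp
    have h1 : AnalyticAt ℂ (fun x : ℂ => fderiv ℂ f (x, 0)) p.1 :=
      AnalyticAt.fun_comp (f := fun x : ℂ => (x, (0 : ℂ))) hp.fderiv (by fun_prop)
    exact AnalyticAt.fun_comp
      ((ContinuousLinearMap.apply ℂ ℂ ((0 : ℂ), (1 : ℂ))).analyticAt _) h1
  have hmul : ∀ᶠ p in 𝓝 (0 : ℂ × ℂ), f p = p.2 * h p := by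
    filter_upwards [h0'] with p hp
    have := sub_smul_dslope (fun y => f (p.1, y)) 0 p.2
    simp only [sub_zero, smul_eq_mul, hp] at this
    exact this.symm
  refine ⟨h, analyticAt_of_separately_differentiable ?_, hmul⟩
  have hopen := eventually_eventually_nhds.2 (hmul.and (han.and (h0'.and (hfst'.eventually han))))
  filter_upwards [hopen] with p hp
  have hpp := hp.self_of_nhds
  obtain ⟨x, y⟩ := p
  by_cases hy : y = 0
  · subst hy
    have hline : ∀ᶠ x' in 𝓝 x, AnalyticAt ℂ f (x', 0) :=
      ((Continuous.tendsto (f := fun x' : ℂ => (x', (0 : ℂ))) (by fun_prop) x).eventually hp).mono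
        fun _ h => h.2.2.2
    refine ⟨?_, ?_, ?_⟩
    · have hstrict := hpp.2.1.hasStrictFDerivAt
      have hc : AnalyticAt ℂ (fun x : ℂ => fderiv ℂ f (x, 0) (0, 1)) x := hfd (x, 0) hpp.2.2.2
      rw [Metric.continuousAt_iff']
      intro ε hε
      have hhx : h (x, 0) = fderiv ℂ f (x, 0) (0, 1) := by
        simp only [h, dslope_same]; exact hderiv x hpp.2.1
      have h1 := (hstrict.isLittleO).def (half_pos hε)
      have ht : Tendsto (fun p : ℂ × ℂ => (p, (p.1, (0 : ℂ)))) (𝓝 (x, 0)) (𝓝 ((x, 0), (x, 0))) :=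
        Continuous.tendsto (by fun_prop) (x, (0 : ℂ))
      have h2 := Metric.continuousAt_iff'.1 hc.continuousAt ε hε
      have h2' := (continuous_fst.tendsto (x, (0 : ℂ))).eventually h2
      have hline' := (continuous_fst.tendsto (x, (0 : ℂ))).eventually hline
      filter_upwards [ht.eventually h1, h2', hline', hp] with q hq1 hq2 hq3 hq4
      rw [hhx]
      by_cases hq : q.2 = 0
      · have : h q = fderiv ℂ f (q.1, 0) (0, 1) := by
          simp only [h, hq, dslope_same]; exact hderiv q.1 hq3
        rw [this]; exact hq2
      · have e1 : q - (q.1, 0) = q.2 • ((0 : ℂ), (1 : ℂ)) := by ext <;> simp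
        rw [hq4.2.2.1, hq4.1, e1, map_smul, smul_eq_mul, sub_zero, ← mul_sub, norm_mul,
          norm_smul] at hq1
        have hn : ‖((0 : ℂ), (1 : ℂ))‖ = 1 := by simp [Prod.norm_def]
        rw [hn, mul_one, mul_comm (ε / 2)] at hq1
        have := le_of_mul_le_mul_left hq1 (norm_pos_iff.2 hq)
        rw [dist_eq_norm]
        linarith
    · refine (hfd (x, 0) hpp.2.1).differentiableAt.congr_of_eventuallyEq ?_
      filter_upwards [hline] with x' hx'
      simp only [h, dslope_same]
      exact hderiv x' hx'
    · have hy : ∀ᶠ y in 𝓝 (0 : ℂ), AnalyticAt ℂ f (x, y) :=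
        ((Continuous.tendsto (f := fun y : ℂ => (x, y)) (by fun_prop) 0).eventually hp).mono
          fun _ h => h.2.1
      have hs : {y : ℂ | AnalyticAt ℂ f (x, y)} ∈ 𝓝 (0 : ℂ) := hy
      have := (Complex.differentiableOn_dslope (f := fun y => f (x, y)) hs).2
        (fun y hy => (hslice (x, y) hy).differentiableWithinAt)
      exact this.differentiableAt hs
  · have heq : h =ᶠ[𝓝 (x, y)] fun p => f p / p.2 := by
      have hne : ∀ᶠ p in 𝓝 (x, y), p.2 ≠ 0 :=
        (continuous_snd.tendsto (x, y)).eventually_ne hy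
      filter_upwards [hp, hne] with q hq hq'
      rw [hq.1]; field_simp
    have hd : AnalyticAt ℂ h (x, y) :=
      (hpp.2.1.div analyticAt_snd hy).congr heq.symm
    exact ⟨hd.continuousAt,
      DifferentiableAt.fun_comp' (g := h) x hd.differentiableAt (by fun_prop),
      DifferentiableAt.fun_comp' (g := h) y hd.differentiableAt (by fun_prop)⟩

/-- An analytic function of `(t, y)` that is invariant under `t ↦ ζ t` for all `k`-th roots of unity
`ζ` is an analytic function of `(t ^ k, y)`. -/
theorem exists_eq_comp_pow {k : ℕ} (hk : 0 < k) {G : ℂ × ℂ → ℂ} (hG : AnalyticAt ℂ G 0)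
    (hinv : ∀ ζ : ℂ, ζ ^ k = 1 → ∀ t y, G (ζ * t, y) = G (t, y)) :
    ∃ g : ℂ × ℂ → ℂ, AnalyticAt ℂ g 0 ∧ ∀ t y, G (t, y) = g (t ^ k, y) := by
  have hk0 : k ≠ 0 := hk.ne'
  -- An arbitrary, possibly discontinuous, choice of `k`-th roots; by invariance the value of `G`
  -- does not depend on it.
  choose ρ hρ using fun x : ℂ => IsAlgClosed.exists_pow_nat_eq x hk
  have hsame : ∀ t u y, t ^ k = u ^ k → G (t, y) = G (u, y) := by
    intro t u y h
    by_cases hu : u = 0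
    · have : t = 0 := by rw [hu, zero_pow hk0] at h; exact pow_eq_zero_iff hk0 |>.1 h
      rw [this, hu]
    · have := hinv (t / u) (by rw [div_pow, h, div_self (pow_ne_zero _ hu)]) u y
      rwa [div_mul_cancel₀ _ hu] at this
  let g : ℂ × ℂ → ℂ := fun p => G (ρ p.1, p.2)
  have hgG : ∀ t y, G (t, y) = g (t ^ k, y) := fun t y => hsame _ _ _ (hρ _).symm
  refine ⟨g, analyticAt_of_separately_differentiable ?_, hgG⟩
  have hρ0 : ρ 0 = 0 := (pow_eq_zero_iff hk0).1 (hρ 0)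
  have hρc : Tendsto ρ (𝓝 0) (𝓝 0) := by
    rw [tendsto_zero_iff_norm_tendsto_zero]
    have : (fun x => ‖ρ x‖) = fun x => ‖x‖ ^ ((k : ℝ)⁻¹) := by
      ext x
      rw [← Real.pow_rpow_inv_natCast (norm_nonneg (ρ x)) hk0, ← norm_pow, hρ]
    rw [this]
    have := (continuous_norm (E := ℂ)).rpow_const (p := (k : ℝ)⁻¹) (fun _ => Or.inr (by positivity))
    have h2 := this.tendsto 0
    rwa [norm_zero, Real.zero_rpow (by positivity)] at h2
  have hpair : Tendsto (fun p : ℂ × ℂ => (ρ p.1, p.2)) (𝓝 0) (𝓝 0) := by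
    have := (hρc.comp (continuous_fst.tendsto (0 : ℂ × ℂ))).prodMk_nhds
      (continuous_snd.tendsto (0 : ℂ × ℂ))
    exact this
  have hcover : ∀ p : ℂ × ℂ, p.1 ≠ 0 → AnalyticAt ℂ G (ρ p.1, p.2) → AnalyticAt ℂ g p := by
    rintro ⟨x, y⟩ hx hGan
    simp only at hx hGan
    have hρx : ρ x ≠ 0 := by
      intro h; apply hx; rw [← hρ x, h, zero_pow hk0]
    have hpow : AnalyticAt ℂ (fun t : ℂ => t ^ k) (ρ x) := analyticAt_id.pow k
    have hd : deriv (fun t : ℂ => t ^ k) (ρ x) ≠ 0 := by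
      rw [deriv_pow_field]
      exact mul_ne_zero (Nat.cast_ne_zero.2 hk0) (pow_ne_zero _ hρx)
    -- Away from `x = 0` an analytic branch of the root may replace `ρ`.
    let r := hpow.hasStrictDerivAt.localInverse _ _ _ hd
    have hr : AnalyticAt ℂ r x := by
      have := hpow.analyticAt_localInverse hd
      simp only [hρ] at this
      exact this
    have hrx : r x = ρ x := by
      have : r ((ρ x) ^ k) = ρ x := HasStrictFDerivAt.localInverse_apply_image ..
      rwa [hρ] at this
    have hrk : ∀ᶠ z in 𝓝 x, r z ^ k = z := by
      have := HasStrictDerivAt.eventually_right_inverse hpow.hasStrictDerivAt hd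
      simp only [hρ] at this
      exact this
    have h1 : AnalyticAt ℂ (fun p : ℂ × ℂ => G (r p.1, p.2)) (x, y) := by
      refine AnalyticAt.fun_comp (g := G) (f := fun p : ℂ × ℂ => (r p.1, p.2)) ?_ ?_
      · simpa only [hrx] using hGan
      · exact (AnalyticAt.fun_comp (f := Prod.fst) hr analyticAt_fst).prod analyticAt_snd
    refine h1.congr ?_
    filter_upwards [(continuous_fst.tendsto (x, y)).eventually hrk] with q hq
    rw [hgG, hq]
  have hslice : ∀ p : ℂ × ℂ, AnalyticAt ℂ G p → DifferentiableAt ℂ (fun y => G (p.1, y)) p.2 :=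
    fun p hp => DifferentiableAt.fun_comp' (g := G) p.2 hp.differentiableAt (by fun_prop)
  filter_upwards [eventually_eventually_nhds.2 (hpair.eventually hG.eventually_analyticAt)]
    with p hp
  obtain ⟨x, y⟩ := p
  by_cases hx : x = 0
  · subst hx
    have hG0 : AnalyticAt ℂ G (0, y) := by
      have := hp.self_of_nhds
      simpa only [hρ0] using this
    have hgc : ContinuousAt g (0, y) := by
      have h1 : Tendsto (fun p : ℂ × ℂ => (ρ p.1, p.2)) (𝓝 (0, y)) (𝓝 (0, y)) :=
        (hρc.comp (continuous_fst.tendsto ((0 : ℂ), y))).prodMk_nhds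
          (continuous_snd.tendsto ((0 : ℂ), y))
      have h2 := hG0.continuousAt.tendsto.comp h1
      have h3 : g (0, y) = G (0, y) := by simp only [g, hρ0]
      rw [ContinuousAt, h3]
      exact h2
    refine ⟨hgc, ?_, ?_⟩
    -- On `x = 0` no branch exists, but the singularity in `x` is removable by continuity.
    · refine (Complex.analyticAt_of_differentiable_on_punctured_nhds_of_continuousAt
        (f := fun x => g (x, y)) ?_ ?_).differentiableAt
      · have h1 := (Continuous.tendsto (f := fun x : ℂ => (x, y)) (by fun_prop) 0).eventually hp
        filter_upwards [h1.filter_mono nhdsWithin_le_nhds, self_mem_nhdsWithin] with z hz hz0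
        exact DifferentiableAt.fun_comp' (g := g) z (hcover (z, y) hz0 hz).differentiableAt
          (by fun_prop)
      · exact ContinuousAt.comp' (g := g) (f := fun x : ℂ => (x, y)) (x := (0 : ℂ)) hgc
          (by fun_prop)
    · have : (fun y => g (0, y)) = fun y => G (0, y) := by ext y; simp only [g, hρ0]
      simp only [this]
      exact hslice (0, y) hG0
  · have hd := hcover (x, y) hx hp.self_of_nhds
    exact ⟨hd.continuousAt,
      DifferentiableAt.fun_comp' (g := g) x hd.differentiableAt (by fun_prop),
      DifferentiableAt.fun_comp' (g := g) y hd.differentiableAt (by fun_prop)⟩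

end PlaneCurve

end

/-! ### Taylor expansion in `y` and the Newton-Puiseux theorem. -/

noncomputable section

namespace PlaneCurve

attribute [fun_prop] analyticAt_fst analyticAt_snd

/-- Taylor expansion with respect to the second variable. -/
theorem exists_eq_sum_add_snd_pow_mul {f : ℂ × ℂ → ℂ} (hf : AnalyticAt ℂ f 0) (n : ℕ) :
    ∃ (a : ℕ → ℂ → ℂ) (h : ℂ × ℂ → ℂ), (∀ j, AnalyticAt ℂ (a j) 0) ∧ AnalyticAt ℂ h 0 ∧
      ∀ᶠ p in 𝓝 (0 : ℂ × ℂ), f p = ∑ j ∈ Finset.range n, a j p.1 * p.2 ^ j + p.2 ^ n * h p := by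
  induction n with
  | zero => exact ⟨fun _ _ => 0, f, fun _ => analyticAt_const, hf, by simp⟩
  | succ n ih =>
    obtain ⟨a, h, ha, hh, hfa⟩ := ih
    have hline : AnalyticAt ℂ (fun x : ℂ => h (x, 0)) 0 :=
      AnalyticAt.fun_comp (g := h) (f := fun x : ℂ => (x, (0 : ℂ))) hh (by fun_prop)
    have hline' : AnalyticAt ℂ (fun p : ℂ × ℂ => h (p.1, 0)) 0 :=
      AnalyticAt.fun_comp (g := h) (f := fun p : ℂ × ℂ => (p.1, (0 : ℂ))) hh (by fun_prop)
    obtain ⟨h', hh', hmul⟩ := exists_eq_snd_mul (hh.fun_sub hline') (by simp)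
    refine ⟨Function.update a n fun x => h (x, 0), h', fun j => ?_, hh', ?_⟩
    · by_cases hj : j = n
      · subst hj; simpa using hline
      · simpa [Function.update_of_ne hj] using ha j
    · filter_upwards [hfa, hmul] with p hp hp'
      have hs : ∑ j ∈ Finset.range n, (Function.update a n fun x => h (x, 0)) j p.1 * p.2 ^ j =
          ∑ j ∈ Finset.range n, a j p.1 * p.2 ^ j := by
        refine Finset.sum_congr rfl fun j hj => ?_
        rw [Function.update_of_ne (Finset.mem_range.1 hj).ne]
      rw [Finset.sum_range_succ, hs, Function.update_self, hp, eq_add_of_sub_eq hp']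
      ring

/-- The remainder has order at least `n`, so it contributes nothing to derivatives of lower order.
-/
theorem iteratedDeriv_eq_of_eq_sum_add_pow_mul {g u : ℂ → ℂ} {c : ℕ → ℂ} {n : ℕ}
    (hu : AnalyticAt ℂ u 0)
    (h : ∀ᶠ y in 𝓝 (0 : ℂ), g y = ∑ j ∈ Finset.range n, c j * y ^ j + y ^ n * u y) {i : ℕ}
    (hi : i < n) : iteratedDeriv i g 0 = i.factorial * c i := by
  rw [Filter.EventuallyEq.iteratedDeriv_eq i h]
  have hrem : AnalyticAt ℂ (fun y => y ^ n * u y) 0 := (analyticAt_id.fun_pow n).fun_mul hu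
  have hpoly : ∀ j, AnalyticAt ℂ (fun y : ℂ => c j * y ^ j) 0 := fun j => by fun_prop
  have h0 : iteratedDeriv i (fun y => y ^ n * u y) 0 = 0 :=
    (natCast_le_analyticOrderAt_iff_iteratedDeriv_eq_zero (n := n) hrem).1
      ((natCast_le_analyticOrderAt hrem).2 ⟨u, hu, by simp⟩) i hi
  rw [iteratedDeriv_fun_add (Finset.analyticAt_fun_sum _ fun j _ => hpoly j).contDiffAt
      hrem.contDiffAt, h0, iteratedDeriv_fun_sum fun j _ => (hpoly j).contDiffAt, add_zero,
    Finset.sum_eq_single i]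
  · rw [iteratedDeriv_const_mul_field, iteratedDeriv_fun_pow_zero]
    simp [mul_comm]
  · intro j _ hj
    rw [iteratedDeriv_const_mul_field, iteratedDeriv_fun_pow_zero]
    simp [hj.symm]
  · intro h; exact absurd (Finset.mem_range.2 hi) h

/-- The partial derivative with respect to the second variable. -/
def derivSnd (f : ℂ × ℂ → ℂ) (p : ℂ × ℂ) : ℂ := fderiv ℂ f p (0, 1)

theorem analyticAt_derivSnd {f : ℂ × ℂ → ℂ} {p : ℂ × ℂ} (hf : AnalyticAt ℂ f p) :
    AnalyticAt ℂ (derivSnd f) p :=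
  AnalyticAt.fun_comp (g := fun L : ℂ × ℂ →L[ℂ] ℂ => L (0, 1))
    ((ContinuousLinearMap.apply ℂ ℂ ((0 : ℂ), (1 : ℂ))).analyticAt _) hf.fderiv

theorem analyticAt_iterate_derivSnd {f : ℂ × ℂ → ℂ} {p : ℂ × ℂ} (hf : AnalyticAt ℂ f p) (j : ℕ) :
    AnalyticAt ℂ (derivSnd^[j] f) p := by
  induction j with
  | zero => exact hf
  | succ j ih => rw [Function.iterate_succ_apply']; exact analyticAt_derivSnd ih

/-- Derivatives along slices become values of a jointly analytic function, to which the implicit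
function theorem applies. -/
theorem iteratedDeriv_snd {f : ℂ × ℂ → ℂ} (j : ℕ) {p : ℂ × ℂ} (hf : AnalyticAt ℂ f p) :
    iteratedDeriv j (fun y => f (p.1, y)) p.2 = derivSnd^[j] f p := by
  induction j generalizing p with
  | zero => simp
  | succ j ih =>
    have h1 : ∀ᶠ y in 𝓝 p.2, iteratedDeriv j (fun y => f (p.1, y)) y = derivSnd^[j] f (p.1, y) := by
      have := (Continuous.tendsto (f := fun y : ℂ => (p.1, y)) (by fun_prop) p.2).eventually
        hf.eventually_analyticAt
      filter_upwards [this] with y hy using ih hy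
    rw [iteratedDeriv_succ, Filter.EventuallyEq.deriv_eq h1, Function.iterate_succ_apply']
    have h2 : HasDerivAt (fun y : ℂ => (p.1, y)) ((0 : ℂ), (1 : ℂ)) p.2 :=
      (hasDerivAt_const _ _).prodMk (hasDerivAt_id _)
    have h3 := (analyticAt_iterate_derivSnd hf j).differentiableAt.hasFDerivAt
    exact (h3.comp_hasDerivAt p.2 h2).deriv

/-- If `f (0, y)` has order `n > 0`, there is an analytic curve `y = φ x` on which the derivative of
order `n - 1` of `f` with respect to `y` vanishes. -/
theorem exists_iteratedDeriv_eq_zero {f : ℂ × ℂ → ℂ} (hf : AnalyticAt ℂ f 0) {n : ℕ}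
    (hn : analyticOrderAt (fun y => f (0, y)) 0 = (n + 1 : ℕ)) :
    ∃ φ : ℂ → ℂ, AnalyticAt ℂ φ 0 ∧ φ 0 = 0 ∧
      ∀ᶠ x in 𝓝 0, iteratedDeriv n (fun y => f (x, y)) (φ x) = 0 := by
  have hf0 : AnalyticAt ℂ (fun y => f (0, y)) 0 :=
    AnalyticAt.fun_comp (g := f) (f := fun y : ℂ => ((0 : ℂ), y)) hf (by fun_prop)
  obtain ⟨hlow, htop⟩ := (analyticOrderAt_eq_nat_iff_iteratedDeriv_eq_zero hf0).1 hn
  set ψ := derivSnd^[n] f with hψ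
  have hψan : AnalyticAt ℂ ψ 0 := analyticAt_iterate_derivSnd hf n
  have hψ0 : ψ 0 = 0 := by
    rw [hψ, ← iteratedDeriv_snd n hf]; exact hlow n (Nat.lt_succ_self n)
  have hψ1 : derivSnd ψ 0 ≠ 0 := by
    rw [hψ, ← Function.iterate_succ_apply' derivSnd, ← iteratedDeriv_snd (n + 1) hf]; exact htop
  have hcd : ContDiffAt ℂ ⊤ ψ 0 := hψan.contDiffAt
  have hinv : (fderiv ℂ ψ 0 ∘L .inr ℂ ℂ ℂ).IsInvertible := by
    refine ⟨ContinuousLinearEquiv.unitsEquivAut ℂ (Units.mk0 _ hψ1), ?_⟩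
    ext
    simp [derivSnd]
  have htop0 : (⊤ : WithTop ℕ∞) ≠ 0 := by simp
  let φ := hcd.implicitFunction htop0 hinv
  have hφ0 : φ 0 = 0 := hcd.implicitFunction_apply_self htop0 hinv
  have hφan : AnalyticAt ℂ φ 0 :=
    (hcd.contDiffAt_implicitFunction htop0 hinv).analyticAt
  refine ⟨φ, hφan, hφ0, ?_⟩
  have h1 : ∀ᶠ x in 𝓝 (0 : ℂ), ψ (x, φ x) = ψ 0 := hcd.eventually_apply_implicitFunction htop0 hinv
  have h2 : Tendsto (fun x => (x, φ x)) (𝓝 0) (𝓝 (0 : ℂ × ℂ)) := by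
    have := (continuousAt_id (x := (0 : ℂ))).prodMk hφan.continuousAt
    rw [ContinuousAt] at this
    simp only [id, hφ0] at this
    exact this
  filter_upwards [h1, h2.eventually hf.eventually_analyticAt] with x hx hx'
  rw [iteratedDeriv_snd (p := (x, φ x)) n hx', ← hψ, hx, hψ0]

/-- A root `b` of full multiplicity would give `P = c (X - b) ^ (n + 1)`; the vanishing coefficient
of degree `n` then forces `b = 0` and kills all lower coefficients. This is what makes the order
drop in the Newton-Puiseux induction. -/
theorem exists_rootMultiplicity_lt {P : Polynomial ℂ} {n j : ℕ} (hdeg : P.natDegree = n + 1)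
    (hn : P.coeff n = 0) (hj : j < n + 1) (hPj : P.coeff j ≠ 0) :
    ∃ b, P.rootMultiplicity b ≠ 0 ∧ P.rootMultiplicity b < n + 1 := by
  have hP0 : P ≠ 0 := by rintro rfl; simp at hPj
  obtain ⟨b, hb⟩ := IsAlgClosed.exists_root P
    (by rw [Polynomial.degree_eq_natDegree hP0, hdeg]; exact_mod_cast Nat.succ_ne_zero n)
  refine ⟨b, ((Polynomial.rootMultiplicity_pos hP0).2 hb).ne', ?_⟩
  by_contra hcon
  obtain ⟨Q, hQ⟩ := (Polynomial.le_rootMultiplicity_iff hP0).1 (not_lt.1 hcon)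
  have hQ0 : Q ≠ 0 := by rintro rfl; simp at hQ; exact hP0 hQ
  have hmon : ((Polynomial.X - Polynomial.C b) ^ (n + 1)).Monic := (Polynomial.monic_X_sub_C b).pow _
  have hQdeg : Q.natDegree = 0 := by
    have := congrArg Polynomial.natDegree hQ
    rw [hmon.natDegree_mul' hQ0, hdeg, Polynomial.natDegree_pow, Polynomial.natDegree_X_sub_C] at this
    omega
  rw [Polynomial.eq_C_of_natDegree_eq_zero hQdeg] at hQ
  have hc : Q.coeff 0 ≠ 0 := by
    intro h; rw [h] at hQ; simp at hQ; exact hP0 hQ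
  rw [hQ, Polynomial.coeff_mul_C, sub_eq_add_neg, ← Polynomial.C_neg,
    Polynomial.coeff_X_add_C_pow] at hn hPj
  have hb0 : b = 0 := by
    have h1 : ((n + 1).choose n : ℂ) ≠ 0 := by
      rw [Nat.choose_succ_self_right]; exact_mod_cast Nat.succ_ne_zero n
    have h2 : n + 1 - n = 1 := by omega
    rw [h2, pow_one] at hn
    exact neg_eq_zero.1 ((mul_eq_zero.1 ((mul_eq_zero.1 hn).resolve_right hc)).resolve_right h1)
  apply hPj
  have : n + 1 - j ≠ 0 := by omega
  simp [hb0, this]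

theorem analyticOrderAt_eval_add {P : Polynomial ℂ} (hP : P ≠ 0) (b : ℂ) :
    analyticOrderAt (fun y => P.eval (b + y)) 0 = P.rootMultiplicity b := by
  have han : ∀ Q : Polynomial ℂ, AnalyticAt ℂ (fun y => Q.eval (b + y)) 0 := fun Q => by
    have : Differentiable ℂ fun y => Q.eval (b + y) := by fun_prop
    exact this.analyticAt 0
  obtain ⟨Q, hQ, hQb⟩ := P.exists_eq_pow_rootMultiplicity_mul_and_not_dvd hP b
  rw [(han P).analyticOrderAt_eq_natCast]
  refine ⟨_, han Q, ?_, Eventually.of_forall fun y => ?_⟩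
  · rw [add_zero]
    intro h
    exact hQb (Polynomial.dvd_iff_isRoot.2 h)
  · conv_lhs => rw [hQ]
    simp

/-- **Newton-Puiseux theorem**: if `f (0, 0) = 0` and `f (0, y)` does not vanish identically, then
`f` vanishes along a curve `x = t ^ k`, `y = s t`. -/
theorem exists_pow_root {n : ℕ} {f : ℂ × ℂ → ℂ} (hf : AnalyticAt ℂ f 0)
    (hn : analyticOrderAt (fun y => f (0, y)) 0 = n) (hn0 : n ≠ 0) :
    ∃ (k : ℕ) (s : ℂ → ℂ), 0 < k ∧ AnalyticAt ℂ s 0 ∧ s 0 = 0 ∧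
      ∀ᶠ t in 𝓝 0, f (t ^ k, s t) = 0 := by
  induction n using Nat.strong_induction_on generalizing f with
  | _ n ih =>
  obtain ⟨n, rfl⟩ := Nat.exists_eq_succ_of_ne_zero hn0
  -- Tschirnhausen transformation: after shifting `y` by `φ x`, the coefficient of `y ^ n` vanishes.
  obtain ⟨φ, hφ, hφ0, hφd⟩ := exists_iteratedDeriv_eq_zero hf hn
  suffices h : ∃ (k : ℕ) (s : ℂ → ℂ), 0 < k ∧ AnalyticAt ℂ s 0 ∧ s 0 = 0 ∧
      ∀ᶠ t in 𝓝 0, f (t ^ k, φ (t ^ k) + s t) = 0 by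
    obtain ⟨k, s, hk, hs, hs0, hfs⟩ := h
    refine ⟨k, fun t => φ (t ^ k) + s t, hk, ?_, by simp [hk.ne', hφ0, hs0], hfs⟩
    refine AnalyticAt.fun_add (AnalyticAt.fun_comp (g := φ) (f := fun t : ℂ => t ^ k) ?_ ?_) hs
    · simpa [hk.ne'] using hφ
    · fun_prop
  set F : ℂ × ℂ → ℂ := fun p => f (p.1, φ p.1 + p.2) with hF
  have hFan : AnalyticAt ℂ F 0 := by
    refine AnalyticAt.fun_comp (g := f) (f := fun p : ℂ × ℂ => (p.1, φ p.1 + p.2)) ?_ ?_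
    · simp only [Prod.fst_zero, Prod.snd_zero, hφ0, add_zero]
      exact hf
    · have : AnalyticAt ℂ (fun p : ℂ × ℂ => φ p.1) 0 :=
        AnalyticAt.fun_comp (g := φ) (f := Prod.fst) hφ analyticAt_fst
      exact analyticAt_fst.prod (this.fun_add analyticAt_snd)
  obtain ⟨a, h, ha, hh, hFa⟩ := exists_eq_sum_add_snd_pow_mul hFan (n + 1)
  have hslice : ∀ᶠ x in 𝓝 (0 : ℂ), ∀ᶠ y in 𝓝 (0 : ℂ),
      F (x, y) = ∑ j ∈ Finset.range (n + 1), a j x * y ^ j + y ^ (n + 1) * h (x, y) := by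
    have h1 := (Continuous.tendsto (f := fun x : ℂ => (x, (0 : ℂ))) (by fun_prop) 0).eventually
      (eventually_eventually_nhds.2 hFa)
    filter_upwards [h1] with x hx
    exact (Continuous.tendsto (f := fun y : ℂ => (x, y)) (by fun_prop) 0).eventually hx
  have hhline : ∀ᶠ x in 𝓝 (0 : ℂ), AnalyticAt ℂ (fun y : ℂ => h (x, y)) 0 := by
    have h1 := (Continuous.tendsto (f := fun x : ℂ => (x, (0 : ℂ))) (by fun_prop) 0).eventually
      hh.eventually_analyticAt
    filter_upwards [h1] with x hx
    exact AnalyticAt.fun_comp (g := h) (f := fun y : ℂ => (x, y)) hx (by fun_prop)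
  have han : ∀ᶠ x in 𝓝 (0 : ℂ), a n x = 0 := by
    filter_upwards [hslice, hhline, hφd] with x hx hx' hx''
    have h1 := iteratedDeriv_eq_of_eq_sum_add_pow_mul hx' hx (Nat.lt_succ_self n)
    simp only [hF] at h1
    rw [iteratedDeriv_comp_const_add n (fun y => f (x, y)) (φ x)] at h1
    simp only [add_zero, hx''] at h1
    simpa [Nat.factorial_ne_zero] using h1.symm
  have hF0 : (fun y => F (0, y)) = fun y => f (0, y) := by ext y; simp [hF, hφ0]
  have hFord : analyticOrderAt (fun y => F (0, y)) 0 = (n + 1 : ℕ) := by rw [hF0]; exact hn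
  have hF0an : AnalyticAt ℂ (fun y => F (0, y)) 0 :=
    AnalyticAt.fun_comp (g := F) (f := fun y : ℂ => ((0 : ℂ), y)) hFan (by fun_prop)
  have ha0 : ∀ j < n + 1, a j 0 = 0 := by
    intro j hj
    have h1 := iteratedDeriv_eq_of_eq_sum_add_pow_mul hhline.self_of_nhds hslice.self_of_nhds hj
    rw [((analyticOrderAt_eq_nat_iff_iteratedDeriv_eq_zero hF0an).1 hFord).1 j hj] at h1
    simpa [Nat.factorial_ne_zero] using h1.symm
  have hh0 : h 0 ≠ 0 := by
    intro h0
    have h1 : analyticOrderAt (fun y => F (0, y)) 0 = analyticOrderAt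
        ((fun y : ℂ => y ^ (n + 1)) * fun y : ℂ => h (0, y)) 0 := by
      refine analyticOrderAt_congr ?_
      filter_upwards [hslice.self_of_nhds] with y hy
      rw [hy, Finset.sum_eq_zero, zero_add]; · rfl
      intro j hj
      rw [ha0 j (Finset.mem_range.1 hj), zero_mul]
    have h2 : analyticOrderAt (fun y : ℂ => y ^ (n + 1)) 0 = (n + 1 : ℕ) := by
      simpa [Pi.pow_def] using analyticOrderAt_centeredMonomial (𝕜 := ℂ) (z₀ := 0) (n := n + 1)
    have h3 : analyticOrderAt (fun y : ℂ => h (0, y)) 0 ≠ 0 :=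
      analyticOrderAt_ne_zero.2 ⟨hhline.self_of_nhds, h0⟩
    rw [hFord, analyticOrderAt_mul (by fun_prop) hhline.self_of_nhds, h2] at h1
    have h4 : (1 : ℕ∞) ≤ analyticOrderAt (fun y : ℂ => h (0, y)) 0 := Order.one_le_iff_ne_zero.2 h3
    have h5 : ((n + 1 : ℕ) : ℕ∞) + 1 ≤ (n + 1 : ℕ) := by
      conv_rhs => rw [h1]
      gcongr
    exact absurd h5 (by exact_mod_cast Nat.not_succ_le_self (n + 1))
  by_cases hall : ∀ j < n + 1, ∀ᶠ x in 𝓝 (0 : ℂ), a j x = 0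
  · refine ⟨1, fun _ => 0, one_pos, analyticAt_const, rfl, ?_⟩
    filter_upwards [hslice, hall 0 (Nat.succ_pos n)] with x hx hx0
    have := hx.self_of_nhds
    simp only [hF] at this
    rw [pow_one, this, Finset.sum_range_succ']
    simp [hx0]
  simp only [not_forall] at hall
  -- the orders of the coefficients
  have hfact : ∀ j, (¬ ∀ᶠ x in 𝓝 (0 : ℂ), a j x = 0) → ∃ (m : ℕ) (b : ℂ → ℂ), AnalyticAt ℂ b 0 ∧
      b 0 ≠ 0 ∧ ∀ᶠ x in 𝓝 0, a j x = x ^ m * b x := by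
    intro j hj
    rw [← analyticOrderAt_eq_top] at hj
    obtain ⟨b, hb, hb0, hab⟩ := (ha j).analyticOrderAt_ne_top.1 hj
    exact ⟨_, b, hb, hb0, by
      filter_upwards [hab] with x hx
      simpa using hx⟩
  choose! m b hb hb0 hab using hfact
  classical
  -- The edge of the Newton polygon at the vertex of `y ^ (n + 1)`. Its slope is `p / q`; the
  -- fraction need not be reduced.
  obtain ⟨j₀, hj₀, hmin⟩ := Finset.exists_min_image
    ((Finset.range (n + 1)).filter fun j => ¬ ∀ᶠ x in 𝓝 (0 : ℂ), a j x = 0)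
    (fun j => (m j : ℚ) / (n + 1 - j : ℚ)) (by
      obtain ⟨j, hj, hj'⟩ := hall
      exact ⟨j, Finset.mem_filter.2 ⟨Finset.mem_range.2 hj, hj'⟩⟩)
  obtain ⟨hj₀n, hj₀'⟩ := Finset.mem_filter.1 hj₀
  rw [Finset.mem_range] at hj₀n
  set q := n + 1 - j₀ with hq
  set p := m j₀ with hp
  have hqpos : 0 < q := by omega
  have hppos : 0 < p := by
    rw [Nat.pos_iff_ne_zero]
    intro h0
    have := (hab j₀ hj₀').self_of_nhds
    rw [ha0 j₀ hj₀n, ← hp, h0] at this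
    exact hb0 j₀ hj₀' (by simpa using this.symm)
  have hslope : ∀ j < n + 1, (¬ ∀ᶠ x in 𝓝 (0 : ℂ), a j x = 0) → p * (n + 1 - j) ≤ q * m j := by
    intro j hj hj'
    have h1 := hmin j (Finset.mem_filter.2 ⟨Finset.mem_range.2 hj, hj'⟩)
    have e1 : (n + 1 - j : ℚ) = ((n + 1 - j : ℕ) : ℚ) := by push_cast [Nat.le_of_lt hj]; ring
    have e2 : (n + 1 - j₀ : ℚ) = (q : ℚ) := by
      rw [hq]; push_cast [Nat.le_of_lt hj₀n]; ring
    rw [e1, e2, div_le_div_iff₀ (by exact_mod_cast hqpos)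
      (by exact_mod_cast (by omega : 0 < n + 1 - j))] at h1
    have h2 : p * (n + 1 - j) ≤ m j * q := by exact_mod_cast h1
    linarith
  have hpowq : Tendsto (fun t : ℂ => t ^ q) (𝓝 0) (𝓝 0) := by
    have := (continuous_pow (M := ℂ) q).tendsto 0
    rwa [zero_pow hqpos.ne'] at this
  -- After `x = t ^ q`, `y = t ^ p (β + v)` every term is divisible by `t ^ (p (n + 1))`; `c j` is
  -- what remains of `a j`.
  have hcoef : ∀ j < n + 1, ∃ c : ℂ → ℂ, AnalyticAt ℂ c 0 ∧
      (∀ᶠ t in 𝓝 0, a j (t ^ q) = t ^ (p * (n + 1 - j)) * c t) ∧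
      ((∀ᶠ x in 𝓝 (0 : ℂ), a j x = 0) → c 0 = 0) ∧ (j = j₀ → c 0 ≠ 0) := by
    intro j hj
    by_cases hj' : ∀ᶠ x in 𝓝 (0 : ℂ), a j x = 0
    · refine ⟨fun _ => 0, analyticAt_const, ?_, fun _ => rfl, ?_⟩
      · filter_upwards [hpowq.eventually hj'] with t ht
        rw [ht, mul_zero]
      · rintro rfl; exact absurd hj' hj₀'
    · refine ⟨fun t => t ^ (q * m j - p * (n + 1 - j)) * b j (t ^ q), ?_, ?_, ?_, ?_⟩
      · refine AnalyticAt.fun_mul (by fun_prop)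
          (AnalyticAt.fun_comp (g := b j) (f := fun t : ℂ => t ^ q) ?_ (by fun_prop))
        simpa [hqpos.ne'] using hb j hj'
      · filter_upwards [hpowq.eventually (hab j hj')] with t ht
        rw [ht, ← mul_assoc, ← pow_add, Nat.add_sub_cancel' (hslope j hj hj'), pow_mul]
      · intro h; exact absurd h hj'
      · rintro rfl
        have : q * m j - p * (n + 1 - j) = 0 := by rw [← hp, ← hq, mul_comm, Nat.sub_self]
        simpa [this, hqpos.ne'] using hb0 j hj'
  choose! c hc hca hc0 hcj₀ using hcoef
  -- The polynomial of the edge: degree `n + 1` since `h 0 ≠ 0`, no term of degree `n` by the choice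
  -- of `φ`, a nonzero term of degree `j₀`.
  set P : Polynomial ℂ := ∑ j ∈ Finset.range (n + 1), Polynomial.C (c j 0) * Polynomial.X ^ j +
    Polynomial.C (h 0) * Polynomial.X ^ (n + 1) with hP
  have hPcoef : ∀ i < n + 1, P.coeff i = c i 0 := by
    intro i hi
    simp only [hP, Polynomial.coeff_add, Polynomial.finsetSum_coeff, Polynomial.coeff_C_mul_X_pow]
    rw [if_neg hi.ne, add_zero, Finset.sum_ite_eq, if_pos (Finset.mem_range.2 hi)]
  have hPtop : P.coeff (n + 1) = h 0 := by
    simp only [hP, Polynomial.coeff_add, Polynomial.finsetSum_coeff, Polynomial.coeff_C_mul_X_pow]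
    rw [Finset.sum_ite_eq]
    simp
  have hPdeg : P.natDegree = n + 1 := by
    refine le_antisymm ?_ (Polynomial.le_natDegree_of_ne_zero (by rwa [hPtop]))
    rw [Polynomial.natDegree_le_iff_coeff_eq_zero]
    intro i hi
    simp only [hP, Polynomial.coeff_add, Polynomial.finsetSum_coeff, Polynomial.coeff_C_mul_X_pow]
    rw [if_neg hi.ne', add_zero, Finset.sum_ite_eq, if_neg (by simp; omega)]
  have hP0 : P ≠ 0 := by rintro h; rw [h] at hPdeg; simp at hPdeg
  obtain ⟨β, hβ0, hβn⟩ := exists_rootMultiplicity_lt hPdeg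
    (by rw [hPcoef n (Nat.lt_succ_self n)]; exact hc0 n (Nat.lt_succ_self n) han) hj₀n
    (by rw [hPcoef j₀ hj₀n]; exact hcj₀ j₀ hj₀n rfl)
  -- The quotient of `F (t ^ q, t ^ p (β + v))` by `t ^ (p (n + 1))`. On `t = 0` it is `P (β + v)`,
  -- whose order is the multiplicity of `β`.
  let G : ℂ × ℂ → ℂ := fun v => ∑ j ∈ Finset.range (n + 1), c j v.1 * (β + v.2) ^ j +
    (β + v.2) ^ (n + 1) * h (v.1 ^ q, v.1 ^ p * (β + v.2))
  have hmap : AnalyticAt ℂ (fun v : ℂ × ℂ => (v.1 ^ q, v.1 ^ p * (β + v.2))) 0 := by fun_prop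
  have hmap0 : ((0 : ℂ × ℂ).1 ^ q, (0 : ℂ × ℂ).1 ^ p * (β + (0 : ℂ × ℂ).2)) = (0 : ℂ × ℂ) := by
    simp [hqpos.ne', hppos.ne']
  have hGan : AnalyticAt ℂ G 0 := by
    refine AnalyticAt.fun_add (Finset.analyticAt_fun_sum _ fun j hj => ?_)
      (AnalyticAt.fun_mul (by fun_prop) ?_)
    · have : AnalyticAt ℂ (fun v : ℂ × ℂ => c j v.1) 0 :=
        AnalyticAt.fun_comp (g := c j) (f := Prod.fst) (hc j (Finset.mem_range.1 hj)) analyticAt_fst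
      exact this.fun_mul (by fun_prop)
    · exact AnalyticAt.fun_comp (g := h) (by rw [hmap0]; exact hh) hmap
  have hGord : analyticOrderAt (fun y => G (0, y)) 0 = P.rootMultiplicity β := by
    rw [← analyticOrderAt_eval_add hP0 β]
    congr 1
    ext y
    have : ((0 : ℂ) ^ q, (0 : ℂ) ^ p * (β + y)) = 0 := by simp [hqpos.ne', hppos.ne']
    simp only [G, this, hP, Polynomial.eval_add, Polynomial.eval_finsetSum, Polynomial.eval_mul,
      Polynomial.eval_C, Polynomial.eval_pow, Polynomial.eval_X]
    ring
  obtain ⟨k, s, hk, hs, hs0, hGs⟩ := ih _ hβn hGan hGord hβ0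
  refine ⟨k * q, fun t => (t ^ k) ^ p * (β + s t), Nat.mul_pos hk hqpos, by fun_prop,
    by simp [hk.ne', hppos.ne'], ?_⟩
  have htk : Tendsto (fun t : ℂ => t ^ k) (𝓝 0) (𝓝 0) := by
    have := (continuous_pow (M := ℂ) k).tendsto 0
    rwa [zero_pow hk.ne'] at this
  have hpt : Tendsto (fun t => (t ^ k, s t)) (𝓝 0) (𝓝 (0 : ℂ × ℂ)) := by
    have := htk.prodMk_nhds hs.continuousAt.tendsto
    rwa [hs0] at this
  have hmapt : Tendsto (fun v : ℂ × ℂ => (v.1 ^ q, v.1 ^ p * (β + v.2))) (𝓝 0) (𝓝 0) := by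
    have := hmap.continuousAt.tendsto
    rwa [hmap0] at this
  have hcall : ∀ᶠ t in 𝓝 (0 : ℂ), ∀ j ∈ Finset.range (n + 1),
      a j (t ^ q) = t ^ (p * (n + 1 - j)) * c j t :=
    (Filter.eventually_all_finset _).2 fun j hj => hca j (Finset.mem_range.1 hj)
  filter_upwards [hGs, htk.eventually hcall, hpt.eventually (hmapt.eventually hFa)] with t h1 h2 h3
  have h4 : F ((t ^ k) ^ q, (t ^ k) ^ p * (β + s t)) = (t ^ k) ^ (p * (n + 1)) * G (t ^ k, s t) := by
    rw [h3, show G (t ^ k, s t) = ∑ j ∈ Finset.range (n + 1), c j (t ^ k) * (β + s t) ^ j +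
      (β + s t) ^ (n + 1) * h ((t ^ k) ^ q, (t ^ k) ^ p * (β + s t)) from rfl,
      mul_add ((t ^ k) ^ (p * (n + 1))),
      Finset.mul_sum]
    congr 1
    · refine Finset.sum_congr rfl fun j hj => ?_
      rw [h2 j hj]
      have : p * (n + 1) = p * (n + 1 - j) + p * j := by
        rw [← mul_add, Nat.sub_add_cancel (Finset.mem_range.1 hj).le]
      rw [this, pow_add _ (p * (n + 1 - j)), mul_pow, pow_mul _ p j]
      ring
    · rw [mul_pow, pow_mul _ p (n + 1)]; ring
  rw [h1, mul_zero] at h4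
  simp only [hF] at h4
  rw [pow_mul]
  exact h4

end PlaneCurve

end

noncomputable section

namespace PlaneCurve

/-! ### Roots -/

theorem tendsto_pow_zero {k : ℕ} (hk : 0 < k) : Tendsto (fun t : ℂ => t ^ k) (𝓝 0) (𝓝 0) := by
  have := (continuous_pow (M := ℂ) k).tendsto 0
  rwa [zero_pow hk.ne'] at this

/-- All `k`-th roots of a small number are small. This matters because membership in a parametrized
germ quantifies over all `t : ℂ`, not only over small ones. -/
theorem eventually_forall_root {k : ℕ} {P : ℂ → Prop} (hP : ∀ᶠ t in 𝓝 0, P t) :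
    ∀ᶠ x in 𝓝 (0 : ℂ), ∀ t, t ^ k = x → P t := by
  obtain ⟨r, hr, hball⟩ := Metric.eventually_nhds_iff_ball.1 hP
  filter_upwards [Metric.ball_mem_nhds (0 : ℂ) (pow_pos hr k)] with x hx t ht
  apply hball
  rw [mem_ball_zero_iff] at hx ⊢
  rw [← ht, norm_pow] at hx
  exact lt_of_pow_lt_pow_left₀ k hr.le hx

theorem eventually_forall_root_fst {k : ℕ} {P : ℂ → Prop} (hP : ∀ᶠ t in 𝓝 0, P t) :
    ∀ᶠ p in 𝓝 (0 : ℂ × ℂ), ∀ t, t ^ k = p.1 → P t :=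
  (continuous_fst.tendsto (0 : ℂ × ℂ)).eventually (eventually_forall_root hP)

theorem eventually_forall_root_prod {k : ℕ} {P : ℂ × ℂ → Prop}
    (hP : ∀ᶠ p in 𝓝 0, P p) : ∀ᶠ p in 𝓝 (0 : ℂ × ℂ), ∀ t, t ^ k = p.1 → P (t, p.2) := by
  rw [Prod.zero_eq_mk, nhds_prod_eq] at hP
  obtain ⟨pa, hpa, pb, hpb, hab⟩ := eventually_prod_iff.1 hP
  filter_upwards [eventually_forall_root_fst hpa, (continuous_snd.tendsto (0 : ℂ × ℂ)).eventually hpb]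
    with p h1 h2 t ht
  exact hab (h1 t ht) h2

theorem eventually_of_eventually_pow {k : ℕ} (hk : 0 < k) {P : ℂ → Prop}
    (hP : ∀ᶠ t : ℂ in 𝓝 0, P (t ^ k)) : ∀ᶠ x in 𝓝 0, P x := by
  filter_upwards [eventually_forall_root hP] with x hx
  obtain ⟨t, ht⟩ := IsAlgClosed.exists_pow_nat_eq x hk
  have := hx t ht
  rwa [ht] at this

theorem tendsto_mul_zero (ζ : ℂ) : Tendsto (fun t : ℂ => ζ * t) (𝓝 0) (𝓝 0) := by
  have := (continuous_const_mul ζ).tendsto 0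
  rwa [mul_zero] at this

theorem mem_roots_one {k : ℕ} (hk : 0 < k) {ζ : ℂ} :
    ζ ∈ Polynomial.nthRootsFinset k (1 : ℂ) ↔ ζ ^ k = 1 := Polynomial.mem_nthRootsFinset hk 1

theorem ne_zero_of_pow_eq_one {k : ℕ} (hk : 0 < k) {ζ : ℂ} (hζ : ζ ^ k = 1) : ζ ≠ 0 := by
  rintro rfl; rw [zero_pow hk.ne'] at hζ; exact zero_ne_one hζ

theorem mem_roots_mul_iff {k : ℕ} (hk : 0 < k) {ζ : ℂ} (hζ : ζ ^ k = 1) (ξ : ℂ) :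
    ξ ∈ Polynomial.nthRootsFinset k (1 : ℂ) ↔
      Equiv.mulRight₀ ζ (ne_zero_of_pow_eq_one hk hζ) ξ ∈ Polynomial.nthRootsFinset k (1 : ℂ) := by
  rw [mem_roots_one hk, mem_roots_one hk]
  simp [mul_pow, hζ]

theorem prod_roots_mul {k : ℕ} (hk : 0 < k) {ζ : ℂ} (hζ : ζ ^ k = 1) (F : ℂ → ℂ) :
    ∏ ξ ∈ Polynomial.nthRootsFinset k (1 : ℂ), F (ξ * ζ) =
      ∏ ξ ∈ Polynomial.nthRootsFinset k (1 : ℂ), F ξ :=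
  Finset.prod_equiv (Equiv.mulRight₀ ζ (ne_zero_of_pow_eq_one hk hζ))
    (mem_roots_mul_iff hk hζ) (fun _ _ => rfl)

theorem sum_roots_mul {k : ℕ} (hk : 0 < k) {ζ : ℂ} (hζ : ζ ^ k = 1) (F : ℂ → ℂ) :
    ∑ ξ ∈ Polynomial.nthRootsFinset k (1 : ℂ), F (ξ * ζ) =
      ∑ ξ ∈ Polynomial.nthRootsFinset k (1 : ℂ), F ξ :=
  Finset.sum_equiv (Equiv.mulRight₀ ζ (ne_zero_of_pow_eq_one hk hζ))
    (mem_roots_mul_iff hk hζ) (fun _ _ => rfl)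

theorem card_roots {k : ℕ} (hk : 0 < k) {x : ℂ} (hx : x ≠ 0) :
    (Polynomial.nthRootsFinset k x).card = k := by
  have hprim := Complex.isPrimitiveRoot_exp k hk.ne'
  rw [Polynomial.nthRootsFinset_def, Multiset.toFinset_card_of_nodup (hprim.nthRoots_nodup hx),
    hprim.card_nthRoots, if_pos (IsAlgClosed.exists_pow_nat_eq x hk)]

theorem card_roots_one {k : ℕ} (hk : 0 < k) :
    (Polynomial.nthRootsFinset k (1 : ℂ)).card = k := card_roots hk one_ne_zero

/-- A germ in one variable invariant under `t ↦ ζ t` is a germ in `t ^ d`. -/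
theorem exists_eventuallyEq_comp_pow {s : ℂ → ℂ} (hs : AnalyticAt ℂ s 0) {d : ℕ} (hd : 0 < d)
    (hinv : ∀ ξ : ℂ, ξ ^ d = 1 → ∀ᶠ t in 𝓝 0, s (ξ * t) = s t) :
    ∃ r : ℂ → ℂ, AnalyticAt ℂ r 0 ∧ ∀ᶠ t in 𝓝 0, s t = r (t ^ d) := by
  let R := Polynomial.nthRootsFinset d (1 : ℂ)
  -- Averaging makes the invariance an identity for all `t`, as the descent to `t ^ d` requires.
  let G : ℂ × ℂ → ℂ := fun p => (d : ℂ)⁻¹ * ∑ ξ ∈ R, s (ξ * p.1)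
  have hG : AnalyticAt ℂ G 0 := by
    refine analyticAt_const.fun_mul (Finset.analyticAt_fun_sum _ fun ξ _ => ?_)
    refine AnalyticAt.fun_comp (g := s) (f := fun p : ℂ × ℂ => ξ * p.1) ?_ (by fun_prop)
    simpa using hs
  obtain ⟨g, hg, hgG⟩ := exists_eq_comp_pow hd hG (fun ζ hζ t y => by
    simp only [G]
    congr 1
    have := sum_roots_mul hd hζ fun ξ => s (ξ * t)
    simpa only [mul_assoc] using this)
  refine ⟨fun x => g (x, 0),
    AnalyticAt.fun_comp (g := g) (f := fun x : ℂ => (x, (0 : ℂ))) hg (by fun_prop), ?_⟩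
  filter_upwards [(Filter.eventually_all_finset R).2 fun ξ hξ =>
    hinv ξ ((mem_roots_one hd).1 hξ)] with t ht
  rw [← hgG]
  simp only [G]
  rw [Finset.sum_congr rfl ht, Finset.sum_const, card_roots_one hd, nsmul_eq_mul,
    inv_mul_cancel_left₀ (by exact_mod_cast hd.ne')]

/-! ### Parametrizations -/

/-- `x = t ^ k`, `y = s t` is an injective parametrization of the germ at the origin of `W`. -/
structure IsParam (W : Set (ℂ × ℂ)) (k : ℕ) (s : ℂ → ℂ) : Prop where
  pos : 0 < k
  analyticAt : AnalyticAt ℂ s 0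
  map_zero : s 0 = 0
  injOn : ∃ U ∈ 𝓝 (0 : ℂ), Set.InjOn (fun t : ℂ => (t ^ k, s t)) U
  mem_iff : ∀ᶠ p in 𝓝 (0 : ℂ × ℂ), p ∈ W ↔ ∃ t : ℂ, t ^ k = p.1 ∧ s t = p.2

theorem IsPuiseuxExpansion.isParam {W : Set (ℂ × ℂ)} {k : ℕ} {s : ℂ → ℂ}
    (h : IsPuiseuxExpansion W k s) : IsParam W k s where
  pos := h.1
  analyticAt := h.2.1
  map_zero := by
    obtain ⟨C, hC⟩ := h.2.2.1.bound
    have := hC.self_of_nhds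
    rw [zero_pow h.1.ne', norm_zero, mul_zero] at this
    exact norm_le_zero_iff.1 this
  injOn := h.2.2.2.1
  mem_iff := h.2.2.2.2

theorem IsParam.isPuiseuxExpansion {W : Set (ℂ × ℂ)} {k : ℕ} {s : ℂ → ℂ}
    (h : IsParam W k s) (hO : s =O[𝓝 0] (fun t : ℂ => t ^ k)) : IsPuiseuxExpansion W k s :=
  ⟨h.pos, h.analyticAt, hO, h.injOn, h.mem_iff⟩

variable {W : Set (ℂ × ℂ)} {k k' : ℕ} {s s' : ℂ → ℂ}

theorem IsParam.tendsto (h : IsParam W k s) : Tendsto (fun t => (t ^ k, s t)) (𝓝 0) (𝓝 0) := by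
  have := (tendsto_pow_zero h.pos).prodMk_nhds h.analyticAt.continuousAt.tendsto
  rwa [h.map_zero] at this

theorem IsParam.eventually_mem (h : IsParam W k s) : ∀ᶠ t in 𝓝 0, (t ^ k, s t) ∈ W := by
  filter_upwards [h.tendsto.eventually h.mem_iff] with t ht using ht.2 ⟨t, rfl, rfl⟩

theorem IsParam.rotate (h : IsParam W k s) {ζ : ℂ} (hζ : ζ ^ k = 1) :
    IsParam W k fun t => s (ζ * t) where
  pos := h.pos
  analyticAt := by
    refine AnalyticAt.fun_comp (g := s) (f := fun t => ζ * t) ?_ (by fun_prop)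
    simpa using h.analyticAt
  map_zero := by simp [h.map_zero]
  injOn := by
    obtain ⟨U, hU, hinj⟩ := h.injOn
    refine ⟨_, (tendsto_mul_zero ζ).eventually hU, fun t ht u hu htu => ?_⟩
    simp only [Prod.mk.injEq] at htu
    have := hinj ht hu (by simp only [mul_pow, htu.1, htu.2])
    exact mul_left_cancel₀ (ne_zero_of_pow_eq_one h.pos hζ) this
  mem_iff := by
    filter_upwards [h.mem_iff] with p hp
    rw [hp]
    have h0 := ne_zero_of_pow_eq_one h.pos hζ
    constructor
    · rintro ⟨t, ht, hst⟩
      refine ⟨ζ⁻¹ * t, by rw [mul_pow, inv_pow, hζ, inv_one, one_mul, ht], ?_⟩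
      rw [mul_inv_cancel_left₀ h0, hst]
    · rintro ⟨t, ht, hst⟩; exact ⟨ζ * t, by rw [mul_pow, hζ, one_mul, ht], hst⟩

/-- Two parameters over the same nonzero `x` differ by a root of unity, and there are finitely many
of these, so one neighbourhood serves all. -/
theorem exists_injOn_of_forall_ne (hk : 0 < k)
    (h : ∀ ζ : ℂ, ζ ^ k = 1 → ζ ≠ 1 → ∀ᶠ t in 𝓝[≠] 0, s (ζ * t) ≠ s t) :
    ∃ U ∈ 𝓝 (0 : ℂ), Set.InjOn (fun t : ℂ => (t ^ k, s t)) U := by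
  have h1 : ∀ᶠ t in 𝓝[≠] (0 : ℂ), ∀ ζ ∈ Polynomial.nthRootsFinset k (1 : ℂ),
      ζ ≠ 1 → s (ζ * t) ≠ s t := by
    refine (Filter.eventually_all_finset _).2 fun ζ hζ => ?_
    by_cases h1 : ζ = 1
    · simp [h1]
    · filter_upwards [h ζ ((mem_roots_one hk).1 hζ) h1] with t ht _ using ht
  rw [eventually_nhdsWithin_iff] at h1
  refine ⟨_, h1, fun t _ u hu htu => ?_⟩
  simp only [Prod.mk.injEq] at htu
  by_cases hu0 : u = 0
  · rw [hu0, zero_pow hk.ne'] at htu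
    rw [hu0, (pow_eq_zero_iff hk.ne').1 htu.1]
  · by_contra hne
    refine hu hu0 (t / u) ((mem_roots_one hk).2 ?_) ?_ ?_
    · rw [div_pow, htu.1, div_self (pow_ne_zero _ hu0)]
    · rwa [Ne, div_eq_one_iff_eq hu0]
    · rw [div_mul_cancel₀ _ hu0, htu.2]

/-- A germ of two variables vanishing on a parametrized branch, pulled back by `x = t ^ k`, is
divisible by the product of the conjugate factors `y - s (ζ t)`. -/
theorem exists_eq_prod_mul {F : ℂ × ℂ → ℂ} (hF : AnalyticAt ℂ F 0) (hs : AnalyticAt ℂ s 0)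
    (hs0 : s 0 = 0) (S : Finset ℂ)
    (hne : ∀ ζ ∈ S, ∀ ξ ∈ S, ζ ≠ ξ → ∀ᶠ t in 𝓝[≠] 0, s (ζ * t) ≠ s (ξ * t))
    (hzero : ∀ ζ ∈ S, ∀ᶠ t in 𝓝 0, F (t, s (ζ * t)) = 0) :
    ∃ H : ℂ × ℂ → ℂ, AnalyticAt ℂ H 0 ∧
      ∀ᶠ p in 𝓝 (0 : ℂ × ℂ), F p = (∏ ζ ∈ S, (p.2 - s (ζ * p.1))) * H p := by
  classical
  induction S using Finset.induction_on with
  | empty => exact ⟨F, hF, by simp⟩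
  | insert ξ S hξ ih =>
    obtain ⟨H, hH, hFH⟩ := ih
      (fun ζ hζ ξ hξ => hne ζ (Finset.mem_insert_of_mem hζ) ξ (Finset.mem_insert_of_mem hξ))
      (fun ζ hζ => hzero ζ (Finset.mem_insert_of_mem hζ))
    have hsξ : AnalyticAt ℂ (fun t => s (ξ * t)) 0 := by
      refine AnalyticAt.fun_comp (g := s) (f := fun t => ξ * t) ?_ (by fun_prop)
      simpa using hs
    have hsξ' : AnalyticAt ℂ (fun p : ℂ × ℂ => s (ξ * p.1)) 0 :=
      AnalyticAt.fun_comp (g := fun t => s (ξ * t)) (f := Prod.fst) hsξ analyticAt_fst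
    have hcurve : Tendsto (fun t => (t, s (ξ * t))) (𝓝 0) (𝓝 (0 : ℂ × ℂ)) := by
      have := (continuousAt_id (x := (0 : ℂ))).tendsto.prodMk_nhds hsξ.continuousAt.tendsto
      simp only [id, mul_zero, hs0] at this
      exact this
    -- Off `t = 0` the earlier factors do not vanish on the new branch, so `H` does; the identity
    -- theorem covers `t = 0`.
    have hHξ : ∀ᶠ t in 𝓝 0, H (t, s (ξ * t)) = 0 := by
      have han : AnalyticAt ℂ (fun t => H (t, s (ξ * t))) 0 := by
        refine AnalyticAt.fun_comp (g := H) (f := fun t => (t, s (ξ * t))) ?_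
          (analyticAt_id.prod hsξ)
        simp only [mul_zero, hs0]
        exact hH
      have h1 : ∀ᶠ t in 𝓝[≠] (0 : ℂ), ∀ ζ ∈ S, s (ξ * t) ≠ s (ζ * t) := by
        refine (Filter.eventually_all_finset _).2 fun ζ hζ => ?_
        exact hne ξ (Finset.mem_insert_self _ _) ζ (Finset.mem_insert_of_mem hζ)
          (fun h => hξ (h ▸ hζ))
      refine han.frequently_zero_iff_eventually_zero.1 (Eventually.frequently ?_)
      filter_upwards [h1, nhdsWithin_le_nhds (hzero ξ (Finset.mem_insert_self _ _)),
        nhdsWithin_le_nhds (hcurve.eventually hFH)] with t h1 h2 h3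
      rw [h2] at h3
      refine (mul_eq_zero.1 h3.symm).resolve_left (Finset.prod_ne_zero_iff.2 fun ζ hζ => ?_)
      exact sub_ne_zero.2 (h1 ζ hζ)
    -- A shear carries the branch to the line `y = 0`.
    have hK : AnalyticAt ℂ (fun p : ℂ × ℂ => H (p.1, p.2 + s (ξ * p.1))) 0 := by
      refine AnalyticAt.fun_comp (g := H) (f := fun p : ℂ × ℂ => (p.1, p.2 + s (ξ * p.1))) ?_
        (analyticAt_fst.prod (analyticAt_snd.fun_add hsξ'))
      simp only [Prod.fst_zero, Prod.snd_zero, mul_zero, hs0, add_zero]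
      exact hH
    obtain ⟨K, hKan, hKmul⟩ := exists_eq_snd_mul hK (by simpa using hHξ)
    have hshift : AnalyticAt ℂ (fun p : ℂ × ℂ => (p.1, p.2 - s (ξ * p.1))) 0 :=
      analyticAt_fst.prod (analyticAt_snd.fun_sub hsξ')
    have hshift0 : ((0 : ℂ × ℂ).1, (0 : ℂ × ℂ).2 - s (ξ * (0 : ℂ × ℂ).1)) = (0 : ℂ × ℂ) := by
      simp [hs0]
    have hshiftt : Tendsto (fun p : ℂ × ℂ => (p.1, p.2 - s (ξ * p.1))) (𝓝 0) (𝓝 0) := by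
      have := hshift.continuousAt.tendsto
      rwa [hshift0] at this
    refine ⟨fun p => K (p.1, p.2 - s (ξ * p.1)), ?_, ?_⟩
    · exact AnalyticAt.fun_comp (g := K) (by rw [hshift0]; exact hKan) hshift
    · filter_upwards [hFH, hshiftt.eventually hKmul] with p h1 h2
      simp only [sub_add_cancel] at h2
      rw [h1, h2, Finset.prod_insert hξ]
      ring

/-- **Puiseux's theorem**: an irreducible plane curve that does not contain `{x = 0}` has an
injective parametrization `x = t ^ k`, `y = s t`. -/
theorem IsIrreduciblePlaneCurve.exists_isParam {Y : Set (ℂ × ℂ)} (hY : IsIrreduciblePlaneCurve Y)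
    (hv : ¬ ∀ᶠ y in 𝓝 (0 : ℂ), ((0 : ℂ), y) ∈ Y) : ∃ (k : ℕ) (s : ℂ → ℂ), IsParam Y k s := by
  obtain ⟨f, ⟨hf, hf0, hirr⟩, hYf⟩ := hY
  have hline : Tendsto (fun y : ℂ => ((0 : ℂ), y)) (𝓝 0) (𝓝 (0 : ℂ × ℂ)) :=
    Continuous.tendsto (by fun_prop) 0
  have hfl : AnalyticAt ℂ (fun y => f (0, y)) 0 :=
    AnalyticAt.fun_comp (g := f) (f := fun y : ℂ => ((0 : ℂ), y)) hf (by fun_prop)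
  have htop : analyticOrderAt (fun y => f (0, y)) 0 ≠ ⊤ := by
    intro h
    apply hv
    filter_upwards [analyticOrderAt_eq_top.1 h, hline.eventually hYf] with y h1 h2
    exact h2.2 h1
  obtain ⟨n, hn⟩ := ENat.ne_top_iff_exists.1 htop
  have hn0 : n ≠ 0 := by
    rintro rfl
    exact analyticOrderAt_ne_zero.2 ⟨hfl, hf0⟩ hn.symm
  have hex : ∃ k, 0 < k ∧ ∃ s : ℂ → ℂ, AnalyticAt ℂ s 0 ∧ s 0 = 0 ∧
      ∀ᶠ t in 𝓝 0, f (t ^ k, s t) = 0 := by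
    obtain ⟨k, s, hk, h⟩ := exists_pow_root hf hn.symm hn0
    exact ⟨k, hk, s, h⟩
  classical
  obtain ⟨hk, s, hs, hs0, hfs⟩ := Nat.find_spec hex
  have hmin := fun m => Nat.find_min (m := m) hex
  generalize Nat.find hex = k at hk hfs hmin
  -- By minimality of `k`: if a nontrivial rotation fixed `s`, then `s` would be a germ in a power
  -- of `t` and a smaller `k` would do.
  have hne : ∀ ζ : ℂ, ζ ^ k = 1 → ζ ≠ 1 → ∀ᶠ t in 𝓝[≠] 0, s (ζ * t) ≠ s t := by
    intro ζ hζ hζ1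
    have hsζ : AnalyticAt ℂ (fun t => s (ζ * t)) 0 := by
      refine AnalyticAt.fun_comp (g := s) (f := fun t => ζ * t) ?_ (by fun_prop)
      simpa using hs
    refine (hsζ.eventually_eq_or_eventually_ne hs).resolve_left fun heq => ?_
    have hd : 0 < orderOf ζ := orderOf_pos_iff.2 (isOfFinOrder_iff_pow_eq_one.2 ⟨k, hk, hζ⟩)
    obtain ⟨e, he⟩ := orderOf_dvd_of_pow_eq_one hζ
    have hd1 : orderOf ζ ≠ 1 := fun h => hζ1 (orderOf_eq_one_iff.1 h)
    have hpow : ∀ i, ∀ᶠ t in 𝓝 0, s (ζ ^ i * t) = s t := by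
      intro i
      induction i with
      | zero => simp
      | succ i ih =>
        filter_upwards [(tendsto_mul_zero ζ).eventually ih, heq] with t h1 h2
        rw [pow_succ, mul_assoc, h1, h2]
    have hprim := IsPrimitiveRoot.orderOf ζ
    have : NeZero (orderOf ζ) := ⟨hd.ne'⟩
    obtain ⟨r, hr, hsr⟩ := exists_eventuallyEq_comp_pow hs hd fun ξ hξ => by
      obtain ⟨i, -, rfl⟩ := hprim.eq_pow_of_pow_eq_one hξ
      exact hpow i
    have he0 : 0 < e := Nat.pos_of_ne_zero (by rintro rfl; simp at he; omega)
    have hek : e < k := by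
      rw [he]
      have : 1 < orderOf ζ := by omega
      nlinarith
    refine hmin e hek ⟨he0, r, hr, ?_, ?_⟩
    · have := hsr.self_of_nhds
      rw [hs0, zero_pow hd.ne'] at this
      exact this.symm
    · refine eventually_of_eventually_pow hd (P := fun x => f (x ^ e, r x) = 0) ?_
      filter_upwards [hfs, hsr] with t h1 h2
      rw [← h2, ← pow_mul, ← he, h1]
  set R := Polynomial.nthRootsFinset k (1 : ℂ) with hR
  have hFan : AnalyticAt ℂ (fun p : ℂ × ℂ => f (p.1 ^ k, p.2)) 0 := by
    refine AnalyticAt.fun_comp (g := f) (f := fun p : ℂ × ℂ => (p.1 ^ k, p.2)) ?_ (by fun_prop)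
    simp only [Prod.fst_zero, Prod.snd_zero, zero_pow hk.ne']
    exact hf
  obtain ⟨H, hH, hFH⟩ := exists_eq_prod_mul hFan hs hs0 R (fun ζ hζ ξ hξ hζξ => by
      have hξ1 := (mem_roots_one hk).1 hξ
      have hζ1 := (mem_roots_one hk).1 hζ
      have hξ0 := ne_zero_of_pow_eq_one hk hξ1
      have h1 := hne (ζ / ξ) (by rw [div_pow, hζ1, hξ1, div_one])
        (by rwa [Ne, div_eq_one_iff_eq hξ0])
      have h2 : Tendsto (fun t : ℂ => ξ * t) (𝓝[≠] 0) (𝓝[≠] 0) := by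
        refine tendsto_nhdsWithin_iff.2 ⟨(tendsto_mul_zero ξ).mono_left nhdsWithin_le_nhds, ?_⟩
        filter_upwards [self_mem_nhdsWithin] with t ht using mul_ne_zero hξ0 ht
      filter_upwards [h2.eventually h1] with t ht
      rwa [← mul_assoc, div_mul_cancel₀ _ hξ0] at ht)
    (fun ζ hζ => by
      filter_upwards [(tendsto_mul_zero ζ).eventually hfs] with t ht
      rwa [mul_pow, (mem_roots_one hk).1 hζ, one_mul] at ht)
  have hsr : ∀ ξ : ℂ, AnalyticAt ℂ (fun p : ℂ × ℂ => s (ξ * p.1)) 0 := fun ξ => by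
    refine AnalyticAt.fun_comp (g := s) (f := fun p : ℂ × ℂ => ξ * p.1) ?_ (by fun_prop)
    simpa using hs
  -- The product of the conjugate factors descends to a germ in `(x, y)`; the average of `H` over
  -- the rotations descends too and serves as cofactor.
  obtain ⟨g, hg, hgG⟩ := exists_eq_comp_pow hk
    (G := fun p : ℂ × ℂ => ∏ ζ ∈ R, (p.2 - s (ζ * p.1)))
    (Finset.analyticAt_fun_prod _ fun ζ _ => analyticAt_snd.fun_sub (hsr ζ)) (fun ζ hζ t y => by
      have := prod_roots_mul hk hζ fun ξ => y - s (ξ * t)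
      simpa only [mul_assoc] using this)
  obtain ⟨h, hh, hhG⟩ := exists_eq_comp_pow hk
    (G := fun p : ℂ × ℂ => (k : ℂ)⁻¹ * ∑ ξ ∈ R, H (ξ * p.1, p.2))
    (analyticAt_const.fun_mul (Finset.analyticAt_fun_sum _ fun ξ _ => by
      refine AnalyticAt.fun_comp (g := H) (f := fun p : ℂ × ℂ => (ξ * p.1, p.2)) ?_ (by fun_prop)
      simp only [Prod.fst_zero, Prod.snd_zero, mul_zero]
      exact hH)) (fun ζ hζ t y => by
      simp only
      congr 1
      have := sum_roots_mul hk hζ fun ξ => H (ξ * t, y)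
      simpa only [mul_assoc] using this)
  have hfgh' : ∀ᶠ p in 𝓝 (0 : ℂ × ℂ), f (p.1 ^ k, p.2) = g (p.1 ^ k, p.2) * h (p.1 ^ k, p.2) := by
    have h1 : ∀ᶠ p in 𝓝 (0 : ℂ × ℂ), ∀ ξ ∈ R, f ((ξ * p.1) ^ k, p.2) =
        (∏ ζ ∈ R, (p.2 - s (ζ * (ξ * p.1)))) * H (ξ * p.1, p.2) := by
      refine (Filter.eventually_all_finset _).2 fun ξ _ => ?_
      have : Tendsto (fun p : ℂ × ℂ => (ξ * p.1, p.2)) (𝓝 0) (𝓝 0) := by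
        have := (Continuous.tendsto (f := fun p : ℂ × ℂ => (ξ * p.1, p.2)) (by fun_prop) 0)
        simp only [Prod.fst_zero, Prod.snd_zero, mul_zero] at this
        exact this
      exact this.eventually hFH
    filter_upwards [h1] with p hp
    have h2 : ∀ ξ ∈ R, f (p.1 ^ k, p.2) = g (p.1 ^ k, p.2) * H (ξ * p.1, p.2) := by
      intro ξ hξ
      have hξ1 := (mem_roots_one hk).1 hξ
      have h3 := hp ξ hξ
      have h4 := prod_roots_mul hk hξ1 fun ζ => p.2 - s (ζ * p.1)
      simp only [mul_assoc] at h4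
      rw [mul_pow, hξ1, one_mul, h4] at h3
      rw [h3, ← hgG]
    rw [← hhG, ← mul_assoc, mul_comm (g _), mul_assoc, Finset.mul_sum, ← Finset.sum_congr rfl h2,
      Finset.sum_const, card_roots_one hk, nsmul_eq_mul,
      inv_mul_cancel_left₀ (by exact_mod_cast hk.ne')]
  have hfgh : f =ᶠ[𝓝 0] g * h := by
    filter_upwards [eventually_forall_root_prod hfgh'] with p hp
    obtain ⟨t, ht⟩ := IsAlgClosed.exists_pow_nat_eq p.1 hk
    have := hp t ht
    simp only [ht] at this
    exact this
  have hg0 : g 0 = 0 := by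
    have h1 := hgG 0 0
    simp only [mul_zero, hs0, sub_zero, zero_pow hk.ne'] at h1
    rw [Finset.prod_const, card_roots_one hk, zero_pow hk.ne'] at h1
    exact h1.symm
  -- Irreducibility makes the cofactor a unit, so `f` vanishes only on the conjugates of the one
  -- branch.
  have hh0 : h 0 ≠ 0 := (hirr g h hg hh hfgh).resolve_left (not_not.2 hg0)
  refine ⟨k, s, hk, hs, hs0, exists_injOn_of_forall_ne hk hne, ?_⟩
  filter_upwards [hYf, hfgh, hh.continuousAt.eventually_ne hh0] with p h1 h2 h3
  rw [h1, h2, Pi.mul_apply, mul_eq_zero, or_iff_left h3]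
  obtain ⟨t, ht⟩ := IsAlgClosed.exists_pow_nat_eq p.1 hk
  have h4 := hgG t p.2
  simp only [ht] at h4
  rw [show p = (p.1, p.2) from rfl, ← h4, Finset.prod_eq_zero_iff]
  constructor
  · rintro ⟨ζ, hζ, h5⟩
    exact ⟨ζ * t, by rw [mul_pow, (mem_roots_one hk).1 hζ, one_mul, ht], (sub_eq_zero.1 h5).symm⟩
  · rintro ⟨u, hu, hsu⟩
    by_cases ht0 : t = 0
    · have hu0 : u = 0 := by
        simp only at hu
        rw [← ht, ht0, zero_pow hk.ne'] at hu
        exact (pow_eq_zero_iff hk.ne').1 hu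
      refine ⟨1, (mem_roots_one hk).2 (one_pow k), ?_⟩
      rw [ht0, one_mul, ← hsu, hu0, sub_self]
    · refine ⟨u / t, (mem_roots_one hk).2 ?_, ?_⟩
      · simp only at hu
        rw [div_pow, hu, ht, div_self]
        rw [← ht]; exact pow_ne_zero _ ht0
      · rw [div_mul_cancel₀ _ ht0, ← hsu, sub_self]

theorem IsParam.eventually_exists (h : IsParam W k s) (h' : IsParam W k' s') :
    ∀ᶠ t in 𝓝 (0 : ℂ), ∃ u, u ^ k' = t ^ k ∧ s' u = s t := by
  filter_upwards [h.eventually_mem, h.tendsto.eventually h'.mem_iff] with t h1 h2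
  exact h2.1 h1

/-- Over a small `x ≠ 0` the `k` roots give distinct points of `W`, each of which also comes from a
`k'`-th root of `x`. -/
theorem IsParam.le (h : IsParam W k s) (h' : IsParam W k' s') : k ≤ k' := by
  obtain ⟨U, hU, hinj⟩ := h.injOn
  have h1 := eventually_forall_root (k := k) ((h.eventually_exists h').and hU)
  obtain ⟨x, hx, hx0⟩ := ((h1.filter_mono nhdsWithin_le_nhds).and
    (self_mem_nhdsWithin : {(0 : ℂ)}ᶜ ∈ 𝓝[≠] 0)).exists
  replace hx0 : x ≠ 0 := hx0
  choose! u hu using fun t (ht : t ^ k = x) => (hx t ht).1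
  have hmem : ∀ {m : ℕ} (_ : 0 < m) {t : ℂ}, t ∈ Polynomial.nthRootsFinset m x ↔ t ^ m = x :=
    fun hm => Polynomial.mem_nthRootsFinset hm x
  rw [← card_roots h.pos hx0, ← card_roots h'.pos hx0]
  refine Finset.card_le_card_of_injOn u (fun t ht => ?_) (fun t ht v hv htv => ?_)
  · have ht' := (hmem h.pos).1 ht
    exact (hmem h'.pos).2 ((hu t ht').1.trans ht')
  · have ht' := (hmem h.pos).1 ht
    have hv' := (hmem h.pos).1 hv
    refine hinj (hx t ht').2 (hx v hv').2 ?_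
    simp only [ht', hv']
    rw [← (hu t ht').2, ← (hu v hv').2, htv]

theorem IsParam.eq_left (h : IsParam W k s) (h' : IsParam W k' s') : k = k' :=
  le_antisymm (h.le h') (h'.le h)

/-- Parametrizations are unique up to multiplication of the parameter by a root of unity. -/
theorem IsParam.exists_eq_rotate (h : IsParam W k s) (h' : IsParam W k s') :
    ∃ ζ : ℂ, ζ ^ k = 1 ∧ s' =ᶠ[𝓝 0] fun t => s (ζ * t) := by
  by_contra hcon
  push Not at hcon
  -- Distinct analytic germs differ on a punctured neighbourhood, whereas `(t ^ k, s' t)` is a point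
  -- of `W` and so equals `(u ^ k, s u)` with `u / t` a root of unity.
  have h1 : ∀ᶠ t in 𝓝[≠] (0 : ℂ), ∀ ζ ∈ Polynomial.nthRootsFinset k (1 : ℂ), s' t ≠ s (ζ * t) := by
    refine (Filter.eventually_all_finset _).2 fun ζ hζ => ?_
    have hζ' := (mem_roots_one h.pos).1 hζ
    exact (h'.analyticAt.eventually_eq_or_eventually_ne
      (h.rotate hζ').analyticAt).resolve_left (hcon ζ hζ')
  obtain ⟨t, ⟨ht1, u, hu, hsu⟩, ht0⟩ := ((h1.and ((h'.eventually_exists h).filter_mono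
    nhdsWithin_le_nhds)).and (self_mem_nhdsWithin : {(0 : ℂ)}ᶜ ∈ 𝓝[≠] 0)).exists
  replace ht0 : t ≠ 0 := ht0
  refine ht1 (u / t) ((mem_roots_one h.pos).2 ?_) ?_
  · rw [div_pow, hu, div_self (pow_ne_zero _ ht0)]
  · rw [div_mul_cancel₀ _ ht0, hsu]

end PlaneCurve

end

noncomputable section

namespace PlaneCurve

/-! ### Tangent cones -/

/-- The linear form that vanishes at `v 0` is `o(‖p‖)` along `W`, which confines the cone to the
line through `v 0`; the secants `t ^ (-m) γ t` reach that line. `hout` ensures that points of `W`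
near the origin come from small parameters. -/
theorem tangentCone_eq_of_curve {W : Set (ℂ × ℂ)} {γ v : ℂ → ℂ × ℂ} {m : ℕ} (hm : 0 < m)
    (hγ : ∀ᶠ t in 𝓝 0, γ t = t ^ m • v t) (hv : ContinuousAt v 0) (hv0 : v 0 ≠ 0)
    (hin : ∀ᶠ t in 𝓝 0, γ t ∈ W)
    (hout : ∀ V ∈ 𝓝 (0 : ℂ), ∀ᶠ p in 𝓝 (0 : ℂ × ℂ), p ∈ W → ∃ t ∈ V, γ t = p) :
    tangentCone W = {p | p.1 * (v 0).2 = p.2 * (v 0).1} := by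
  let ℓ : ℂ × ℂ → ℂ := fun p => p.1 * (v 0).2 - p.2 * (v 0).1
  have hℓc : Continuous ℓ := by fun_prop
  have hℓs : ∀ (c : ℂ) p, ℓ (c • p) = c * ℓ p := fun c p => by
    simp only [ℓ, Prod.smul_fst, Prod.smul_snd, smul_eq_mul]; ring
  have hℓ0 : ℓ (v 0) = 0 := by simp only [ℓ]; ring
  ext y
  constructor
  · intro hy
    obtain ⟨α, l, hl, c, d, hd, hdW, hcd⟩ := exists_fun_of_mem_tangentConeAt hy
    simp only [zero_add] at hdW
    have hsmall : ∀ ε > 0, ‖ℓ y‖ ≤ ε * ‖y‖ := by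
      intro ε hε
      have h1 : ∀ᶠ t in 𝓝 (0 : ℂ), ‖ℓ (v t)‖ < ε * ‖v t‖ := by
        have hlim1 : Tendsto (fun t => ‖ℓ (v t)‖) (𝓝 0) (𝓝 0) := by
          have := ((hℓc.tendsto (v 0)).comp hv.tendsto).norm
          rwa [hℓ0, norm_zero] at this
        have hlim2 : Tendsto (fun t => ε * ‖v t‖) (𝓝 0) (𝓝 (ε * ‖v 0‖)) :=
          hv.tendsto.norm.const_mul ε
        exact hlim1.eventually_lt hlim2 (mul_pos hε (norm_pos_iff.2 hv0))
      have h2 : ∀ᶠ p in 𝓝 (0 : ℂ × ℂ), p ∈ W → ‖ℓ p‖ ≤ ε * ‖p‖ := by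
        filter_upwards [hout _ (h1.and hγ)] with p hp hpW
        obtain ⟨t, ⟨ht1, ht2⟩, rfl⟩ := hp hpW
        rw [ht2, hℓs, norm_mul, norm_smul]
        nlinarith [norm_nonneg (t ^ m)]
      refine le_of_tendsto_of_tendsto (((hℓc.tendsto y).comp hcd).norm) (hcd.norm.const_mul ε) ?_
      filter_upwards [hd.eventually h2, hdW] with n hn hnW
      have := hn hnW
      simp only [Function.comp_apply]
      rw [hℓs, norm_mul, norm_smul]
      nlinarith [norm_nonneg (c n)]
    have hzero : ‖ℓ y‖ ≤ 0 := by
      refine ge_of_tendsto (x := 𝓝[>] (0 : ℝ)) (f := fun ε => ε * ‖y‖) ?_ ?_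
      · have : Tendsto (fun ε : ℝ => ε * ‖y‖) (𝓝 0) (𝓝 (0 * ‖y‖)) :=
          tendsto_id.mul_const _
        rw [zero_mul] at this
        exact this.mono_left nhdsWithin_le_nhds
      · filter_upwards [self_mem_nhdsWithin] with ε hε using hsmall ε hε
    exact sub_eq_zero.1 (norm_le_zero_iff.1 hzero)
  · intro hy
    obtain ⟨c, hc⟩ : ∃ c : ℂ, c • v 0 = y := by
      replace hy : y.1 * (v 0).2 = y.2 * (v 0).1 := hy
      by_cases h1 : (v 0).1 = 0
      · have h2 : (v 0).2 ≠ 0 := fun h2 => hv0 (Prod.ext h1 h2)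
        refine ⟨y.2 / (v 0).2, Prod.ext ?_ ?_⟩
        · rw [h1, mul_zero] at hy
          simp [h1, (mul_eq_zero.1 hy).resolve_right h2]
        · simp [div_mul_cancel₀ _ h2]
      · refine ⟨y.1 / (v 0).1, Prod.ext ?_ ?_⟩
        · simp [div_mul_cancel₀ _ h1]
        · simp only [Prod.smul_snd, smul_eq_mul]; field_simp; rw [hy, mul_comm]
    refine mem_tangentConeAt_of_seq (𝓝[≠] (0 : ℂ)) (fun t => c * (t ^ m)⁻¹) γ ?_ ?_ ?_
    · have h1 : Tendsto (fun t : ℂ => t ^ m • v t) (𝓝 0) (𝓝 0) := by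
        have := (tendsto_pow_zero hm).smul hv.tendsto
        rwa [zero_smul] at this
      exact (h1.congr' (EventuallyEq.symm hγ)).mono_left nhdsWithin_le_nhds
    · simp only [zero_add]; exact nhdsWithin_le_nhds hin
    · have h1 : Tendsto (fun t : ℂ => c • v t) (𝓝[≠] 0) (𝓝 y) := by
        rw [← hc]; exact (hv.tendsto.const_smul c).mono_left nhdsWithin_le_nhds
      refine h1.congr' ?_
      filter_upwards [nhdsWithin_le_nhds hγ, self_mem_nhdsWithin] with t ht ht0
      rw [ht, smul_smul, mul_assoc, inv_mul_cancel₀ (pow_ne_zero _ ht0), mul_one]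

variable {W : Set (ℂ × ℂ)} {k m : ℕ} {s c : ℂ → ℂ}

theorem IsParam.eventually_exists_mem (h : IsParam W k s) {V : Set ℂ} (hV : V ∈ 𝓝 (0 : ℂ)) :
    ∀ᶠ p in 𝓝 (0 : ℂ × ℂ), p ∈ W → ∃ t ∈ V, (t ^ k, s t) = p := by
  filter_upwards [h.mem_iff, eventually_forall_root_fst (k := k) hV] with p hp hpV hpW
  obtain ⟨t, ht, hst⟩ := hp.1 hpW
  exact ⟨t, hpV t ht, Prod.ext ht hst⟩

theorem IsParam.tangentCone_of_eq_pow_mul (h : IsParam W k s) (hc : AnalyticAt ℂ c 0)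
    (hs : ∀ᶠ t in 𝓝 0, s t = t ^ k * c t) : tangentCone W = {p | p.2 = c 0 * p.1} := by
  rw [tangentCone_eq_of_curve (γ := fun t => (t ^ k, s t)) (v := fun t => (1, c t)) h.pos ?_
    (continuousAt_const.prodMk hc.continuousAt) (by simp) h.eventually_mem
    fun V hV => h.eventually_exists_mem hV]
  · ext p
    simp only [Set.mem_ofPred_eq, mul_one]
    rw [mul_comm, eq_comm]
  · filter_upwards [hs] with t ht
    simp [ht]

theorem IsParam.tangentCone_of_lt (h : IsParam W k s) (hm : analyticOrderAt s 0 = m) (hmk : m < k) :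
    tangentCone W = {p | p.1 = 0} := by
  obtain ⟨g, hg, hg0, hsg⟩ := h.analyticAt.analyticOrderAt_eq_natCast.1 hm
  have hm0 : 0 < m := by
    rw [Nat.pos_iff_ne_zero]
    rintro rfl
    exact analyticOrderAt_ne_zero.2 ⟨h.analyticAt, h.map_zero⟩ hm
  have hkm : k - m ≠ 0 := by omega
  rw [tangentCone_eq_of_curve (γ := fun t => (t ^ k, s t)) (v := fun t => (t ^ (k - m), g t)) hm0 ?_
    (ContinuousAt.prodMk (by fun_prop) hg.continuousAt) (by simp [hg0]) h.eventually_mem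
    fun V hV => h.eventually_exists_mem hV]
  · ext p
    simp [hkm, hg0]
  · filter_upwards [hsg] with t ht
    simp [ht, ← pow_add, Nat.add_sub_cancel' hmk.le]

theorem tangentCone_yAxis : tangentCone yAxis = {p | p.1 = 0} := by
  rw [tangentCone_eq_of_curve (γ := fun t => (0, t)) (v := fun _ => (0, 1)) (m := 1) one_pos
    (by simp) continuousAt_const (by simp) (by simp [yAxis]) ?_]
  · simp
  · intro V hV
    filter_upwards [(continuous_snd.tendsto (0 : ℂ × ℂ)).eventually hV] with p hp hpW
    exact ⟨p.2, hp, Prod.ext (Eq.symm hpW) rfl⟩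

theorem isTransversal_yAxis_of_tangentCone {b : ℂ} (h : tangentCone W = {p | p.2 = b * p.1}) :
    IsTransversal W yAxis := by
  rw [IsTransversal, h, tangentCone_yAxis]
  ext p
  simp only [Set.mem_inter_iff, Set.mem_ofPred_eq, Set.mem_singleton_iff]
  constructor
  · rintro ⟨h1, h2⟩; rw [h2, mul_zero] at h1; exact Prod.ext h2 h1
  · rintro rfl; simp

theorem not_isTransversal_yAxis_of_tangentCone (h : tangentCone W = {p | p.1 = 0}) :
    ¬ IsTransversal W yAxis := by
  rw [IsTransversal, h, tangentCone_yAxis, Set.inter_self]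
  intro h
  have : ((0 : ℂ), (1 : ℂ)) ∈ ({0} : Set (ℂ × ℂ)) := by rw [← h]; rfl
  simp at this

theorem exceptionalDivisor_eq (a : ℂ) : exceptionalDivisor a = yAxis := by
  ext p
  simp only [exceptionalDivisor, blowUp, Set.mem_preimage, Set.mem_singleton_iff, yAxis,
    Set.mem_ofPred_eq, Prod.ext_iff, Prod.fst_zero, Prod.snd_zero]
  exact ⟨fun h => h.1, fun h => ⟨h, by rw [h, zero_mul]⟩⟩

/-- The zero series has order `⊤`, so contact with `E` reads off the order of the other germ. -/
theorem isParam_swap_yAxis : IsParam (swapCoords yAxis) 1 fun _ => 0 where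
  pos := one_pos
  analyticAt := analyticAt_const
  map_zero := rfl
  injOn := ⟨Set.univ, univ_mem, fun t _ u _ h => by simpa using h⟩
  mem_iff := Eventually.of_forall fun p => by
    simp [swapCoords, yAxis, eq_comm]

/-- A curve with tangent cone `y = a x` has a parametrization `x = t ^ k`, `y = t ^ k (a + σ t)`. -/
theorem IsIrreduciblePlaneCurve.exists_isParam_of_tangentCone {Y : Set (ℂ × ℂ)} {a : ℂ}
    (hY : IsIrreduciblePlaneCurve Y) (ha : tangentCone Y = {v | v.2 = a * v.1}) :
    ∃ (k : ℕ) (s σ : ℂ → ℂ), IsParam Y k s ∧ AnalyticAt ℂ σ 0 ∧ σ 0 = 0 ∧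
      ∀ᶠ t in 𝓝 0, s t = t ^ k * (a + σ t) := by
  have hvert : ((0 : ℂ), (1 : ℂ)) ∉ tangentCone Y := by rw [ha]; simp
  -- A germ containing `{x = 0}` would have a vertical vector in its tangent cone.
  obtain ⟨k, s, h⟩ := hY.exists_isParam fun hv => hvert <| by
    refine mem_tangentConeAt_of_seq (𝓝[≠] (0 : ℂ)) (fun t => t⁻¹) (fun t => (0, t)) ?_ ?_ ?_
    · have : Tendsto (fun t : ℂ => ((0 : ℂ), t)) (𝓝 0) (𝓝 ((0 : ℂ), (0 : ℂ))) :=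
        Continuous.tendsto (by fun_prop) 0
      exact this.mono_left nhdsWithin_le_nhds
    · simp only [zero_add]; exact nhdsWithin_le_nhds hv
    · refine tendsto_const_nhds.congr' ?_
      filter_upwards [self_mem_nhdsWithin] with t ht
      rw [Prod.smul_mk, smul_zero, smul_eq_mul, inv_mul_cancel₀ ht]
  have hord : (k : ℕ∞) ≤ analyticOrderAt s 0 := by
    by_contra hlt
    rw [not_le] at hlt
    obtain ⟨m, hm⟩ := ENat.ne_top_iff_exists.1 hlt.ne_top
    rw [h.tangentCone_of_lt hm.symm (by rw [← hm] at hlt; exact_mod_cast hlt)] at hvert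
    exact hvert rfl
  obtain ⟨c, hc, hsc⟩ := (natCast_le_analyticOrderAt h.analyticAt).1 hord
  simp only [sub_zero, smul_eq_mul] at hsc
  have hca : c 0 = a := by
    have h1 := h.tangentCone_of_eq_pow_mul hc hsc
    rw [ha] at h1
    have h2 : ((1 : ℂ), c 0) ∈ {v : ℂ × ℂ | v.2 = a * v.1} := by rw [h1]; simp
    simpa using h2
  refine ⟨k, s, fun t => c t - a, h, hc.fun_sub analyticAt_const, by simp [hca], ?_⟩
  filter_upwards [hsc] with t ht
  rw [ht]; ring

/-! ### Strict transforms -/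

/-- Off `E` the chart is inverted by dividing `y` by `x = t ^ k` and subtracting `a`; the closure
then adds only the origin locally. -/
theorem IsParam.strictTransform {Y : Set (ℂ × ℂ)} {a : ℂ} {σ : ℂ → ℂ} (h : IsParam Y k s)
    (hσ : AnalyticAt ℂ σ 0) (hσ0 : σ 0 = 0) (hs : ∀ᶠ t in 𝓝 0, s t = t ^ k * (a + σ t)) :
    IsParam (strictTransform a Y) k σ where
  pos := h.pos
  analyticAt := hσ
  map_zero := hσ0
  injOn := by
    obtain ⟨U, hU, hinj⟩ := h.injOn
    refine ⟨U ∩ {t | s t = t ^ k * (a + σ t)}, inter_mem hU hs, fun t ht u hu htu =>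
      hinj ht.1 hu.1 ?_⟩
    have h1 : s t = t ^ k * (a + σ t) := ht.2
    have h2 : s u = u ^ k * (a + σ u) := hu.2
    simp only [Prod.mk.injEq] at htu ⊢
    exact ⟨htu.1, by rw [h1, h2, htu.1, htu.2]⟩
  mem_iff := by
    set B := blowUp a ⁻¹' (Y \ {0}) with hB
    have hblow : Tendsto (blowUp a) (𝓝 0) (𝓝 0) := by
      have : Continuous (blowUp a) := by unfold blowUp; fun_prop
      have h1 := this.tendsto 0
      have h2 : blowUp a 0 = 0 := by simp [blowUp]
      rwa [h2] at h1
    have hmemB : ∀ᶠ q in 𝓝 (0 : ℂ × ℂ), q ∈ B ↔ q.1 ≠ 0 ∧ ∃ t, t ^ k = q.1 ∧ σ t = q.2 := by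
      filter_upwards [hblow.eventually h.mem_iff, eventually_forall_root_fst (k := k) hs]
        with q h1 h2
      have h3 : blowUp a q = 0 ↔ q.1 = 0 := by
        simp only [blowUp, Prod.ext_iff, Prod.fst_zero, Prod.snd_zero]
        exact ⟨fun h => h.1, fun h => ⟨h, by rw [h, zero_mul]⟩⟩
      rw [hB, Set.mem_preimage, Set.mem_sdiff, Set.mem_singleton_iff, h3, h1, and_comm]
      refine and_congr_right fun hq => exists_congr fun t => and_congr_right fun ht => ?_
      replace ht : t ^ k = q.1 := ht
      rw [h2 t ht, ht]
      simp [blowUp, hq]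
    obtain ⟨r, hr, hball⟩ := Metric.eventually_nhds_iff_ball.1 hσ.eventually_analyticAt
    -- The image of a closed disc is compact, so the closure acquires no points outside the
    -- parametrized curve.
    have hK : IsClosed ((fun t : ℂ => (t ^ k, σ t)) '' Metric.closedBall 0 (r / 2)) := by
      refine ((isCompact_closedBall _ _).image_of_continuousOn fun t ht => ?_).isClosed
      have := (hball t (Metric.closedBall_subset_ball (by linarith) ht)).continuousAt
      exact (ContinuousAt.prodMk (by fun_prop) this).continuousWithinAt
    have hroot := eventually_forall_root_fst (k := k)
      (Metric.closedBall_mem_nhds (0 : ℂ) (half_pos hr))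
    obtain ⟨O, hO, hOo, h0O⟩ := eventually_nhds_iff.1 (hmemB.and hroot)
    have hcurve : Tendsto (fun t => (t ^ k, σ t)) (𝓝 0) (𝓝 (0 : ℂ × ℂ)) := by
      have := (tendsto_pow_zero h.pos).prodMk_nhds hσ.continuousAt.tendsto
      rwa [hσ0] at this
    have hzero : (0 : ℂ × ℂ) ∈ closure B := by
      refine mem_closure_of_tendsto (hcurve.mono_left (nhdsWithin_le_nhds (s := {0}ᶜ))) ?_
      filter_upwards [nhdsWithin_le_nhds (hcurve.eventually hmemB), self_mem_nhdsWithin]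
        with t ht ht0
      exact ht.2 ⟨pow_ne_zero _ ht0, t, rfl, rfl⟩
    filter_upwards [hOo.mem_nhds h0O] with q hq
    constructor
    · intro hqB
      have h1 : q ∈ closure (O ∩ B) := hOo.inter_closure ⟨hq, hqB⟩
      have h2 : O ∩ B ⊆ (fun t : ℂ => (t ^ k, σ t)) '' Metric.closedBall 0 (r / 2) := by
        rintro p ⟨hpO, hpB⟩
        obtain ⟨-, t, ht, hσt⟩ := (hO p hpO).1.1 hpB
        exact ⟨t, (hO p hpO).2 t ht, Prod.ext ht hσt⟩
      obtain ⟨t, -, ht⟩ := closure_minimal h2 hK h1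
      exact ⟨t, congrArg Prod.fst ht, congrArg Prod.snd ht⟩
    · rintro ⟨t, ht, hσt⟩
      by_cases hq1 : q.1 = 0
      · have ht0 : t = 0 := by rw [hq1] at ht; exact (pow_eq_zero_iff h.pos.ne').1 ht
        have : q = 0 := Prod.ext hq1 (by rw [← hσt, ht0, hσ0]; rfl)
        rw [this]; exact hzero
      · exact subset_closure ((hO q hq).1.2 ⟨hq1, t, ht, hσt⟩)

/-! ### Exchange of the coordinates -/

theorem exists_local_inverse {A : ℂ → ℂ} (hA : AnalyticAt ℂ A 0) (hA0 : A 0 = 0)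
    (hA1 : deriv A 0 ≠ 0) : ∃ θ : ℂ → ℂ, AnalyticAt ℂ θ 0 ∧ θ 0 = 0 ∧
      (∀ᶠ t in 𝓝 0, θ (A t) = t) ∧ ∀ᶠ τ in 𝓝 0, A (θ τ) = τ := by
  refine ⟨hA.hasStrictDerivAt.localInverse _ _ _ hA1, ?_, ?_,
    HasStrictDerivAt.eventually_left_inverse .., ?_⟩
  · have := hA.analyticAt_localInverse hA1
    rwa [hA0] at this
  · have : hA.hasStrictDerivAt.localInverse _ _ _ hA1 (A 0) = 0 :=
      HasStrictFDerivAt.localInverse_apply_image ..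
    rwa [hA0] at this
  · have := HasStrictDerivAt.eventually_right_inverse hA.hasStrictDerivAt hA1
    rwa [hA0] at this

/-- With the uniformizer `τ = A t` the curve reads `y = τ ^ m`, `x = θ τ ^ k`. -/
theorem IsParam.swap {A θ : ℂ → ℂ} (h : IsParam W k s) (hm : 0 < m)
    (hAs : ∀ᶠ t in 𝓝 0, A t ^ m = s t) (hθ : AnalyticAt ℂ θ 0) (hθ0 : θ 0 = 0)
    (hθA : ∀ᶠ t in 𝓝 0, θ (A t) = t) (hAθ : ∀ᶠ τ in 𝓝 0, A (θ τ) = τ) :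
    IsParam (swapCoords W) m fun τ => θ τ ^ k := by
  have hθt : Tendsto θ (𝓝 0) (𝓝 0) := by
    have := hθ.continuousAt.tendsto
    rwa [hθ0] at this
  have hsθ : ∀ᶠ τ in 𝓝 0, s (θ τ) = τ ^ m := by
    filter_upwards [hθt.eventually hAs, hAθ] with τ h1 h2
    rw [← h1, h2]
  refine ⟨hm, hθ.fun_pow k, by simp [hθ0, h.pos.ne'], ?_, ?_⟩
  · obtain ⟨U, hU, hinj⟩ := h.injOn
    refine ⟨_, (hθt.eventually hU).and (hsθ.and hAθ), fun t ht u hu htu => ?_⟩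
    simp only [Prod.mk.injEq] at htu
    have := hinj ht.1 hu.1 (by simp only [htu.2, ht.2.1, hu.2.1, htu.1])
    rw [← ht.2.2, ← hu.2.2, this]
  · have hswap : Tendsto (Prod.swap : ℂ × ℂ → ℂ × ℂ) (𝓝 0) (𝓝 0) :=
      continuous_swap.tendsto (0 : ℂ × ℂ)
    filter_upwards [hswap.eventually h.mem_iff,
      hswap.eventually (eventually_forall_root_fst (k := k) (hAs.and hθA)),
      eventually_forall_root_fst (k := m) hsθ] with p h1 h2 h3
    rw [swapCoords, Set.mem_preimage, h1]
    constructor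
    · rintro ⟨t, ht, hst⟩
      have h4 := h2 t ht
      exact ⟨A t, by rw [h4.1, hst]; rfl, by rw [h4.2, ht]; rfl⟩
    · rintro ⟨τ, hτ, hθτ⟩
      exact ⟨θ τ, hθτ, by rw [h3 τ hτ, hτ]; rfl⟩

end PlaneCurve

end

noncomputable section

namespace PlaneCurve

/-! ### Orders of vanishing -/

theorem analyticOrderAt_pow_zero (n : ℕ) : analyticOrderAt (fun t : ℂ => t ^ n) 0 = n := by
  simpa [Pi.pow_def] using analyticOrderAt_centeredMonomial (𝕜 := ℂ) (z₀ := 0) (n := n)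

theorem analyticOrderAt_pow_mul {f g : ℂ → ℂ} {n : ℕ} (hg : AnalyticAt ℂ g 0)
    (h : ∀ᶠ t in 𝓝 0, f t = t ^ n * g t) : analyticOrderAt f 0 = n + analyticOrderAt g 0 := by
  rw [analyticOrderAt_congr (g := (fun t : ℂ => t ^ n) * g) h, analyticOrderAt_mul (by fun_prop) hg,
    analyticOrderAt_pow_zero]

theorem analyticOrderAt_comp_pow {f : ℂ → ℂ} (hf : AnalyticAt ℂ f 0) {d : ℕ} (hd : 0 < d) :
    analyticOrderAt (fun t => f (t ^ d)) 0 = analyticOrderAt f 0 * d := by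
  have h0 : (0 : ℂ) ^ d = 0 := zero_pow hd.ne'
  have := AnalyticAt.analyticOrderAt_comp (f := f) (g := fun t : ℂ => t ^ d) (z₀ := 0)
    (by simpa [h0] using hf) (by fun_prop)
  simp only [h0, sub_zero, analyticOrderAt_pow_zero] at this
  exact this

theorem analyticAt_comp_pow {f : ℂ → ℂ} (hf : AnalyticAt ℂ f 0) {d : ℕ} (hd : 0 < d) :
    AnalyticAt ℂ (fun t => f (t ^ d)) 0 := by
  refine AnalyticAt.fun_comp (g := f) (f := fun t : ℂ => t ^ d) ?_ (by fun_prop)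
  simpa [hd.ne'] using hf

theorem deriv_eq_of_eq_mul {A u : ℂ → ℂ} (hu : AnalyticAt ℂ u 0)
    (h : ∀ᶠ t in 𝓝 0, A t = t * u t) : deriv A 0 = u 0 := by
  have h1 : HasDerivAt (fun t => t * u t) (1 * u 0 + 0 * deriv u 0) 0 :=
    (hasDerivAt_id (0 : ℂ)).fun_mul hu.differentiableAt.hasDerivAt
  rw [EventuallyEq.deriv_eq h, h1.deriv]
  simp

theorem exists_eq_mul {A : ℂ → ℂ} (hA : AnalyticAt ℂ A 0) (hA0 : A 0 = 0) :
    ∃ u : ℂ → ℂ, AnalyticAt ℂ u 0 ∧ ∀ᶠ t in 𝓝 0, A t = t * u t := by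
  have : ((1 : ℕ) : ℕ∞) ≤ analyticOrderAt A 0 := by
    rw [Nat.cast_one, Order.one_le_iff_ne_zero]
    exact analyticOrderAt_ne_zero.2 ⟨hA, hA0⟩
  obtain ⟨u, hu, h⟩ := (natCast_le_analyticOrderAt hA).1 this
  exact ⟨u, hu, by simpa using h⟩

/-- The cofactor `∑ A ^ i B ^ (M - i)` of `A - B` has order exactly `M`: its leading coefficient is
`(M + 1) A'(0) ^ M`. -/
theorem analyticOrderAt_pow_sub_pow {A B : ℂ → ℂ} (hA : AnalyticAt ℂ A 0) (hB : AnalyticAt ℂ B 0)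
    (hA0 : A 0 = 0) (hB0 : B 0 = 0) (hAB : deriv A 0 = deriv B 0) (hA1 : deriv A 0 ≠ 0) (M : ℕ) :
    analyticOrderAt (fun t => A t ^ (M + 1) - B t ^ (M + 1)) 0 =
      M + analyticOrderAt (fun t => A t - B t) 0 := by
  obtain ⟨u, hu, hAu⟩ := exists_eq_mul hA hA0
  obtain ⟨v, hv, hBv⟩ := exists_eq_mul hB hB0
  have hu0 := deriv_eq_of_eq_mul hu hAu
  have hv0 := deriv_eq_of_eq_mul hv hBv
  let Q : ℂ → ℂ := fun t => ∑ i ∈ Finset.range (M + 1), u t ^ i * v t ^ (M + 1 - 1 - i)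
  have hQ : AnalyticAt ℂ Q 0 := Finset.analyticAt_fun_sum _ fun i _ =>
    (hu.fun_pow i).fun_mul (hv.fun_pow _)
  have hQ0 : Q 0 ≠ 0 := by
    simp only [Q]
    rw [← hv0, ← hAB, ← hu0, geom_sum₂_self]
    exact mul_ne_zero (Nat.cast_ne_zero.2 (Nat.succ_ne_zero M)) (pow_ne_zero _ hA1)
  have hAB' : AnalyticAt ℂ (fun t => A t - B t) 0 := hA.fun_sub hB
  rw [analyticOrderAt_pow_mul (n := M) (g := Q * fun t => A t - B t) (hQ.mul hAB') ?_,
    analyticOrderAt_mul hQ hAB', hQ.analyticOrderAt_eq_zero.2 hQ0, zero_add]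
  filter_upwards [hAu, hBv] with t h1 h2
  have h3 := geom_sum₂_mul (u t) (v t) (M + 1)
  simp only [Pi.mul_apply, Q]
  rw [h1, h2, ← mul_sub, mul_left_comm _ t, h3]
  ring

theorem deriv_local_inverse {A θ : ℂ → ℂ} (hA : AnalyticAt ℂ A 0) (hA0 : A 0 = 0)
    (hθ : AnalyticAt ℂ θ 0) (hθA : ∀ᶠ t in 𝓝 0, θ (A t) = t) : deriv θ 0 * deriv A 0 = 1 := by
  have h1 : HasDerivAt θ (deriv θ 0) (A 0) := by
    rw [hA0]; exact hθ.differentiableAt.hasDerivAt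
  have h2 := (h1.comp (0 : ℂ) hA.differentiableAt.hasDerivAt).deriv
  rw [← h2, EventuallyEq.deriv_eq (f := id) (f₁ := θ ∘ A) hθA]
  simp

/-- Composing with `A` gives `(θ - η) ∘ A = η ∘ B - η ∘ A`, which is `B - A` times a unit because
`η'(0) ≠ 0`. -/
theorem analyticOrderAt_local_inverse_sub {A B θ η : ℂ → ℂ} (hA : AnalyticAt ℂ A 0)
    (hB : AnalyticAt ℂ B 0) (hA0 : A 0 = 0) (hB0 : B 0 = 0) (hθ : AnalyticAt ℂ θ 0)
    (hη : AnalyticAt ℂ η 0) (hη0 : η 0 = 0) (hθA : ∀ᶠ t in 𝓝 0, θ (A t) = t)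
    (hηB : ∀ᶠ t in 𝓝 0, η (B t) = t) :
    analyticOrderAt (fun t => θ t - η t) 0 = analyticOrderAt (fun t => A t - B t) 0 := by
  have hA1 : deriv A 0 ≠ 0 := right_ne_zero_of_mul_eq_one (deriv_local_inverse hA hA0 hθ hθA)
  have hη1 : deriv η 0 ≠ 0 := left_ne_zero_of_mul_eq_one (deriv_local_inverse hB hB0 hη hηB)
  have h1 := analyticOrderAt_comp_of_deriv_ne_zero (f := fun t => θ t - η t) hA hA1
  rw [hA0] at h1
  rw [← h1]
  have hΦ : AnalyticAt ℂ (fun p : ℂ × ℂ => η (p.1 + p.2) - η p.1) 0 := by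
    refine AnalyticAt.fun_sub
      (AnalyticAt.fun_comp (g := η) (f := fun p : ℂ × ℂ => p.1 + p.2) (by simpa using hη)
        (by fun_prop)) (AnalyticAt.fun_comp (g := η) (f := Prod.fst) hη analyticAt_fst)
  obtain ⟨h, hh, hmul⟩ := exists_eq_snd_mul hΦ (by simp)
  have hh0 : h 0 ≠ 0 := by
    have h2 : ∀ᶠ z in 𝓝 (0 : ℂ), η z = z * h (0, z) := by
      have := (Continuous.tendsto (f := fun z : ℂ => ((0 : ℂ), z)) (by fun_prop) 0).eventually hmul
      filter_upwards [this] with z hz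
      simpa [hη0] using hz
    have h3 := deriv_eq_of_eq_mul (AnalyticAt.fun_comp (g := h) (f := fun z : ℂ => ((0 : ℂ), z))
      (x := (0 : ℂ)) hh (by fun_prop)) h2
    rw [h3] at hη1
    exact hη1
  have hpair : AnalyticAt ℂ (fun t => (A t, B t - A t)) 0 := hA.prod (hB.fun_sub hA)
  have hpair0 : (A 0, B 0 - A 0) = (0 : ℂ × ℂ) := by simp [hA0, hB0]
  have hg : AnalyticAt ℂ (fun t => h (A t, B t - A t)) 0 :=
    AnalyticAt.fun_comp (g := h) (by rw [hpair0]; exact hh) hpair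
  have hg0 : h (A 0, B 0 - A 0) ≠ 0 := by rwa [hpair0]
  have hpt : Tendsto (fun t => (A t, B t - A t)) (𝓝 0) (𝓝 0) := by
    have := hpair.continuousAt.tendsto
    rwa [hpair0] at this
  have hBA : AnalyticAt ℂ (fun t => B t - A t) 0 := hB.fun_sub hA
  have h2 : ((fun t => θ t - η t) ∘ A) =ᶠ[𝓝 0]
      (fun t => B t - A t) * fun t => h (A t, B t - A t) := by
    filter_upwards [hθA, hηB, hpt.eventually hmul] with t h1 h2 h3
    simp only [add_sub_cancel] at h3
    simp only [Function.comp_apply, Pi.mul_apply]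
    rw [← h3, h1, h2]
  rw [analyticOrderAt_congr h2, analyticOrderAt_mul hBA hg, hg.analyticOrderAt_eq_zero.2 hg0,
    add_zero, ← analyticOrderAt_neg]
  congr 1
  ext t
  simp

/-! ### The inversion formula -/

/-- The value `α` at the origin is prescribed so that two germs can be given uniformizers with the
same derivative. -/
theorem exists_pow_eq_of_ne_zero {g : ℂ → ℂ} (hg : AnalyticAt ℂ g 0) (hg0 : g 0 ≠ 0) {M : ℕ}
    (hM : 0 < M) {α : ℂ} (hα : α ^ M = g 0) :
    ∃ v : ℂ → ℂ, AnalyticAt ℂ v 0 ∧ v 0 = α ∧ ∀ᶠ t in 𝓝 0, v t ^ M = g t := by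
  have h1 : AnalyticAt ℂ (fun t => g t / g 0) 0 := hg.fun_div analyticAt_const hg0
  have h2 : AnalyticAt ℂ (fun t => Complex.log (g t / g 0)) 0 :=
    h1.clog (by rw [div_self hg0]; exact Complex.one_mem_slitPlane)
  refine ⟨fun t => α * Complex.exp (Complex.log (g t / g 0) / M),
    analyticAt_const.fun_mul (h2.fun_div analyticAt_const (by exact_mod_cast hM.ne')).cexp, ?_, ?_⟩
  · simp [div_self hg0]
  · filter_upwards [hg.continuousAt.eventually_ne hg0] with t ht
    rw [mul_pow, ← Complex.exp_nat_mul, mul_div_cancel₀ _ (by exact_mod_cast hM.ne'),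
      Complex.exp_log (div_ne_zero ht hg0), hα, mul_div_cancel₀ _ hg0]

variable {W W' : Set (ℂ × ℂ)} {k l m m' d e : ℕ} {s r g : ℂ → ℂ}

/-- The parametrization `y = τ ^ m`, `x = h τ`, together with a uniformizer `A` such that
`A ^ (m d) = s (t ^ d)` and whose inverse `Θ` satisfies `h (τ ^ d) = Θ τ ^ (k d)`. -/
theorem IsParam.exists_swap (h : IsParam W k s) (hm : 0 < m) (hd : 0 < d) (hg : AnalyticAt ℂ g 0)
    (hg0 : g 0 ≠ 0) (hsg : ∀ᶠ t in 𝓝 0, s t = t ^ m * g t) {α : ℂ} (hα : α ^ (m * d) = g 0) :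
    ∃ r A Θ : ℂ → ℂ, IsParam (swapCoords W) m r ∧ analyticOrderAt r 0 = k ∧
      AnalyticAt ℂ A 0 ∧ A 0 = 0 ∧ deriv A 0 = α ∧ (∀ᶠ t in 𝓝 0, A t ^ (m * d) = s (t ^ d)) ∧
      AnalyticAt ℂ Θ 0 ∧ Θ 0 = 0 ∧ (∀ᶠ t in 𝓝 0, Θ (A t) = t) ∧
      ∀ᶠ τ in 𝓝 0, r (τ ^ d) = Θ τ ^ (k * d) := by
  obtain ⟨v, hv, hv0, hvg⟩ := exists_pow_eq_of_ne_zero hg hg0 (Nat.mul_pos hm hd) hα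
  have hα0 : α ≠ 0 := by
    rintro rfl
    rw [zero_pow (Nat.mul_pos hm hd).ne'] at hα
    exact hg0 hα.symm
  let a : ℂ → ℂ := fun t => t * v t ^ d
  have ha : AnalyticAt ℂ a 0 := analyticAt_id.fun_mul (hv.fun_pow d)
  have ha0 : a 0 = 0 := by simp [a]
  have ha1 : deriv a 0 ≠ 0 := by
    rw [deriv_eq_of_eq_mul (hv.fun_pow d) (Eventually.of_forall fun t => rfl), hv0]
    exact pow_ne_zero _ hα0
  have has : ∀ᶠ t in 𝓝 0, a t ^ m = s t := by
    filter_upwards [hvg, hsg] with t h1 h2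
    simp only [a]
    rw [mul_pow, ← pow_mul, mul_comm d, h1, h2]
  obtain ⟨θ, hθ, hθ0, hθa, haθ⟩ := exists_local_inverse ha ha0 ha1
  -- `A` is a `d`-th root of `a (t ^ d)`, so its inverse is the corresponding root of `θ (τ ^ d)`.
  let A : ℂ → ℂ := fun t => t * v (t ^ d)
  have hvd := analyticAt_comp_pow hv hd
  have hA : AnalyticAt ℂ A 0 := analyticAt_id.fun_mul hvd
  have hA0 : A 0 = 0 := by simp [A]
  have hA1 : deriv A 0 = α := by
    rw [deriv_eq_of_eq_mul hvd (Eventually.of_forall fun t => rfl), zero_pow hd.ne', hv0]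
  obtain ⟨Θ, hΘ, hΘ0, hΘA, hAΘ⟩ := exists_local_inverse hA hA0 (by rwa [hA1])
  refine ⟨fun τ => θ τ ^ k, A, Θ, h.swap hm has hθ hθ0 hθa haθ, ?_, hA, hA0, hA1, ?_, hΘ, hΘ0,
    hΘA, ?_⟩
  · have h1 : analyticOrderAt θ 0 = 1 := hθ.analyticOrderAt_eq_one_of_zero_deriv_ne_zero hθ0
      (left_ne_zero_of_mul_eq_one (deriv_local_inverse ha ha0 hθ hθa))
    have h2 := analyticOrderAt_pow hθ k
    rw [h1] at h2
    simpa [Pi.pow_def] using h2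
  · filter_upwards [(tendsto_pow_zero hd).eventually hvg, (tendsto_pow_zero hd).eventually hsg]
      with t h1 h2
    simp only [A]
    rw [mul_pow, h1, h2, mul_comm m, pow_mul]
  · have hΘt : Tendsto (fun τ => Θ τ ^ d) (𝓝 0) (𝓝 0) := by
      have := hΘ.continuousAt.tendsto
      rw [hΘ0] at this
      exact (tendsto_pow_zero hd).comp this
    filter_upwards [hΘt.eventually hθa, hAΘ] with τ h1 h2
    have h3 : a (Θ τ ^ d) = τ ^ d := by
      conv_rhs => rw [← h2]
      simp only [a, A, mul_pow]
    rw [h3] at h1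
    rw [h1, ← pow_mul, mul_comm]

/-- Inversion formula. With `M = m d` and `N = k d`, `D` is `M - 1` plus the order of `A - B`, and
the exchanged difference has order `N - 1` plus the order of the difference of the inverses; these
last orders agree. -/
theorem IsParam.exists_swap_pair (h : IsParam W k s) (h' : IsParam W' l r)
    (hm : analyticOrderAt s 0 = m) (hm' : analyticOrderAt r 0 = m') (hm0 : 0 < m) (hm0' : 0 < m')
    (hd : 0 < d) (he : 0 < e) (hN : k * d = l * e) (hM : m * d = m' * e) {D : ℕ∞}
    (hD : analyticOrderAt (fun t => s (t ^ d) - r (t ^ e)) 0 = D) (hMD : ((m * d : ℕ) : ℕ∞) < D) :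
    ∃ s' r' : ℂ → ℂ, IsParam (swapCoords W) m s' ∧ IsParam (swapCoords W') m' r' ∧
      analyticOrderAt (fun t => s' (t ^ d) - r' (t ^ e)) 0 + (m * d : ℕ) = D + (k * d : ℕ) := by
  obtain ⟨g, hg, hg0, hsg⟩ := h.analyticAt.analyticOrderAt_eq_natCast.1 hm
  obtain ⟨g', hg', hg0', hrg⟩ := h'.analyticAt.analyticOrderAt_eq_natCast.1 hm'
  simp only [sub_zero, smul_eq_mul] at hsg hrg
  have hMpos : 0 < m * d := Nat.mul_pos hm0 hd
  have hNpos : 0 < k * d := Nat.mul_pos h.pos hd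
  -- With different leading coefficients the difference would have order exactly `m d`, contrary to
  -- `hMD`.
  have hgg : g 0 = g' 0 := by
    have han : AnalyticAt ℂ (fun t => g (t ^ d) - g' (t ^ e)) 0 :=
      (analyticAt_comp_pow hg hd).fun_sub (analyticAt_comp_pow hg' he)
    have h1 := analyticOrderAt_pow_mul (f := fun t => s (t ^ d) - r (t ^ e)) (n := m * d) han (by
      filter_upwards [(tendsto_pow_zero hd).eventually hsg, (tendsto_pow_zero he).eventually hrg]
        with t h1 h2
      rw [h1, h2, ← pow_mul, ← pow_mul, mul_comm d, mul_comm e, ← hM, mul_sub])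
    by_contra hne
    have h2 : g ((0 : ℂ) ^ d) - g' ((0 : ℂ) ^ e) ≠ 0 := by
      rw [zero_pow hd.ne', zero_pow he.ne']; exact sub_ne_zero.2 hne
    rw [han.analyticOrderAt_eq_zero.2 h2, add_zero, hD] at h1
    exact hMD.ne' h1
  obtain ⟨α, hα⟩ := IsAlgClosed.exists_pow_nat_eq (g 0) hMpos
  obtain ⟨s', A, Θ, hs', -, hA, hA0, hA1, hAs, hΘ, hΘ0, hΘA, hsΘ⟩ :=
    h.exists_swap hm0 hd hg hg0 hsg hα
  obtain ⟨r', B, H, hr', -, hB, hB0, hB1, hBr, hH, hH0, hHB, hrH⟩ :=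
    h'.exists_swap hm0' he hg' hg0' hrg (α := α) (by rw [← hM, hα, hgg])
  have hα0 : α ≠ 0 := by
    rintro rfl
    rw [zero_pow hMpos.ne'] at hα
    exact hg0 hα.symm
  refine ⟨s', r', hs', hr', ?_⟩
  obtain ⟨M, hM'⟩ := Nat.exists_eq_succ_of_ne_zero hMpos.ne'
  obtain ⟨N, hN'⟩ := Nat.exists_eq_succ_of_ne_zero hNpos.ne'
  have e1 : D = M + analyticOrderAt (fun t => A t - B t) 0 := by
    rw [← hD, ← analyticOrderAt_pow_sub_pow hA hB hA0 hB0 (hA1.trans hB1.symm) (by rwa [hA1])]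
    refine analyticOrderAt_congr ?_
    filter_upwards [hAs, hBr] with t h1 h2
    rw [← h1, ← h2, ← hM, hM']
  have hΘ1 := deriv_local_inverse hA hA0 hΘ hΘA
  have hH1 := deriv_local_inverse hB hB0 hH hHB
  rw [hA1] at hΘ1
  rw [hB1] at hH1
  have e2 : analyticOrderAt (fun t => s' (t ^ d) - r' (t ^ e)) 0 =
      N + analyticOrderAt (fun t => A t - B t) 0 := by
    rw [← analyticOrderAt_local_inverse_sub hA hB hA0 hB0 hΘ hH hH0 hΘA hHB,
      ← analyticOrderAt_pow_sub_pow hΘ hH hΘ0 hH0 (mul_right_cancel₀ hα0 (hΘ1.trans hH1.symm))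
        (left_ne_zero_of_mul_eq_one hΘ1)]
    refine analyticOrderAt_congr ?_
    filter_upwards [hsΘ, hrH] with t h1 h2
    rw [h1, h2, ← hN, hN']
  rw [e2, e1, hM', hN']
  push_cast
  ring

/-! ### Coefficients -/

theorem iteratedDeriv_comp_pow_div (hs : AnalyticAt ℂ s 0) (hd : 0 < d) (j : ℕ) :
    iteratedDeriv j (fun t => s (t ^ d)) 0 / (j.factorial : ℂ) =
      if d ∣ j then iteratedDeriv (j / d) s 0 / ((j / d).factorial : ℂ) else 0 := by
  have h1 := hs.hasFPowerSeriesAt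
  have h2 := (analyticAt_comp_pow hs hd).hasFPowerSeriesAt
  set c : ℕ → ℂ := fun n => iteratedDeriv n s 0 / (n.factorial : ℂ) with hc
  have h3 : HasFPowerSeriesAt (fun t => s (t ^ d))
      (FormalMultilinearSeries.ofScalars ℂ fun j => if d ∣ j then c (j / d) else 0) 0 := by
    rw [hasFPowerSeriesAt_iff]
    rw [hasFPowerSeriesAt_iff] at h1
    filter_upwards [(tendsto_pow_zero hd).eventually h1] with t ht
    simp only [FormalMultilinearSeries.coeff_ofScalars, zero_add, smul_eq_mul] at ht ⊢
    have hinj : Function.Injective fun n : ℕ => d * n := fun a b hab =>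
      Nat.eq_of_mul_eq_mul_left hd hab
    rw [← hinj.hasSum_iff]
    · convert ht using 2 with n
      simp [Nat.mul_div_cancel_left _ hd, pow_mul]
    · intro j hj
      rw [if_neg, mul_zero]
      rintro ⟨n, rfl⟩
      exact hj ⟨n, rfl⟩
  have h4 := congrArg (fun p => FormalMultilinearSeries.coeff p j)
    (h2.eq_formalMultilinearSeries h3)
  simpa only [FormalMultilinearSeries.coeff_ofScalars] using h4

theorem puiseuxCoeff_of_mul_eq {α : ℚ} {i : ℕ} (h : α * k = i) :
    puiseuxCoeff k s α = iteratedDeriv i s 0 / (i.factorial : ℂ) := by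
  rw [puiseuxCoeff, h, Nat.floor_natCast, if_pos rfl]

theorem puiseuxCoeff_of_forall_ne {α : ℚ} (h : ∀ i : ℕ, α * k ≠ i) : puiseuxCoeff k s α = 0 := by
  rw [puiseuxCoeff, if_neg fun h' => h _ h'.symm]

/-- The coefficient of `x ^ α` does not see the denominator used; two expansions can thus be
compared over a common one. -/
theorem puiseuxCoeff_comp_pow (hs : AnalyticAt ℂ s 0) (hd : 0 < d) (α : ℚ) :
    puiseuxCoeff (k * d) (fun t => s (t ^ d)) α = puiseuxCoeff k s α := by
  have hd' : (d : ℚ) ≠ 0 := by exact_mod_cast hd.ne'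
  by_cases h : ∃ j : ℕ, α * (k * d : ℕ) = j
  · obtain ⟨j, hj⟩ := h
    rw [puiseuxCoeff_of_mul_eq hj, iteratedDeriv_comp_pow_div hs hd]
    push_cast at hj
    split_ifs with hdj
    · obtain ⟨i, rfl⟩ := hdj
      rw [Nat.mul_div_cancel_left _ hd, puiseuxCoeff_of_mul_eq (i := i)]
      push_cast at hj
      refine mul_right_cancel₀ hd' ?_
      linarith
    · rw [puiseuxCoeff_of_forall_ne]
      intro i hi
      apply hdj
      refine ⟨i, ?_⟩
      rw [← mul_assoc, hi] at hj
      have : i * d = j := by exact_mod_cast hj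
      rw [← this, mul_comm]
  · simp only [not_exists] at h
    rw [puiseuxCoeff_of_forall_ne h, puiseuxCoeff_of_forall_ne]
    intro i hi
    refine h (i * d) ?_
    push_cast
    rw [← mul_assoc, hi]

/-- The quotient of an order of vanishing by a positive integer. -/
def ordRatio : ℕ∞ → ℕ → EReal
  | ⊤, _ => ⊤
  | (n : ℕ), N => (((n : ℝ) / (N : ℝ) : ℝ) : EReal)

@[simp] theorem ordRatio_top (N : ℕ) : ordRatio ⊤ N = ⊤ := rfl

@[simp] theorem ordRatio_natCast (n N : ℕ) :
    ordRatio (n : ℕ∞) N = (((n : ℝ) / (N : ℝ) : ℝ) : EReal) := rfl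

/-- Over the common denominator the first differing coefficient is the first nonzero Taylor
coefficient of the difference. -/
theorem sInf_puiseuxCoeff_ne (hs : AnalyticAt ℂ s 0) (hr : AnalyticAt ℂ r 0) (hd : 0 < d)
    (he : 0 < e) (hk : 0 < k) (hN : k * d = l * e) :
    sInf {x : EReal | ∃ γ : ℚ, puiseuxCoeff k s γ ≠ puiseuxCoeff l r γ ∧ x = ((γ : ℝ) : EReal)} =
      ordRatio (analyticOrderAt (fun t => s (t ^ d) - r (t ^ e)) 0) (k * d) := by
  have hS := analyticAt_comp_pow hs hd
  have hR := analyticAt_comp_pow hr he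
  set S : ℂ → ℂ := fun t => s (t ^ d) with hSdef
  set R : ℂ → ℂ := fun t => r (t ^ e) with hRdef
  have hcoef : ∀ γ, puiseuxCoeff k s γ = puiseuxCoeff l r γ ↔
      puiseuxCoeff (k * d) S γ = puiseuxCoeff (k * d) R γ := by
    intro γ
    rw [← puiseuxCoeff_comp_pow hs hd, ← puiseuxCoeff_comp_pow hr he (k := l), ← hN]
  simp only [Ne, hcoef]
  set N := k * d with hNdef
  have hNpos : (0 : ℚ) < N := by exact_mod_cast Nat.mul_pos hk hd
  have hsub : AnalyticAt ℂ (fun t => S t - R t) 0 := hS.fun_sub hR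
  have hdiff : ∀ i, iteratedDeriv i (fun t => S t - R t) 0 = iteratedDeriv i S 0 -
      iteratedDeriv i R 0 := fun i => iteratedDeriv_fun_sub hS.contDiffAt hR.contDiffAt
  have hne : ∀ γ, puiseuxCoeff N S γ ≠ puiseuxCoeff N R γ ↔
      ∃ i : ℕ, γ * N = i ∧ iteratedDeriv i (fun t => S t - R t) 0 ≠ 0 := by
    intro γ
    constructor
    · intro h
      by_cases hi : ∃ i : ℕ, γ * N = i
      · obtain ⟨i, hi⟩ := hi
        refine ⟨i, hi, fun h0 => h ?_⟩
        rw [hdiff] at h0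
        rw [puiseuxCoeff_of_mul_eq hi, puiseuxCoeff_of_mul_eq hi, sub_eq_zero.1 h0]
      · simp only [not_exists] at hi
        exact absurd (by rw [puiseuxCoeff_of_forall_ne hi, puiseuxCoeff_of_forall_ne hi]) h
    · rintro ⟨i, hi, h0⟩ h
      rw [puiseuxCoeff_of_mul_eq hi, puiseuxCoeff_of_mul_eq hi] at h
      apply h0
      rw [hdiff, sub_eq_zero]
      exact (div_left_inj' (by exact_mod_cast i.factorial_ne_zero)).1 h
  simp only [hne]
  cases hord : analyticOrderAt (fun t => S t - R t) 0 with
  | top =>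
    have h0 : ∀ i, iteratedDeriv i (fun t => S t - R t) 0 = 0 := fun i =>
      (natCast_le_analyticOrderAt_iff_iteratedDeriv_eq_zero (n := i + 1) hsub).1
        (by rw [hord]; exact le_top) i (Nat.lt_succ_self i)
    -- The set is empty here, and its infimum in `EReal` is `⊤`.
    simp [h0]
  | coe n =>
    obtain ⟨hlow, hn⟩ := (analyticOrderAt_eq_nat_iff_iteratedDeriv_eq_zero hsub).1 hord
    rw [ordRatio_natCast]
    refine IsLeast.csInf_eq ⟨⟨(n : ℚ) / N, ⟨n, div_mul_cancel₀ _ hNpos.ne', hn⟩, by push_cast; rfl⟩,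
      ?_⟩
    rintro x ⟨γ, ⟨i, hi, hi0⟩, rfl⟩
    have hni : n ≤ i := by
      by_contra hlt
      exact hi0 (hlow i (not_le.1 hlt))
    rw [EReal.coe_le_coe_iff, div_le_iff₀ (by exact_mod_cast hNpos)]
    have : (i : ℝ) = γ * N := by exact_mod_cast hi.symm
    rw [← this]
    exact_mod_cast hni

end PlaneCurve

end

/-! ### Invariance of orders, and tangent cones under the exchange of coordinates. -/

noncomputable section

namespace PlaneCurve

variable {W W' : Set (ℂ × ℂ)} {k l m m' d e : ℕ} {s r s' : ℂ → ℂ}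

theorem analyticOrderAt_rotate (s : ℂ → ℂ) {ζ : ℂ} (hζ : ζ ≠ 0) :
    analyticOrderAt (fun t => s (ζ * t)) 0 = analyticOrderAt s 0 := by
  have hd : deriv (fun t : ℂ => ζ * t) 0 ≠ 0 := by
    rw [deriv_eq_of_eq_mul (u := fun _ => ζ) analyticAt_const
      (Eventually.of_forall fun t => mul_comm _ _)]
    exact hζ
  have := analyticOrderAt_comp_of_deriv_ne_zero (f := s) (g := fun t : ℂ => ζ * t) (z₀ := 0)
    (by fun_prop) hd
  rwa [mul_zero] at this

theorem analyticOrderAt_fun_sub_of_ne {f g : ℂ → ℂ} {z : ℂ}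
    (h : analyticOrderAt f z ≠ analyticOrderAt g z) :
    analyticOrderAt (fun t => f t - g t) z = min (analyticOrderAt f z) (analyticOrderAt g z) := by
  have := analyticOrderAt_add_of_ne (f := f) (g := -g) (z₀ := z) (by rwa [analyticOrderAt_neg])
  rw [analyticOrderAt_neg] at this
  rw [← this, ← sub_eq_add_neg]
  rfl

theorem IsParam.analyticOrderAt_eq (h : IsParam W k s) (h' : IsParam W k s') :
    analyticOrderAt s' 0 = analyticOrderAt s 0 := by
  obtain ⟨ζ, hζ, heq⟩ := h.exists_eq_rotate h'
  rw [analyticOrderAt_congr heq, analyticOrderAt_rotate _ (ne_zero_of_pow_eq_one h.pos hζ)]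

theorem IsParam.analyticOrderAt_pos (h : IsParam W k s) (hm : analyticOrderAt s 0 = m) : 0 < m := by
  rw [Nat.pos_iff_ne_zero]
  rintro rfl
  exact analyticOrderAt_ne_zero.2 ⟨h.analyticAt, h.map_zero⟩ hm

theorem IsParam.isPuiseuxExpansion_of_le (h : IsParam W k s)
    (hk : (k : ℕ∞) ≤ analyticOrderAt s 0) : IsPuiseuxExpansion W k s := by
  refine h.isPuiseuxExpansion ?_
  obtain ⟨c, hc, hsc⟩ := (natCast_le_analyticOrderAt h.analyticAt).1 hk
  simp only [sub_zero, smul_eq_mul] at hsc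
  refine EventuallyEq.trans_isBigO hsc ?_
  have := (isBigO_refl (fun t : ℂ => t ^ k) (𝓝 0)).mul (hc.continuousAt.isBigO_one ℂ)
  simpa using this

theorem swapCoords_swapCoords (W : Set (ℂ × ℂ)) : swapCoords (swapCoords W) = W := by
  ext p; simp [swapCoords]

theorem swap_mem_tangentCone_swapCoords {v : ℂ × ℂ} (hv : v ∈ tangentCone W) :
    v.swap ∈ tangentCone (swapCoords W) := by
  obtain ⟨α, L, hL, c, δ, hδ, hδW, hcδ⟩ := exists_fun_of_mem_tangentConeAt hv
  refine mem_tangentConeAt_of_seq L c (fun n => (δ n).swap) ?_ ?_ ?_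
  · exact (continuous_swap.tendsto (0 : ℂ × ℂ)).comp hδ
  · filter_upwards [hδW] with n hn
    simpa [swapCoords] using hn
  · exact (continuous_swap.tendsto v).comp hcδ

theorem tangentCone_swapCoords : tangentCone (swapCoords W) = Prod.swap ⁻¹' tangentCone W := by
  ext v
  constructor
  · intro hv
    have := swap_mem_tangentCone_swapCoords hv
    rwa [swapCoords_swapCoords] at this
  · intro hv
    have := swap_mem_tangentCone_swapCoords hv
    rwa [Prod.swap_swap] at this

/-! ### Ratios of orders -/

theorem ordRatio_mono {D D' : ℕ∞} (h : D ≤ D') (N : ℕ) : ordRatio D N ≤ ordRatio D' N := by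
  cases D' with
  | top => exact le_top
  | coe n' =>
    obtain ⟨n, rfl⟩ := ENat.ne_top_iff_exists.1 (ne_top_of_le_ne_top (ENat.natCast_ne_top n') h)
    rw [ordRatio_natCast, ordRatio_natCast, EReal.coe_le_coe_iff]
    gcongr
    exact_mod_cast h

theorem ordRatio_lt_ordRatio {D D' : ℕ∞} {N N' : ℕ} (hN : 0 < N) (hN' : 0 < N') :
    ordRatio D N < ordRatio D' N' ↔ D * N' < D' * N := by
  have hN0 : (N : ℕ∞) ≠ 0 := by exact_mod_cast hN.ne'
  have hN0' : (N' : ℕ∞) ≠ 0 := by exact_mod_cast hN'.ne'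
  cases D with
  | top => simp [ENat.top_mul, hN0']
  | coe n =>
    cases D' with
    | top =>
      rw [ENat.top_mul hN0, ordRatio_natCast, ordRatio_top]
      refine ⟨fun _ => ?_, fun _ => EReal.coe_lt_top _⟩
      exact_mod_cast ENat.natCast_lt_top (n * N')
    | coe n' =>
      rw [ordRatio_natCast, ordRatio_natCast, EReal.coe_lt_coe_iff,
        div_lt_div_iff₀ (by exact_mod_cast hN) (by exact_mod_cast hN')]
      norm_cast

theorem ordRatio_eq_ordRatio {D D' : ℕ∞} {N N' : ℕ} (hN : 0 < N) (hN' : 0 < N') :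
    ordRatio D N = ordRatio D' N' ↔ D * N' = D' * N := by
  rw [le_antisymm_iff, ← not_lt, ← not_lt, ordRatio_lt_ordRatio hN hN',
    ordRatio_lt_ordRatio hN' hN, not_lt, not_lt, ← le_antisymm_iff]

theorem two_le_ordRatio {D : ℕ∞} {N : ℕ} (hN : 0 < N) :
    2 ≤ ordRatio (N + D) N ↔ (N : ℕ∞) ≤ D := by
  have h2 : (2 : EReal) = ordRatio ((2 : ℕ) : ℕ∞) 1 := by
    rw [ordRatio_natCast]; norm_num; rfl
  rw [h2, ← not_lt, ordRatio_lt_ordRatio hN one_pos, not_lt]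
  cases D with
  | top => simp
  | coe n => norm_cast; omega

theorem ordRatio_add_sub_one {D : ℕ∞} {N : ℕ} (hN : 0 < N) :
    ordRatio (N + D) N - 1 = ordRatio D N := by
  have hN0 : (N : ℝ) ≠ 0 := by exact_mod_cast hN.ne'
  cases D with
  | top => rw [add_top, ordRatio_top]; exact EReal.top_sub_coe 1
  | coe n =>
    rw [← Nat.cast_add, ordRatio_natCast, ordRatio_natCast, ← EReal.coe_one, ← EReal.coe_sub]
    congr 1
    push_cast
    field_simp
    ring

/-- Inversion in terms of exponents: `(kl + D) / (pl) - 1 = (D + kl - pl) / (pl) = D' / (pl)`. The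
case `D = ⊤` is equality of the germs. -/
theorem ordRatio_div_ordRatio_sub_one {D D' : ℕ∞} {k l p : ℕ} (hk : 0 < k) (hl : 0 < l)
    (hp : 0 < p) (h : D' + (p * l : ℕ) = D + (k * l : ℕ)) :
    ordRatio ((k * l : ℕ) + D) (k * l) / ordRatio p k - 1 = ordRatio D' (p * l) := by
  have hk0 : (k : ℝ) ≠ 0 := by exact_mod_cast hk.ne'
  have hl0 : (l : ℝ) ≠ 0 := by exact_mod_cast hl.ne'
  have hp0 : (p : ℝ) ≠ 0 := by exact_mod_cast hp.ne'
  have hpos : (0 : ℝ) < p / k := div_pos (by exact_mod_cast hp) (by exact_mod_cast hk)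
  cases D with
  | top =>
    have hD' : D' = ⊤ := by
      by_contra hne
      obtain ⟨n, rfl⟩ := ENat.ne_top_iff_exists.1 hne
      rw [top_add] at h
      exact ENat.natCast_ne_top (n + p * l) (by exact_mod_cast h)
    rw [hD', add_top, ordRatio_top, ordRatio_top, ordRatio_natCast,
      EReal.top_div_of_pos_ne_top (by exact_mod_cast hpos) (EReal.coe_ne_top _)]
    exact EReal.top_sub_coe 1
  | coe n =>
    have hD' : D' ≠ ⊤ := by
      rintro rfl
      rw [top_add] at h
      exact ENat.natCast_ne_top (n + k * l) (by exact_mod_cast h.symm)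
    obtain ⟨n', rfl⟩ := ENat.ne_top_iff_exists.1 hD'
    have h1 : n' + p * l = n + k * l := by exact_mod_cast h
    have h2 : (n' : ℝ) = n + k * l - p * l := by
      rw [eq_sub_iff_add_eq]; exact_mod_cast h1
    rw [← Nat.cast_add, ordRatio_natCast, ordRatio_natCast, ordRatio_natCast, ← EReal.coe_one,
      ← EReal.coe_div, ← EReal.coe_sub]
    congr 1
    push_cast
    rw [h2]
    field_simp
    ring

/-! ### Contact orders -/

/-- The orders of the differences of the parametrizations of two germs, brought to a common
denominator `k d = l e`. -/
def contactOrders (W : Set (ℂ × ℂ)) (k d : ℕ) (W' : Set (ℂ × ℂ)) (l e : ℕ) : Set ℕ∞ :=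
  {D | ∃ s r : ℂ → ℂ, IsParam W k s ∧ IsParam W' l r ∧
    D = analyticOrderAt (fun t => s (t ^ d) - r (t ^ e)) 0}

/-- Up to the choice of two roots of unity there is only one pair of parametrizations, so the set of
orders is finite. -/
theorem IsParam.exists_isGreatest (h : IsParam W k s) (h' : IsParam W' l r) (hd : 0 < d)
    (he : 0 < e) : ∃ D, IsGreatest (contactOrders W k d W' l e) D := by
  let F : ℂ × ℂ → ℕ∞ := fun q => analyticOrderAt (fun t => s (q.1 * t ^ d) - r (q.2 * t ^ e)) 0
  have hsub : contactOrders W k d W' l e ⊆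
      F '' (Polynomial.nthRootsFinset k (1 : ℂ) ×ˢ Polynomial.nthRootsFinset l (1 : ℂ) : Finset _) := by
    rintro D ⟨s', r', hs', hr', rfl⟩
    obtain ⟨ζ, hζ, hsζ⟩ := h.exists_eq_rotate hs'
    obtain ⟨ξ, hξ, hrξ⟩ := h'.exists_eq_rotate hr'
    refine ⟨(ζ, ξ), ?_, ?_⟩
    · rw [Finset.mem_coe, Finset.mem_product]
      exact ⟨(mem_roots_one h.pos).2 hζ, (mem_roots_one h'.pos).2 hξ⟩
    · refine analyticOrderAt_congr ?_
      filter_upwards [(tendsto_pow_zero hd).eventually hsζ, (tendsto_pow_zero he).eventually hrξ]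
        with t h1 h2
      rw [h1, h2]
  have hfin : (contactOrders W k d W' l e).Finite := ((Finset.finite_toSet _).image F).subset hsub
  obtain ⟨D, hD, hmax⟩ := Set.exists_max_image _ id hfin ⟨_, s, r, h, h', rfl⟩
  exact ⟨D, hD, hmax⟩

/-- The denominators are determined by the germs, so the supremum over all expansions is one over
the conjugate pairs, attained at `D`. -/
theorem contactExponentIn_eq_ordRatio (h : IsPuiseuxExpansion W k s)
    (h' : IsPuiseuxExpansion W' l r) (hd : 0 < d) (he : 0 < e) (hN : k * d = l * e) {D : ℕ∞}
    (hD : IsGreatest (contactOrders W k d W' l e) D) :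
    contactExponentIn W W' = ordRatio D (k * d) := by
  have hrot : ∀ {V : Set (ℂ × ℂ)} {n : ℕ} {u u' : ℂ → ℂ}, IsPuiseuxExpansion V n u →
      IsParam V n u' → IsPuiseuxExpansion V n u' := by
    intro V n u u' hu hu'
    refine hu'.isPuiseuxExpansion ?_
    obtain ⟨ζ, hζ, heq⟩ := hu.isParam.exists_eq_rotate hu'
    refine EventuallyEq.trans_isBigO heq ?_
    have := hu.2.2.1.comp_tendsto (tendsto_mul_zero ζ)
    refine this.congr_right fun t => ?_
    simp [mul_pow, hζ]
  refine IsGreatest.csSup_eq ⟨?_, ?_⟩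
  · obtain ⟨s₁, r₁, hs₁, hr₁, rfl⟩ := hD.1
    refine ⟨k, s₁, l, r₁, hrot h hs₁, hrot h' hr₁, ?_⟩
    rw [sInf_puiseuxCoeff_ne hs₁.analyticAt hr₁.analyticAt hd he h.1 hN]
  · rintro c ⟨k₁, s₁, l₁, r₁, hs₁, hr₁, rfl⟩
    obtain rfl := h.isParam.eq_left hs₁.isParam
    obtain rfl := h'.isParam.eq_left hr₁.isParam
    rw [sInf_puiseuxCoeff_ne hs₁.2.1 hr₁.2.1 hd he h.1 hN]
    exact ordRatio_mono (hD.2 ⟨s₁, r₁, hs₁.isParam, hr₁.isParam, rfl⟩) _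

theorem IsParam.min_le_of_mem_contactOrders (h : IsParam W k s) (h' : IsParam W' l r) (hd : 0 < d)
    (he : 0 < e) {D : ℕ∞} (hD : D ∈ contactOrders W k d W' l e) :
    min (analyticOrderAt s 0 * d) (analyticOrderAt r 0 * e) ≤ D := by
  obtain ⟨s₁, r₁, hs₁, hr₁, rfl⟩ := hD
  rw [← h.analyticOrderAt_eq hs₁, ← h'.analyticOrderAt_eq hr₁,
    ← analyticOrderAt_comp_pow hs₁.analyticAt hd, ← analyticOrderAt_comp_pow hr₁.analyticAt he]
  exact le_analyticOrderAt_sub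

/-- Different orders exclude cancellation, for every choice of conjugates. -/
theorem IsParam.isGreatest_contactOrders_of_ne (h : IsParam W k s) (h' : IsParam W' l r)
    (hd : 0 < d) (he : 0 < e) (hne : analyticOrderAt s 0 * d ≠ analyticOrderAt r 0 * e) :
    IsGreatest (contactOrders W k d W' l e)
      (min (analyticOrderAt s 0 * d) (analyticOrderAt r 0 * e)) := by
  have hmem : ∀ D ∈ contactOrders W k d W' l e,
      D = min (analyticOrderAt s 0 * d) (analyticOrderAt r 0 * e) := by
    rintro D ⟨s₁, r₁, hs₁, hr₁, rfl⟩
    rw [← h.analyticOrderAt_eq hs₁, ← h'.analyticOrderAt_eq hr₁] at hne ⊢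
    rw [← analyticOrderAt_comp_pow hs₁.analyticAt hd,
      ← analyticOrderAt_comp_pow hr₁.analyticAt he] at hne ⊢
    exact analyticOrderAt_fun_sub_of_ne hne
  refine ⟨?_, fun D hD => (hmem D hD).le⟩
  have := hmem _ ⟨s, r, h, h', rfl⟩
  rw [← this]
  exact ⟨s, r, h, h', rfl⟩

/-- The inversion formula for contact orders. -/
theorem exists_mem_contactOrders_swap (h : IsParam W k s) (h' : IsParam W' l r)
    (hm : analyticOrderAt s 0 = m) (hm' : analyticOrderAt r 0 = m')
    (hd : 0 < d) (he : 0 < e) (hN : k * d = l * e) (hM : m * d = m' * e) {D : ℕ∞}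
    (hD : D ∈ contactOrders W k d W' l e) (hMD : ((m * d : ℕ) : ℕ∞) < D) :
    ∃ D' ∈ contactOrders (swapCoords W) m d (swapCoords W') m' e,
      D' + (m * d : ℕ) = D + (k * d : ℕ) := by
  obtain ⟨s₁, r₁, hs₁, hr₁, rfl⟩ := hD
  obtain ⟨s₂, r₂, hs₂, hr₂, heq⟩ := hs₁.exists_swap_pair hr₁
    ((h.analyticOrderAt_eq hs₁).trans hm) ((h'.analyticOrderAt_eq hr₁).trans hm')
    (h.analyticOrderAt_pos hm) (h'.analyticOrderAt_pos hm') hd he hN hM rfl hMD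
  exact ⟨_, ⟨s₂, r₂, hs₂, hr₂, rfl⟩, heq⟩

/-- A germ of finite order `m` has a parametrization in the coordinates `(y, x)`. -/
theorem IsParam.exists_swap_isParam (h : IsParam W k s) (hm : analyticOrderAt s 0 = m) :
    ∃ r : ℂ → ℂ, IsParam (swapCoords W) m r ∧ analyticOrderAt r 0 = k := by
  obtain ⟨g, hg, hg0, hsg⟩ := h.analyticAt.analyticOrderAt_eq_natCast.1 hm
  simp only [sub_zero, smul_eq_mul] at hsg
  have hm0 := h.analyticOrderAt_pos hm
  obtain ⟨α, hα⟩ := IsAlgClosed.exists_pow_nat_eq (g 0) (Nat.mul_pos hm0 one_pos)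
  obtain ⟨r, -, -, hr, hrk, -⟩ := h.exists_swap hm0 one_pos hg hg0 hsg hα
  exact ⟨r, hr, hrk⟩

/-! ### The first Puiseux exponent -/

/-- Since `s` agrees with the tangent line through degree `k`, the first exponent is the contact of
the expansion with that line. -/
theorem one_lt_and_puiseuxCoeff_ne_zero_iff (hs : AnalyticAt ℂ s 0) (hk : 0 < k) {b : ℂ}
    (hb : (k : ℕ∞) < analyticOrderAt (fun t => s t - b * t ^ k) 0) (γ : ℚ) :
    1 < γ ∧ puiseuxCoeff k s γ ≠ 0 ↔
      puiseuxCoeff k s γ ≠ puiseuxCoeff 1 (fun t => b * t) γ := by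
  have hkQ : (0 : ℚ) < k := by exact_mod_cast hk
  have hlin : AnalyticAt ℂ (fun t : ℂ => b * t ^ k) 0 := by fun_prop
  have hline : puiseuxCoeff 1 (fun t => b * t) γ = puiseuxCoeff k (fun t => b * t ^ k) γ := by
    have := puiseuxCoeff_comp_pow (k := 1) (s := fun t : ℂ => b * t) (by fun_prop) hk γ
    rw [one_mul] at this
    exact this.symm
  have hder : ∀ i ≤ k, iteratedDeriv i s 0 = iteratedDeriv i (fun t : ℂ => b * t ^ k) 0 := by
    intro i hi
    have h1 : ((k + 1 : ℕ) : ℕ∞) ≤ analyticOrderAt (fun t => s t - b * t ^ k) 0 := by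
      rw [Nat.cast_add, Nat.cast_one]; exact Order.add_one_le_of_lt hb
    have h2 := (natCast_le_analyticOrderAt_iff_iteratedDeriv_eq_zero (hs.fun_sub hlin)).1 h1 i
      (by omega)
    rw [iteratedDeriv_fun_sub hs.contDiffAt hlin.contDiffAt] at h2
    exact sub_eq_zero.1 h2
  rw [hline]
  by_cases hγ : 1 < γ
  · have h0 : puiseuxCoeff k (fun t => b * t ^ k) γ = 0 := by
      by_cases hi : ∃ i : ℕ, γ * k = i
      · obtain ⟨i, hi⟩ := hi
        have hik : i ≠ k := by
          rintro rfl
          have : γ = 1 := mul_right_cancel₀ hkQ.ne' (by rw [hi, one_mul])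
          exact hγ.ne' this
        rw [puiseuxCoeff_of_mul_eq hi, iteratedDeriv_const_mul_field, iteratedDeriv_fun_pow_zero]
        simp [hik]
      · simp only [not_exists] at hi
        exact puiseuxCoeff_of_forall_ne hi
    rw [h0]
    exact and_iff_right hγ
  · refine iff_of_false (fun h => hγ h.1) (not_not.2 ?_)
    by_cases hi : ∃ i : ℕ, γ * k = i
    · obtain ⟨i, hi⟩ := hi
      have hik : i ≤ k := by
        have : (i : ℚ) ≤ k := by rw [← hi]; nlinarith [not_lt.1 hγ]
        exact_mod_cast this
      rw [puiseuxCoeff_of_mul_eq hi, puiseuxCoeff_of_mul_eq hi, hder i hik]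
    · simp only [not_exists] at hi
      rw [puiseuxCoeff_of_forall_ne hi, puiseuxCoeff_of_forall_ne hi]

theorem firstPuiseuxExponentIn_eq_ordRatio (h : IsPuiseuxExpansion W k s) {b : ℂ}
    (hb : (k : ℕ∞) < analyticOrderAt (fun t => s t - b * t ^ k) 0) :
    firstPuiseuxExponentIn W = ordRatio (analyticOrderAt (fun t => s t - b * t ^ k) 0) k := by
  have key : ∀ u : ℂ → ℂ, IsParam W k u →
      sInf {x : EReal | ∃ γ : ℚ, (1 < γ ∧ puiseuxCoeff k u γ ≠ 0) ∧ x = ((γ : ℝ) : EReal)} =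
        ordRatio (analyticOrderAt (fun t => s t - b * t ^ k) 0) k := by
    intro u hu
    obtain ⟨ζ, hζ, heq⟩ := h.isParam.exists_eq_rotate hu
    have hord : analyticOrderAt (fun t => u t - b * t ^ k) 0 =
        analyticOrderAt (fun t => s t - b * t ^ k) 0 := by
      -- The line term `b t ^ k` is fixed by the rotation, so all conjugates give the same order.
      rw [← analyticOrderAt_rotate (fun t => s t - b * t ^ k) (ne_zero_of_pow_eq_one h.1 hζ)]
      refine analyticOrderAt_congr ?_
      filter_upwards [heq] with t ht
      rw [ht, mul_pow, hζ, one_mul]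
    rw [← hord] at hb ⊢
    simp only [one_lt_and_puiseuxCoeff_ne_zero_iff hu.analyticAt h.1 hb]
    rw [sInf_puiseuxCoeff_ne (d := 1) (e := k) hu.analyticAt (by fun_prop) one_pos h.1 h.1
      (by rw [mul_one, one_mul]), mul_one]
    simp only [pow_one]
  refine le_antisymm ?_ (le_sInf ?_)
  · rw [← key s h.isParam]
    refine sInf_le_sInf ?_
    rintro x ⟨γ, ⟨h1, h2⟩, rfl⟩
    exact ⟨k, s, γ, h, h1, h2, rfl⟩
  · rintro x ⟨k₁, s₁, γ, hs₁, h1, h2, rfl⟩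
    obtain rfl := h.isParam.eq_left hs₁.isParam
    rw [← key s₁ hs₁.isParam]
    exact sInf_le ⟨γ, ⟨h1, h2⟩, rfl⟩

end PlaneCurve

end

noncomputable section

namespace PlaneCurve

variable {W W' : Set (ℂ × ℂ)} {k l p q d e : ℕ} {s r σ ρ : ℂ → ℂ} {a : ℂ}

/-! ### Germs transversal to the exceptional divisor, and germs tangent to it -/

theorem IsParam.isPuiseuxExpansion_of_eq (h : IsParam W k s) (hσ : AnalyticAt ℂ σ 0)
    (hs : ∀ᶠ t in 𝓝 0, s t = t ^ k * (a + σ t)) : IsPuiseuxExpansion W k s := by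
  refine h.isPuiseuxExpansion_of_le ?_
  rw [analyticOrderAt_pow_mul (analyticAt_const.fun_add hσ) hs]
  exact le_self_add

theorem IsParam.firstPuiseuxExponent_of_eq (h : IsParam W k s) (hσ : AnalyticAt ℂ σ 0)
    (hσ0 : σ 0 = 0) (hs : ∀ᶠ t in 𝓝 0, s t = t ^ k * (a + σ t)) (hW : IsTransversal W yAxis) :
    firstPuiseuxExponent W = ordRatio (k + analyticOrderAt σ 0) k := by
  have hord : analyticOrderAt (fun t => s t - a * t ^ k) 0 = k + analyticOrderAt σ 0 := by
    refine analyticOrderAt_pow_mul hσ ?_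
    filter_upwards [hs] with t ht
    rw [ht]; ring
  rw [firstPuiseuxExponent, if_pos hW, ← hord]
  refine firstPuiseuxExponentIn_eq_ordRatio (h.isPuiseuxExpansion_of_eq hσ hs) ?_
  rw [hord, add_comm]
  exact ENat.lt_add_left (ENat.natCast_ne_top k)
    (pos_iff_ne_zero.2 (analyticOrderAt_ne_zero.2 ⟨hσ, hσ0⟩))

theorem IsParam.exists_tangentCone_eq (h : IsParam W k s) (hk : (k : ℕ∞) ≤ analyticOrderAt s 0) :
    ∃ b : ℂ, tangentCone W = {v | v.2 = b * v.1} ∧ (b ≠ 0 → analyticOrderAt s 0 = k) := by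
  obtain ⟨c, hc, hsc⟩ := (natCast_le_analyticOrderAt h.analyticAt).1 hk
  simp only [sub_zero, smul_eq_mul] at hsc
  refine ⟨c 0, h.tangentCone_of_eq_pow_mul hc hsc, fun hb => ?_⟩
  rw [analyticOrderAt_pow_mul hc hsc, hc.analyticOrderAt_eq_zero.2 hb, add_zero]

theorem isTransversal_swapCoords_of_tangentCone (h : tangentCone W = {v | v.1 = 0}) :
    IsTransversal (swapCoords W) yAxis := by
  refine isTransversal_yAxis_of_tangentCone (b := 0) ?_
  rw [tangentCone_swapCoords, h]
  ext v
  simp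

theorem IsParam.exists_isPuiseuxExpansion_swap (h : IsParam W k s) (hp : analyticOrderAt s 0 = p)
    (hpk : p ≤ k) : ∃ r : ℂ → ℂ, IsPuiseuxExpansion (swapCoords W) p r ∧ analyticOrderAt r 0 = k := by
  obtain ⟨r, hr, hrk⟩ := h.exists_swap_isParam hp
  exact ⟨r, hr.isPuiseuxExpansion_of_le (by rw [hrk]; exact_mod_cast hpk), hrk⟩

/-- After the exchange the series has order `k` over the denominator `p < k`; its tangent line has
slope `0`. -/
theorem IsParam.firstPuiseuxExponent_of_lt (h : IsParam W k s) (hp : analyticOrderAt s 0 = p)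
    (hpk : p < k) : firstPuiseuxExponent W = ordRatio k p := by
  obtain ⟨r, hr, hrk⟩ := h.exists_isPuiseuxExpansion_swap hp hpk.le
  have hord : analyticOrderAt (fun t => r t - 0 * t ^ p) 0 = k := by
    simpa only [zero_mul, sub_zero] using hrk
  rw [firstPuiseuxExponent,
    if_neg (not_isTransversal_yAxis_of_tangentCone (h.tangentCone_of_lt hp hpk)), ← hord]
  refine firstPuiseuxExponentIn_eq_ordRatio hr ?_
  rw [hord]
  exact_mod_cast hpk

theorem contactExponent_of_tangentCone (h : tangentCone W = {v | v.1 = 0})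
    (h' : tangentCone W' = {v | v.1 = 0}) :
    contactExponent W W' = contactExponentIn (swapCoords W) (swapCoords W') := by
  rw [contactExponent, if_neg fun hc => not_isTransversal_yAxis_of_tangentCone h hc.1,
    if_pos ⟨isTransversal_swapCoords_of_tangentCone h, isTransversal_swapCoords_of_tangentCone h'⟩]

theorem IsParam.contactExponent_yAxis (h : IsParam W k s) (hp : analyticOrderAt s 0 = p)
    (hpk : p < k) : contactExponent W yAxis = ordRatio k p := by
  obtain ⟨r, hr, hrk⟩ := h.exists_isPuiseuxExpansion_swap hp hpk.le
  have hE : IsPuiseuxExpansion (swapCoords yAxis) 1 fun _ => 0 :=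
    isParam_swap_yAxis.isPuiseuxExpansion_of_le (by simp [analyticOrderAt_eq_top.2])
  have hp0 := h.analyticOrderAt_pos hp
  have htop : analyticOrderAt (fun _ : ℂ => (0 : ℂ)) 0 * p = ⊤ := by
    rw [analyticOrderAt_eq_top.2 (Eventually.of_forall fun _ => rfl),
      ENat.top_mul (by exact_mod_cast hp0.ne')]
  have hgr := hr.isParam.isGreatest_contactOrders_of_ne isParam_swap_yAxis one_pos hp0 (by
    rw [htop, hrk, Nat.cast_one, mul_one]; exact ENat.natCast_ne_top k)
  rw [htop, min_top_right, hrk, Nat.cast_one, mul_one] at hgr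
  rw [contactExponent_of_tangentCone (h.tangentCone_of_lt hp hpk) tangentCone_yAxis,
    contactExponentIn_eq_ordRatio hr hE one_pos hp0 (by ring) hgr, mul_one]

/-- The contact exponent relatively to `(y, x)` of two germs with first exponents `k / p < l / q` is
the smaller one of them. -/
theorem contactExponentIn_swap_of_lt (h : IsParam W k s) (h' : IsParam W' l r)
    (hp : analyticOrderAt s 0 = p) (hq : analyticOrderAt r 0 = q) (hpk : p ≤ k) (hql : q ≤ l)
    (hlt : k * q < l * p) :
    contactExponentIn (swapCoords W) (swapCoords W') = ordRatio k p := by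
  obtain ⟨u, hu, huk⟩ := h.exists_isPuiseuxExpansion_swap hp hpk
  obtain ⟨v, hv, hvl⟩ := h'.exists_isPuiseuxExpansion_swap hq hql
  have hp0 := h.analyticOrderAt_pos hp
  have hq0 := h'.analyticOrderAt_pos hq
  have hlt' : (k * q : ℕ∞) < l * p := by exact_mod_cast hlt
  have hgr := hu.isParam.isGreatest_contactOrders_of_ne hv.isParam hq0 hp0 (by
    rw [huk, hvl]; exact hlt'.ne)
  rw [huk, hvl, min_eq_left hlt'.le] at hgr
  rw [contactExponentIn_eq_ordRatio hu hv hq0 hp0 (mul_comm _ _) hgr,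
    ordRatio_eq_ordRatio (Nat.mul_pos hp0 hq0) hp0]
  push_cast
  ring

/-! ### Contact before and after the blow up -/

/-- For each pair of conjugates the difference downstairs is `t ^ (k d)` times the difference of the
strict transforms, since the terms with `a` cancel. -/
theorem isGreatest_contactOrders_of_strictTransform {Y Z Y' Z' : Set (ℂ × ℂ)} {D : ℕ∞}
    (hY : IsParam Y k s) (hZ : IsParam Z l r) (hY' : IsParam Y' k σ) (hZ' : IsParam Z' l ρ)
    (hs : ∀ᶠ t in 𝓝 0, s t = t ^ k * (a + σ t)) (hr : ∀ᶠ t in 𝓝 0, r t = t ^ l * (a + ρ t))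
    (hd : 0 < d) (he : 0 < e) (hN : k * d = l * e) (hD : IsGreatest (contactOrders Y' k d Z' l e) D) :
    IsGreatest (contactOrders Y k d Z l e) ((k * d : ℕ) + D) := by
  have key : ∀ ζ ξ : ℂ, ζ ^ k = 1 → ξ ^ l = 1 → ∀ s₁ r₁ σ₁ ρ₁ : ℂ → ℂ,
      (s₁ =ᶠ[𝓝 0] fun t => s (ζ * t)) → (r₁ =ᶠ[𝓝 0] fun t => r (ξ * t)) →
      (σ₁ =ᶠ[𝓝 0] fun t => σ (ζ * t)) → (ρ₁ =ᶠ[𝓝 0] fun t => ρ (ξ * t)) →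
      AnalyticAt ℂ σ₁ 0 → AnalyticAt ℂ ρ₁ 0 →
      analyticOrderAt (fun t => s₁ (t ^ d) - r₁ (t ^ e)) 0 =
        (k * d : ℕ) + analyticOrderAt (fun t => σ₁ (t ^ d) - ρ₁ (t ^ e)) 0 := by
    intro ζ ξ hζ hξ s₁ r₁ σ₁ ρ₁ hs₁ hr₁ hσ₁ hρ₁ hσa hρa
    refine analyticOrderAt_pow_mul
      ((analyticAt_comp_pow hσa hd).fun_sub (analyticAt_comp_pow hρa he)) ?_
    have h1 := hs₁.and (((tendsto_mul_zero ζ).eventually hs).and hσ₁)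
    have h2 := hr₁.and (((tendsto_mul_zero ξ).eventually hr).and hρ₁)
    filter_upwards [(tendsto_pow_zero hd).eventually h1, (tendsto_pow_zero he).eventually h2]
      with t ⟨e1, e2, e3⟩ ⟨f1, f2, f3⟩
    rw [e1, e2, e3, f1, f2, f3, mul_pow, mul_pow, hζ, hξ, ← pow_mul, ← pow_mul, mul_comm d,
      mul_comm e, ← hN]
    ring
  constructor
  · obtain ⟨σ₁, ρ₁, hσ₁, hρ₁, rfl⟩ := hD.1
    obtain ⟨ζ, hζ, hσζ⟩ := hY'.exists_eq_rotate hσ₁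
    obtain ⟨ξ, hξ, hρξ⟩ := hZ'.exists_eq_rotate hρ₁
    exact ⟨_, _, hY.rotate hζ, hZ.rotate hξ, (key ζ ξ hζ hξ _ _ _ _ EventuallyEq.rfl
      EventuallyEq.rfl hσζ hρξ hσ₁.analyticAt hρ₁.analyticAt).symm⟩
  · rintro _ ⟨s₁, r₁, hs₁, hr₁, rfl⟩
    obtain ⟨ζ, hζ, hsζ⟩ := hY.exists_eq_rotate hs₁
    obtain ⟨ξ, hξ, hrξ⟩ := hZ.exists_eq_rotate hr₁
    rw [key ζ ξ hζ hξ _ _ _ _ hsζ hrξ EventuallyEq.rfl EventuallyEq.rfl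
      (hY'.rotate hζ).analyticAt (hZ'.rotate hξ).analyticAt]
    gcongr
    exact hD.2 ⟨_, _, hY'.rotate hζ, hZ'.rotate hξ, rfl⟩

/-- Exchanging the coordinates turns the greatest contact order `D` into `D + k d - p d`. -/
theorem exists_isGreatest_contactOrders_swap (h : IsParam W k s) (h' : IsParam W' l r)
    (hp : analyticOrderAt s 0 = p) (hq : analyticOrderAt r 0 = q) (hd : 0 < d) (he : 0 < e)
    (hN : k * d = l * e) (hM : p * d = q * e) {D : ℕ∞}
    (hD : IsGreatest (contactOrders W k d W' l e) D) :
    ∃ D', IsGreatest (contactOrders (swapCoords W) p d (swapCoords W') q e) D' ∧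
      D' + (p * d : ℕ) = D + (k * d : ℕ) := by
  obtain ⟨u, hu, huk⟩ := h.exists_swap_isParam hp
  obtain ⟨v, hv, hvl⟩ := h'.exists_swap_isParam hq
  obtain ⟨D', hD'⟩ := hu.exists_isGreatest hv hd he
  have hMD : ((p * d : ℕ) : ℕ∞) ≤ D := by
    have := h.min_le_of_mem_contactOrders h' hd he hD.1
    rw [hp, hq] at this
    norm_cast at this
    rwa [← hM, min_self] at this
  have hND : ((k * d : ℕ) : ℕ∞) ≤ D' := by
    have := hu.min_le_of_mem_contactOrders hv hd he hD'.1
    rw [huk, hvl] at this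
    norm_cast at this
    rwa [← hN, min_self] at this
  refine ⟨D', hD', le_antisymm ?_ ?_⟩
  -- The inversion formula needs a strict inequality; at the minimal order the bound is immediate.
  -- Both inequalities are needed, one by exchanging the coordinates back.
  · rcases hND.eq_or_lt with heq | hlt
    · rw [← heq, add_comm]
      gcongr
    · obtain ⟨D'', hD'', heq⟩ := exists_mem_contactOrders_swap hu hv huk hvl hd he hM hN hD'.1 hlt
      rw [swapCoords_swapCoords, swapCoords_swapCoords] at hD''
      rw [← heq]
      gcongr
      exact hD.2 hD''
  · rcases hMD.eq_or_lt with heq | hlt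
    · rw [← heq, add_comm]
      gcongr
    · obtain ⟨D'', hD'', heq⟩ := exists_mem_contactOrders_swap h h' hp hq hd he hN hM hD.1 hlt
      rw [← heq]
      gcongr
      exact hD'.2 hD''

end PlaneCurve

end

/-! ### Contact exponents in the transversal and mixed cases. -/

noncomputable section

namespace PlaneCurve

variable {W W' : Set (ℂ × ℂ)} {k l p q : ℕ} {s r : ℂ → ℂ}

theorem ordRatio_strictMono {N : ℕ} (hN : 0 < N) : StrictMono fun D => ordRatio D N := by
  intro D D' h
  rw [ordRatio_lt_ordRatio hN hN]
  exact ENat.mul_left_strictMono (by exact_mod_cast hN.ne') (ENat.natCast_ne_top N) h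

theorem IsParam.isTransversal_yAxis (h : IsParam W k s) (hk : (k : ℕ∞) ≤ analyticOrderAt s 0) :
    IsTransversal W yAxis := by
  obtain ⟨b, hb, -⟩ := h.exists_tangentCone_eq hk
  exact isTransversal_yAxis_of_tangentCone hb

theorem IsParam.contactExponent_of_le (h : IsParam W k s) (h' : IsParam W' l r)
    (hk : (k : ℕ∞) ≤ analyticOrderAt s 0) (hl : (l : ℕ∞) ≤ analyticOrderAt r 0) {D : ℕ∞}
    (hD : IsGreatest (contactOrders W k l W' l k) D) :
    contactExponent W W' = ordRatio D (k * l) := by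
  rw [contactExponent, if_pos ⟨h.isTransversal_yAxis hk, h'.isTransversal_yAxis hl⟩,
    contactExponentIn_eq_ordRatio (h.isPuiseuxExpansion_of_le hk) (h'.isPuiseuxExpansion_of_le hl)
      h'.pos h.pos (mul_comm _ _) hD]

/-- If `W` is also transversal to `{y = 0}`, its order is `k` and the contact in `(y, x)` is `k /
k`, the smaller first order; otherwise the value is the convention. -/
theorem IsParam.contactExponent_eq_one (h : IsParam W k s) (h' : IsParam W' l r)
    (hk : (k : ℕ∞) ≤ analyticOrderAt s 0) (hq : analyticOrderAt r 0 = q) (hql : q < l) :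
    contactExponent W W' = 1 := by
  obtain ⟨b, hb, hbk⟩ := h.exists_tangentCone_eq hk
  have hW' := h'.tangentCone_of_lt hq hql
  rw [contactExponent, if_neg fun hc => not_isTransversal_yAxis_of_tangentCone hW' hc.2]
  split_ifs with hc
  · have hb0 : b ≠ 0 := by
      rintro rfl
      refine not_isTransversal_yAxis_of_tangentCone (W := swapCoords W) ?_ hc.1
      rw [tangentCone_swapCoords, hb]
      ext v
      simp
    rw [contactExponentIn_swap_of_lt h h' (hbk hb0) hq le_rfl hql.le
      (by rw [mul_comm]; exact Nat.mul_lt_mul_of_pos_right hql h.pos), ordRatio_natCast,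
      div_self (by exact_mod_cast h.pos.ne')]
    rfl
  · rfl

end PlaneCurve

end

/-! ### The behaviour of exponents under the blow up. -/

theorem theorem2p2 (a : ℂ) (Y Z : Set (ℂ × ℂ))
    (hY : PlaneCurve.IsIrreduciblePlaneCurve Y) (hZ : PlaneCurve.IsIrreduciblePlaneCurve Z)
    (hYa : PlaneCurve.tangentCone Y = {v | v.2 = a * v.1})
    (hZa : PlaneCurve.tangentCone Z = {v | v.2 = a * v.1})
    (Y' Z' E : Set (ℂ × ℂ))
    (hY' : Y' = PlaneCurve.strictTransform a Y) (hZ' : Z' = PlaneCurve.strictTransform a Z)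
    (hE : E = PlaneCurve.exceptionalDivisor a)
    (μ ν μ' ν' : EReal)
    (hμ : μ = PlaneCurve.firstPuiseuxExponent Y) (hν : ν = PlaneCurve.firstPuiseuxExponent Z)
    (hμ' : μ' = PlaneCurve.firstPuiseuxExponent Y')
    (hν' : ν' = PlaneCurve.firstPuiseuxExponent Z')
    (hνμ : ν ≤ μ) :
    (2 ≤ ν →
      PlaneCurve.contactExponent Y' Z' = PlaneCurve.contactExponent Y Z - 1 ∧
      PlaneCurve.IsTransversal Y' E ∧ PlaneCurve.IsTransversal Z' E) ∧
    (ν < 2 → 2 ≤ μ →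
      PlaneCurve.contactExponent Y' Z' = 1 ∧ PlaneCurve.IsTangent Z' E) ∧
    (μ < 2 →
      PlaneCurve.IsTangent Y' E ∧ PlaneCurve.IsTangent Z' E ∧ μ' ≤ ν' ∧
      (μ < PlaneCurve.contactExponent Y Z →
        μ = ν ∧ μ' = ν' ∧
        PlaneCurve.contactExponent Y' E = μ' ∧ PlaneCurve.contactExponent Z' E = μ' ∧
        μ' < PlaneCurve.contactExponent Y Z / (μ - 1) - 1 ∧
        PlaneCurve.contactExponent Y' Z' = PlaneCurve.contactExponent Y Z / (μ - 1) - 1) ∧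
      (PlaneCurve.contactExponent Y Z = μ →
        μ = ν ∧
        PlaneCurve.contactExponent Y' E = μ' ∧ PlaneCurve.contactExponent Z' E = μ' ∧
        μ' = ν' ∧ PlaneCurve.contactExponent Y' Z' = μ') ∧
      (PlaneCurve.contactExponent Y Z < μ →
        PlaneCurve.contactExponent Y Z = ν ∧
        PlaneCurve.contactExponent Y' E = μ' ∧ PlaneCurve.contactExponent Y' Z' = μ' ∧
        μ' < ν' ∧ PlaneCurve.contactExponent Z' E = ν')) := by
  open PlaneCurve in
  rw [exceptionalDivisor_eq] at hE
  subst hE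
  obtain ⟨k, s, σ, hs, hσ, hσ0, hsσ⟩ := hY.exists_isParam_of_tangentCone hYa
  obtain ⟨l, r, ρ, hr, hρ, hρ0, hrρ⟩ := hZ.exists_isParam_of_tangentCone hZa
  have hσ' := hs.strictTransform hσ hσ0 hsσ
  have hρ' := hr.strictTransform hρ hρ0 hrρ
  rw [← hY'] at hσ'
  rw [← hZ'] at hρ'
  have hk := hs.pos
  have hl := hr.pos
  have hkl := Nat.mul_pos hk hl
  rw [hs.firstPuiseuxExponent_of_eq hσ hσ0 hsσ (isTransversal_yAxis_of_tangentCone hYa)] at hμ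
  rw [hr.firstPuiseuxExponent_of_eq hρ hρ0 hrρ (isTransversal_yAxis_of_tangentCone hZa)] at hν
  -- `D` belongs to the strict transforms, over the common denominator `k l`; downstairs it becomes
  -- `k l + D`.
  obtain ⟨D, hD⟩ := hσ'.exists_isGreatest hρ' hl hk
  have ho : contactExponent Y Z = ordRatio ((k * l : ℕ) + D) (k * l) := by
    rw [contactExponent, if_pos ⟨isTransversal_yAxis_of_tangentCone hYa,
      isTransversal_yAxis_of_tangentCone hZa⟩]
    exact contactExponentIn_eq_ordRatio (hs.isPuiseuxExpansion_of_eq hσ hsσ)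
      (hr.isPuiseuxExpansion_of_eq hρ hrρ) hl hk (mul_comm _ _)
      (isGreatest_contactOrders_of_strictTransform hs hr hσ' hρ' hsσ hrρ hl hk (mul_comm _ _) hD)
  have hμ2 : 2 ≤ μ ↔ (k : ℕ∞) ≤ analyticOrderAt σ 0 := by rw [hμ, two_le_ordRatio hk]
  have hν2 : 2 ≤ ν ↔ (l : ℕ∞) ≤ analyticOrderAt ρ 0 := by rw [hν, two_le_ordRatio hl]
  have hord : ∀ {τ : ℂ → ℂ} {n : ℕ}, ¬ (n : ℕ∞) ≤ analyticOrderAt τ 0 →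
      ∃ m : ℕ, analyticOrderAt τ 0 = m ∧ m < n := by
    intro τ n hn
    obtain ⟨m, hm⟩ := ENat.ne_top_iff_exists.1 (ne_top_of_lt (not_le.1 hn))
    rw [← hm] at hn
    exact ⟨m, hm.symm, by exact_mod_cast not_le.1 hn⟩
  refine ⟨fun h2ν => ?_, fun hν2' h2μ => ?_, fun hμ2' => ?_⟩
  · have hkσ := hμ2.1 (h2ν.trans hνμ)
    have hlρ := hν2.1 h2ν
    refine ⟨?_, hσ'.isTransversal_yAxis hkσ, hρ'.isTransversal_yAxis hlρ⟩
    rw [ho, hσ'.contactExponent_of_le hρ' hkσ hlρ hD, ordRatio_add_sub_one hkl]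
  · obtain ⟨q, hq, hql⟩ := hord fun h => hν2'.not_ge (hν2.2 h)
    refine ⟨hσ'.contactExponent_eq_one hρ' (hμ2.1 h2μ) hq hql, ?_⟩
    exact (hρ'.tangentCone_of_lt hq hql).trans tangentCone_yAxis.symm
  · obtain ⟨p, hp, hpk⟩ := hord fun h => hμ2'.not_ge (hμ2.2 h)
    obtain ⟨q, hq, hql⟩ := hord fun h => (hνμ.trans_lt hμ2').not_ge (hν2.2 h)
    have hp0 := hσ'.analyticOrderAt_pos hp
    have hq0 := hρ'.analyticOrderAt_pos hq
    have hYt := hσ'.tangentCone_of_lt hp hpk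
    have hZt := hρ'.tangentCone_of_lt hq hql
    rw [hσ'.contactExponent_yAxis hp hpk, hρ'.contactExponent_yAxis hq hql]
    rw [hσ'.firstPuiseuxExponent_of_lt hp hpk] at hμ'
    rw [hρ'.firstPuiseuxExponent_of_lt hq hql] at hν'
    rw [hp] at hμ
    rw [hq] at hν
    have hν_lt : ν < μ ↔ q * k < p * l := by
      rw [hν, hμ, ordRatio_lt_ordRatio hl hk]
      norm_cast
      rw [add_mul, add_mul, mul_comm l k, add_lt_add_iff_left]
    have hν_eq : μ = ν ↔ p * l = q * k := by
      rw [hν, hμ, ordRatio_eq_ordRatio hk hl]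
      norm_cast
      rw [add_mul, add_mul, mul_comm l k, add_right_inj]
    have hqp : q * k ≤ p * l := by
      rcases hνμ.lt_or_eq with h | h
      · exact (hν_lt.1 h).le
      · exact (hν_eq.1 h.symm).ge
    have hν_lt' : μ' < ν' ↔ k * q < l * p := by
      rw [hμ', hν', ordRatio_lt_ordRatio hp0 hq0]
      norm_cast
    have hν_eq' : μ' = ν' ↔ k * q = l * p := by
      rw [hμ', hν', ordRatio_eq_ordRatio hp0 hq0]
      norm_cast
    rw [ho, contactExponent_of_tangentCone hYt hZt]
    refine ⟨hYt.trans tangentCone_yAxis.symm, hZt.trans tangentCone_yAxis.symm, ?_⟩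
    -- `q k < p l` is `ν < μ`: then `D = q k`, the contact downstairs is `ν`, and only (c) can
    -- occur. Equality leaves (a) and (b).
    rcases hqp.lt_or_eq with hlt | heq
    · have hlt' : k * q < l * p := by rwa [mul_comm k, mul_comm l]
      have hgr := hσ'.isGreatest_contactOrders_of_ne hρ' hl hk (by
        rw [hp, hq]; exact_mod_cast hlt.ne')
      rw [hp, hq, min_eq_right (by exact_mod_cast hlt.le)] at hgr
      have hoν : ordRatio ((k * l : ℕ) + D) (k * l) = ν := by
        rw [hD.unique hgr, hν, ordRatio_eq_ordRatio hkl hl]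
        norm_cast
        ring
      have hνμ' := hν_lt.2 hlt
      rw [hoν, contactExponentIn_swap_of_lt hσ' hρ' hp hq hpk.le hql.le hlt']
      exact ⟨(hν_lt'.2 hlt').le, fun h => absurd h hνμ'.not_gt, fun h => absurd h hνμ'.ne,
        fun _ => ⟨rfl, hμ'.symm, hμ'.symm, hν_lt'.2 hlt', hν'.symm⟩⟩
    · have heq' : μ' = ν' := hν_eq'.2 (by rw [mul_comm k, mul_comm l, heq])
      have hμν : μ = ν := hν_eq.2 heq.symm
      obtain ⟨D', hD', hDD'⟩ := exists_isGreatest_contactOrders_swap hσ' hρ' hp hq hl hk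
        (mul_comm _ _) heq.symm hD
      obtain ⟨u, hu, -⟩ := hσ'.exists_isPuiseuxExpansion_swap hp hpk.le
      obtain ⟨v, hv, -⟩ := hρ'.exists_isPuiseuxExpansion_swap hq hql.le
      have ho' := contactExponentIn_eq_ordRatio hu hv hl hk heq.symm hD'
      have hoo' : ordRatio D' (p * l) =
          ordRatio ((k * l : ℕ) + D) (k * l) / (μ - 1) - 1 := by
        rw [hμ, ordRatio_add_sub_one hk, ordRatio_div_ordRatio_sub_one hk hl hp0 hDD']
      have hμ_eq : μ = ordRatio ((k * l : ℕ) + (p * l : ℕ)) (k * l) := by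
        rw [hμ, ordRatio_eq_ordRatio hk hkl]
        norm_cast
        ring
      have hμ_eq' : μ' = ordRatio (k * l : ℕ) (p * l) := by
        rw [hμ', ordRatio_eq_ordRatio hp0 (Nat.mul_pos hp0 hl)]
        norm_cast
        ring
      -- Both pulled back series have order `p l`, so the contact downstairs is at least `μ`, which
      -- excludes (c).
      have hpD : ((p * l : ℕ) : ℕ∞) ≤ D := by
        have := hσ'.min_le_of_mem_contactOrders hρ' hl hk hD.1
        rw [hp, hq] at this
        norm_cast at this
        rwa [heq, min_self] at this
      have hpl := Nat.mul_pos hp0 hl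
      rw [ho', ← hoo', ← heq', ← hμ', show ordRatio l q = μ' from hν'.symm.trans heq'.symm]
      refine ⟨le_rfl, fun h => ⟨hμν, rfl, rfl, rfl, ?_, rfl⟩, fun h => ⟨hμν, rfl, rfl, rfl, ?_⟩,
        fun h => absurd h (not_lt.2 ?_)⟩
      -- The hypothesis says `p l < D`; by the inversion formula `D' + p l = D + k l` this gives `k
      -- l < D'`.
      · rw [hμ_eq, (ordRatio_strictMono hkl).lt_iff_lt,
          ENat.add_lt_add_iff_left (ENat.natCast_ne_top _)] at h
        rw [hμ_eq', (ordRatio_strictMono hpl).lt_iff_lt]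
        by_contra hle
        have h1 := add_le_add_left (not_lt.1 hle) ((p * l : ℕ) : ℕ∞)
        rw [hDD', add_comm, ENat.add_le_add_iff_left (ENat.natCast_ne_top _)] at h1
        exact h1.not_gt h
      · rw [hμ_eq, (ordRatio_strictMono hkl).injective.eq_iff,
          (ENat.add_right_injective_of_ne_top (ENat.natCast_ne_top _)).eq_iff] at h
        rw [h, add_comm, (ENat.add_right_injective_of_ne_top (ENat.natCast_ne_top _)).eq_iff] at hDD'
        rw [hμ_eq', hDD']
      · rw [hμ_eq]
        exact ordRatio_mono (by gcongr) _
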